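/- Let $\lambda, v, p, w>0$ and $\beta>2$. Let $\Phi$ be a homogeneous Poisson point process of intensity $\lambda$ in $\mathbb{R}^2$ (the nodes), and let a user move from the origin at time $t=0$ along a straight line with constant speed $v$. Let $L(t)$ be the distance at time $t\ge 0$ from the user to the closest point of $\Phi$, and let $\mathrm{SNR}(t)=p\,L(t)^{-\beta}/w$ (which is $+\infty$ if $L(t)=0$, and $0$ if $\Phi=\emptyset$). For $\gamma>0$ let $C^{(\gamma)}(t)=\mathbf 1(\mathrm{SNR}(t)\ge\gamma)$ be the SNR level crossing process and $r_\gamma=\left(\frac{p}{w\gamma}\right)^{1/\beta}$ the radius of coverage. The up-crossings are the times $t>0$ such that $C^{(\gamma)}(t)=1$ and $C^{(\gamma)}=0$ on $(t-\varepsilon,t)$ for some $\varepsilon>0$; let $T^{(\gamma)}_1<T^{(\gamma)}_2<\cdots$ be their increasing enumeration. (1) For every $\gamma>0$, almost surely there are infinitely many up-crossings and they are exhausted by the strictly increasing sequence $(T^{(\gamma)}_n)_{n\ge1}$. This sequence is a (delayed) renewal process: the inter-arrival times $T^{(\gamma)}_{n+1}-T^{(\gamma)}_n$, $n\ge1$,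 are almost surely positive, identically distributed, independent of each other and jointly independent of the first epoch $T^{(\gamma)}_1$, whose law may differ. Let $V^{(\gamma)}$ be a typical inter-arrival time, that is, a random variable with the common law of $T^{(\gamma)}_{n+1}-T^{(\gamma)}_n$, $n\ge1$. Then: (2) with $f(\gamma)=2\lambda v r_\gamma$, the random variable $f(\gamma)V^{(\gamma)}$ converges in distribution to $\mathrm{Exp}(1)$ as $\gamma\to\infty$; (3) with $g(\gamma)=2\lambda v r_\gamma e^{-\lambda\pi r_\gamma^2}$, the random variable $g(\gamma)V^{(\gamma)}$ converges in distribution to $\mathrm{Exp}(1)$ as $\gamma\to0^+$. -/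

import Mathlib

open MeasureTheory ProbabilityTheory Filter Topology
open scoped ENNReal NNReal

noncomputable section

namespace PoissonCellular

/-- The Euclidean plane. -/
abbrev Plane : Type := EuclideanSpace ℝ (Fin 2)

/-- `Φ` is a homogeneous Poisson point process of intensity `lam` in the plane: a random locally
finite set of points whose counts in Borel sets are random variables, with the Poisson law of
mean `lam * |A|` for every Borel set `A` of finite area, and independent on disjoint Borel sets. -/
structure IsPoissonPointProcess {Ω : Type*} [MeasurableSpace Ω] (Φ : Ω → Set Plane) (lam : ℝ)
    (P : Measure Ω) : Prop where
  locallyFinite : ∀ ω, ∀ R : ℝ, (Φ ω ∩ Metric.closedBall 0 R).Finite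
  measurable_count : ∀ A : Set Plane, MeasurableSet A → Measurable fun ω => (Φ ω ∩ A).encard
  law_count : ∀ A : Set Plane, MeasurableSet A → volume A ≠ ∞ →
    HasLaw (fun ω => (Φ ω ∩ A).encard)
      ((poissonMeasure (lam.toNNReal * (volume A).toNNReal)).map (fun n : ℕ => (n : ℕ∞))) P
  indep_count : ∀ A : ℕ → Set Plane, (∀ i, MeasurableSet (A i)) →
    Pairwise (fun i j => Disjoint (A i) (A j)) →
    iIndepFun (fun i ω => (Φ ω ∩ A i).encard) P

/-- Location at time `t` of a user who starts at the origin and moves with speed `v` along the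
direction `u`. -/
def userPosition (v : ℝ) (u : Plane) (t : ℝ) : Plane := (v * t) • u

/-- Distance `L(t)` from the user to the closest node of the configuration `S` (it is `∞` if there
is no node at all). -/
def nodeDistance (S : Set Plane) (v : ℝ) (u : Plane) (t : ℝ) : ℝ≥0∞ :=
  Metric.infEDist (userPosition v u t) S

/-- The signal-to-noise ratio `p L(t)^(-β) / w`, which is `∞` when `L(t) = 0` and `0` when
`L(t) = ∞`. -/
def snr (p w β : ℝ) (S : Set Plane) (v : ℝ) (u : Plane) (t : ℝ) : ℝ≥0∞ :=
  ENNReal.ofReal p * nodeDistance S v u t ^ (-β) / ENNReal.ofReal w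

open Classical in
/-- The SNR level crossing process `C(t) = 1(SNR(t) ≥ γ)`. -/
def levelCrossing (p w β γ : ℝ) (S : Set Plane) (v : ℝ) (u : Plane) (t : ℝ) : ℕ :=
  if ENNReal.ofReal γ ≤ snr p w β S v u t then 1 else 0

/-- The SNR up-crossing times: the times `t > 0` at which the level crossing process switches
from `0` to `1`. -/
def upCrossings (p w β γ : ℝ) (S : Set Plane) (v : ℝ) (u : Plane) : Set ℝ :=
  {t | 0 < t ∧ (∀ᶠ s in 𝓝[<] t, levelCrossing p w β γ S v u s = 0) ∧
    levelCrossing p w β γ S v u t = 1}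

/-- The successive elements of a set of times, in increasing order, starting with index `0`.
(This is meaningful for infinite, locally finite sets that are bounded below.) -/
def successive (U : Set ℝ) : ℕ → ℝ
  | 0 => sInf U
  | n + 1 => sInf {t | t ∈ U ∧ successive U n < t}

/-- The `(n + 1)`-st SNR up-crossing time. -/
def upCrossingTime (p w β γ : ℝ) (S : Set Plane) (v : ℝ) (u : Plane) (n : ℕ) : ℝ :=
  successive (upCrossings p w β γ S v u) n

/-- The `(n + 1)`-st inter-arrival time between successive SNR up-crossings. -/
def interArrival (p w β γ : ℝ) (S : Set Plane) (v : ℝ) (u : Plane) (n : ℕ) : ℝ :=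
  upCrossingTime p w β γ S v u (n + 1) - upCrossingTime p w β γ S v u n

/-- The radius of coverage `r_γ = (p / (w γ))^(1/β)`. -/
def coverageRadius (p w β γ : ℝ) : ℝ := (p / (w * γ)) ^ (1 / β)

/-- The random times `T 0 < T 1 < ⋯` form a (delayed) renewal process: the inter-arrival times
`T (n + 1) - T n` are positive and identically distributed, and they are independent of each other
and of the first epoch `T 0`, whose law may be different. -/
structure IsRenewalProcess {Ω : Type*} [MeasurableSpace Ω] (T : ℕ → Ω → ℝ) (P : Measure Ω) :
    Prop where
  aemeasurable : ∀ n, AEMeasurable (T n) P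
  nonneg : ∀ᵐ ω ∂P, 0 ≤ T 0 ω
  increasing : ∀ᵐ ω ∂P, ∀ n, T n ω < T (n + 1) ω
  indep : iIndepFun (fun (n : ℕ) ω => if n = 0 then T 0 ω else T n ω - T (n - 1) ω) P
  identDistrib : ∀ n, IdentDistrib (fun ω => T (n + 1) ω - T n ω) (fun ω => T 1 ω - T 0 ω) P P

instance isProbabilityMeasure_expMeasure_one : IsProbabilityMeasure (expMeasure 1) :=
  isProbabilityMeasure_expMeasure one_pos

end PoissonCellular

end

/-!
For a user moving along a line, a node at distance at most `r` from the line is within distance `r`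
of the user exactly during a time interval. The pairs (start, length) of these intervals form a
Poisson process on `ℝ × ℝ`: the intervals start at rate `f = 2λvr`, and their lengths are
independent, distributed like a random chord of a disk of radius `r` divided by `v`. The
up-crossings are the starts of intervals at vacant times, that is, the starts of the busy periods of
an `M/G/∞` queue.

By Mecke's formula, the intervals that start after an up-crossing are independent of the past and
distributed like those after time `0`, whence the renewal property and the common tail `F` of the
inter-arrival times. Decomposing with respect to the last up-crossing before time `t` gives
`1 = F t + ∫ a in 0..t, ρ a * F (t - a)`, where `ρ a` is the rate of the up-crossings at time `a`
after a given one. For `a` larger than the longest chord, `ρ a` is the constant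
`g = f * exp (-(λπr²))`, so that a Grönwall argument bounds `|F t - exp (-(g * t))|` by the integral
of `ρ + g` over `[0, 2r/v]`, up to a factor `exp (g * t)`. This integral vanishes as `r → 0`
because `ρ ≤ f`, and as `r → ∞` because an up-crossing at time `a ≤ d = 2r/v` requires that the
first interval is shorter than `a`, which has probability at most `(a / d)²`, and that `a` is
vacant, which has probability at most `exp (-3fa/8)`.
-/

noncomputable section

namespace PoissonCellular

section SFiniteKernel

variable {α β : Type*} [MeasurableSpace α] [MeasurableSpace β]

lemma isSFiniteKernel_of_forall_isFiniteMeasure {κ : Kernel α β}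
    (hκ : ∀ a, IsFiniteMeasure (κ a)) : IsSFiniteKernel κ := by
  classical
  let size : α → ℕ := fun a => ⌊(κ a Set.univ).toNNReal⌋₊
  have hsize : ∀ n, MeasurableSet {a | size a = n} := fun n =>
    (Nat.measurable_floor.comp
      (κ.measurable_coe MeasurableSet.univ).ennreal_toNNReal) (measurableSet_singleton n)
  let layer : ℕ → Kernel α β := fun n => Kernel.piecewise (hsize n) κ 0
  have hlayer : ∀ n, IsFiniteKernel (layer n) := fun n => by
    refine ⟨⟨n + 1, by finiteness, fun a => ?_⟩⟩
    simp only [layer, Kernel.piecewise_apply']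
    split_ifs with ha
    · have hlt := Nat.lt_floor_add_one (κ a Set.univ).toNNReal
      rw [show ⌊(κ a Set.univ).toNNReal⌋₊ = n from ha] at hlt
      rw [← ENNReal.coe_toNNReal (measure_ne_top (κ a) Set.univ)]
      exact_mod_cast hlt.le
    · simp
  have hsum : κ = Kernel.sum layer := by
    ext a A hA
    rw [Kernel.sum_apply' _ _ hA, tsum_eq_single (size a)]
    · simp [layer, Kernel.piecewise_apply']
    · intro n hn
      simp [layer, Kernel.piecewise_apply', hn.symm]
  rw [hsum]
  infer_instance

lemma isSFiniteKernel_of_restrict {ι : Type*} [Countable ι] {κ : Kernel α β} {B : ι → Set β}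
    (hB : ∀ i, MeasurableSet (B i)) (hdisj : Pairwise (Function.onFun Disjoint B))
    (hunion : ⋃ i, B i = Set.univ) (hκ : ∀ i, IsSFiniteKernel (κ.restrict (hB i))) :
    IsSFiniteKernel κ := by
  have hsum : κ = Kernel.sum fun i => κ.restrict (hB i) := by
    ext1 a
    simp only [Kernel.sum_apply, Kernel.restrict_apply]
    rw [← Measure.restrict_iUnion hdisj hB, hunion, Measure.restrict_univ]
  rw [hsum]
  infer_instance

end SFiniteKernel

namespace Config

variable {X : Type*}

variable (X) in
/-- The marked times in `[j, j + 1)`. The strips are a countable partition into sets that contain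
finitely many points of each configuration. -/
def strip (j : ℤ) : Set (ℝ × X) := Prod.fst ⁻¹' Set.Ico (j : ℝ) (j + 1)

lemma measurableSet_strip [MeasurableSpace X] (j : ℤ) : MeasurableSet (strip X j) :=
  measurable_fst measurableSet_Ico

lemma iUnion_strip : ⋃ j, strip X j = Set.univ := by
  simp only [strip, ← Set.preimage_iUnion, iUnion_Ico_intCast, Set.preimage_univ]

lemma pairwise_disjoint_strip : Pairwise (Function.onFun Disjoint (strip X)) := fun _ _ h =>
  (Set.pairwise_disjoint_Ico_intCast ℝ h).preimage _

lemma abs_fst_le_of_mem_strip {j : ℤ} {z : ℝ × X} (hz : z ∈ strip X j) :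
    |z.1| ≤ |(j : ℝ)| + 1 := by
  obtain ⟨hle, hlt⟩ := hz
  rw [abs_le]
  constructor <;> cases abs_cases (j : ℝ) <;> linarith

end Config

section Config

variable {X : Type*} [MeasurableSpace X]

/-- A sum of unit masses at marked times (a time in `ℝ` and a mark in `X`), finitely many of them
in every bounded interval of time. The index type may be taken in `Type` because such a sum is
countable. -/
def IsConfig (M : Measure (ℝ × X)) : Prop :=
  ∃ (ι : Type) (x : ι → ℝ × X), M = Measure.sum (fun i => Measure.dirac (x i)) ∧
    ∀ R : ℝ, {i | |(x i).1| ≤ R}.Finite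

lemma sum_dirac_apply {ι : Type*} (x : ι → ℝ × X) {A : Set (ℝ × X)} (hA : MeasurableSet A) :
    Measure.sum (fun i => Measure.dirac (x i)) A = ({i | x i ∈ A}.encard : ℝ≥0∞) := by
  rw [Measure.sum_apply _ hA, ← ENNReal.tsum_set_one,
    tsum_subtype {i | x i ∈ A} (fun _ => (1 : ℝ≥0∞))]
  refine tsum_congr fun i => ?_
  rw [Measure.dirac_apply' _ hA]
  rfl

namespace IsConfig

variable {M : Measure (ℝ × X)}

lemma add_dirac (hM : IsConfig M) (z : ℝ × X) : IsConfig (M + Measure.dirac z) := by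
  obtain ⟨ι, x, rfl, hfin⟩ := hM
  refine ⟨ι ⊕ Unit, Sum.elim x fun _ => z, ?_, fun R => ?_⟩
  · ext A hA
    simp [Measure.sum_apply _ hA, ENNReal.summable.tsum_sum ENNReal.summable, tsum_fintype]
  · refine (((hfin R).image Sum.inl).union (Set.finite_singleton (Sum.inr ()))).subset ?_
    rintro (i | ⟨⟩) hi
    · exact Or.inl ⟨i, hi, rfl⟩
    · exact Or.inr rfl

lemma restrict (hM : IsConfig M) {A : Set (ℝ × X)} (hA : MeasurableSet A) :
    IsConfig (M.restrict A) := by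
  classical
  obtain ⟨ι, x, rfl, hfin⟩ := hM
  refine ⟨{i // x i ∈ A}, fun i => x i, ?_, fun R =>
    (hfin R).preimage Subtype.val_injective.injOn⟩
  ext B hB
  simp only [Measure.restrict_sum _ hA, restrict_dirac' hA, Measure.sum_apply _ hB]
  refine Eq.trans (tsum_congr fun i => ?_)
    (tsum_subtype {i | x i ∈ A} (fun i => Measure.dirac (x i) B)).symm
  by_cases hi : x i ∈ A <;> simp [Set.indicator, hi]

lemma map_sub_left (hM : IsConfig M) (s : ℝ) :
    IsConfig (M.map fun z : ℝ × X => (z.1 - s, z.2)) := by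
  obtain ⟨ι, x, rfl, hfin⟩ := hM
  have hmap : Measurable fun z : ℝ × X => (z.1 - s, z.2) := by fun_prop
  refine ⟨ι, fun i => ((x i).1 - s, (x i).2), ?_,
    fun R => (hfin (R + |s|)).subset fun i hi => ?_⟩
  · simp only [Measure.map_sum hmap.aemeasurable, Measure.map_dirac' hmap]
  · have hi : |(x i).1 - s| ≤ R := hi
    have := abs_sub_abs_le_abs_sub (x i).1 s
    change |(x i).1| ≤ R + |s|
    linarith

end IsConfig

variable (X) in
/-- Locally finite configurations of times in `ℝ` with marks in `X`, encoded as counting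
measures. -/
structure Config where
  /-- The counting measure of the configuration. -/
  val : Measure (ℝ × X)
  isConfig : IsConfig val

instance : MeasurableSpace (Config X) := MeasurableSpace.comap Config.val inferInstance

namespace Config

lemma measurable_val : Measurable (Config.val : Config X → Measure (ℝ × X)) :=
  comap_measurable _

lemma measurable_coe {A : Set (ℝ × X)} (hA : MeasurableSet A) :
    Measurable fun M : Config X => M.val A :=
  (Measure.measurable_coe hA).comp measurable_val

lemma measurable_of_coe {α : Type*} [MeasurableSpace α] {f : α → Config X}
    (hf : ∀ A, MeasurableSet A → Measurable fun a => (f a).val A) : Measurable f :=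
  measurable_comap_iff.2 (Measure.measurable_of_measurable_coe _ hf)

lemma exists_measure_eq_natCast (M : Config X) {A : Set (ℝ × X)} (hA : MeasurableSet A) {R : ℝ}
    (hR : ∀ z ∈ A, |z.1| ≤ R) : ∃ n : ℕ, M.val A = n := by
  obtain ⟨ι, x, hM, hfin⟩ := M.isConfig
  have : {i | x i ∈ A}.Finite := (hfin R).subset fun i hi => hR _ hi
  exact ⟨this.toFinset.card, by
    simp [hM, sum_dirac_apply x hA, this.encard_eq_coe_toFinset_card]⟩

variable (X) in
/-- The kernel that sends a configuration to its counting measure. -/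
def countingKernel : Kernel (Config X) (ℝ × X) := ⟨Config.val, measurable_val⟩

lemma countingKernel_apply (M : Config X) : countingKernel X M = M.val := rfl

instance : IsSFiniteKernel (countingKernel X) := by
  refine isSFiniteKernel_of_restrict measurableSet_strip pairwise_disjoint_strip iUnion_strip
    fun j => isSFiniteKernel_of_forall_isFiniteMeasure fun M => ⟨?_⟩
  obtain ⟨n, hn⟩ := M.exists_measure_eq_natCast (measurableSet_strip j)
    fun _ => abs_fst_le_of_mem_strip
  rw [Kernel.restrict_apply, Measure.restrict_apply_univ, countingKernel_apply, hn]
  exact ENNReal.natCast_lt_top n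

lemma measurable_measure_section {α : Type*} [MeasurableSpace α] {f : α → Config X}
    (hf : Measurable f) {S : Set (α × (ℝ × X))} (hS : MeasurableSet S) :
    Measurable fun a => (f a).val {z | (a, z) ∈ S} :=
  Kernel.measurable_kernel_prodMk_left (κ := (countingKernel X).comap f hf) hS

/-- The configuration with one more point. -/
def add (M : Config X) (z : ℝ × X) : Config X :=
  ⟨M.val + Measure.dirac z, M.isConfig.add_dirac z⟩

lemma add_val (M : Config X) (z : ℝ × X) : (M.add z).val = M.val + Measure.dirac z := rfl

lemma measurable_add : Measurable fun p : Config X × (ℝ × X) => p.1.add p.2 := by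
  refine measurable_of_coe fun A hA => ?_
  simp_rw [add_val, Measure.add_apply, Measure.dirac_apply' _ hA]
  exact ((measurable_coe hA).comp measurable_fst).add
    ((measurable_const.indicator hA).comp measurable_snd)

/-- The points of a configuration that lie in a measurable set. -/
def restrict (M : Config X) {A : Set (ℝ × X)} (hA : MeasurableSet A) : Config X :=
  ⟨M.val.restrict A, M.isConfig.restrict hA⟩

lemma restrict_apply (M : Config X) {A B : Set (ℝ × X)} (hA : MeasurableSet A)
    (hB : MeasurableSet B) : (M.restrict hA).val B = M.val (B ∩ A) :=
  Measure.restrict_apply hB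

lemma measurable_restrict_section {α : Type*} [MeasurableSpace α] {f : α → Config X}
    (hf : Measurable f) {S : Set (α × (ℝ × X))} (hS : MeasurableSet S) :
    Measurable fun a => (f a).restrict (measurable_prodMk_left (x := a) hS) := by
  refine measurable_of_coe fun A hA => ?_
  simp only [restrict_apply _ _ hA]
  exact measurable_measure_section (S := Prod.snd ⁻¹' A ∩ S) hf ((measurable_snd hA).inter hS)

lemma measurable_restrict {A : Set (ℝ × X)} (hA : MeasurableSet A) :
    Measurable fun M : Config X => M.restrict hA :=
  measurable_restrict_section (S := Prod.snd ⁻¹' A) measurable_id (measurable_snd hA)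

/-- The configuration seen from time `s`. -/
def shift (s : ℝ) (M : Config X) : Config X :=
  ⟨M.val.map fun z => (z.1 - s, z.2), M.isConfig.map_sub_left s⟩

lemma shift_apply (s : ℝ) (M : Config X) {B : Set (ℝ × X)} (hB : MeasurableSet B) :
    (shift s M).val B = M.val {z | (z.1 - s, z.2) ∈ B} :=
  Measure.map_apply (by fun_prop) hB

lemma measurable_shift (s : ℝ) : Measurable (shift s : Config X → Config X) := by
  refine measurable_of_coe fun A hA => ?_
  simp_rw [shift_apply s _ hA]
  exact measurable_coe ((by fun_prop : Measurable fun z : ℝ × X => (z.1 - s, z.2)) hA)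

end Config

end Config

section VennCell

variable {E ι : Type*}

/-- The cell of the Venn diagram of the family `B` labelled by `σ`: the points that lie in exactly
those members of the family whose index is in `σ`. -/
def vennCell (B : ι → Set E) (σ : Finset ι) : Set E := {z | ∀ i, z ∈ B i ↔ i ∈ σ}

lemma measurableSet_vennCell [Countable ι] [MeasurableSpace E] {B : ι → Set E}
    (hB : ∀ i, MeasurableSet (B i)) (σ : Finset ι) : MeasurableSet (vennCell B σ) := by
  rw [vennCell, Set.ofPred_forall]
  refine MeasurableSet.iInter fun i => ?_
  by_cases h : i ∈ σ
  · simpa [h] using hB i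
  · simp only [h, iff_false]
    exact (hB i).compl

lemma disjoint_vennCell (B : ι → Set E) {σ τ : Finset ι} (h : σ ≠ τ) :
    Disjoint (vennCell B σ) (vennCell B τ) := by
  rw [Set.disjoint_left]
  exact fun z hz hz' => h (Finset.ext fun i => (hz i).symm.trans (hz' i))

variable (ι) in
/-- The labels of the Venn cells contained in the union of a finite family. -/
abbrev CellLabel := {σ : Finset ι // σ.Nonempty}

lemma vennCell_subset {B : ι → Set E} {σ : Finset ι} {i : ι} (hi : i ∈ σ) : vennCell B σ ⊆ B i :=
  fun _ hz => (hz i).2 hi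

lemma vennCell_subset_of_forall {B : ι → Set E} {S : Set E} (hS : ∀ i, B i ⊆ S)
    (σ : CellLabel ι) : vennCell B σ.1 ⊆ S :=
  have ⟨i, hi⟩ := σ.2
  (vennCell_subset hi).trans (hS i)

lemma pairwise_disjoint_vennCell (B : ι → Set E) :
    Pairwise fun σ τ : CellLabel ι => Disjoint (vennCell B σ.1) (vennCell B τ.1) :=
  fun _ _ h => disjoint_vennCell B fun h' => h (Subtype.ext h')

lemma measure_vennCell_ne_top [MeasurableSpace E] (μ : Measure E) {B : ι → Set E}
    (hf : ∀ i, μ (B i) ≠ ∞) (σ : CellLabel ι) : μ (vennCell B σ.1) ≠ ∞ :=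
  have ⟨i, hi⟩ := σ.2
  measure_ne_top_of_subset (vennCell_subset hi) (hf i)

variable [Fintype ι]

open Classical in
/-- The quantities carried by the members of a finite family, recovered additively from those
carried by its Venn cells. -/
def cellSum (c : CellLabel ι → ℝ≥0∞) (i : ι) : ℝ≥0∞ := ∑ σ, if i ∈ σ.1 then c σ else 0

lemma measurable_cellSum : Measurable (cellSum (ι := ι)) := by
  classical
  refine measurable_pi_lambda _ fun i => Finset.measurable_sum _ fun σ _ => ?_
  split_ifs
  · exact measurable_pi_apply _
  · exact measurable_const

open Classical in
lemma eq_biUnion_vennCell (B : ι → Set E) (i : ι) :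
    B i = ⋃ σ ∈ Finset.univ.filter (fun σ : CellLabel ι => i ∈ σ.1), vennCell B σ.1 := by
  ext z
  simp only [Finset.mem_filter, Finset.mem_univ, true_and, Set.mem_iUnion, exists_prop]
  constructor
  · intro hz
    have hi : i ∈ Finset.univ.filter (fun i => z ∈ B i) := by simpa using hz
    exact ⟨⟨_, i, hi⟩, hi, fun j => by simp⟩
  · rintro ⟨σ, hi, hz⟩
    exact vennCell_subset hi hz

lemma setLIntegral_eq_cellSum [MeasurableSpace E] (M : Measure E) {B : ι → Set E}
    (hB : ∀ i, MeasurableSet (B i)) (i : ι) (f : E → ℝ≥0∞) :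
    ∫⁻ z in B i, f z ∂M = cellSum (fun σ => ∫⁻ z in vennCell B σ.1, f z ∂M) i := by
  classical
  conv_lhs => rw [eq_biUnion_vennCell B i]
  rw [lintegral_biUnion_finset _ fun σ _ => measurableSet_vennCell hB _, cellSum,
    Finset.sum_filter]
  exact fun σ _ τ _ h => pairwise_disjoint_vennCell B h

lemma measure_eq_cellSum [MeasurableSpace E] (M : Measure E) {B : ι → Set E}
    (hB : ∀ i, MeasurableSet (B i)) (i : ι) :
    M (B i) = cellSum (fun σ => M (vennCell B σ.1)) i := by
  simpa only [setLIntegral_one] using setLIntegral_eq_cellSum M hB i fun _ => 1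

end VennCell

/-- The Poisson law of mean `r < ∞`, as a law of counts in `ℝ≥0∞`. -/
def poissonCount (r : ℝ≥0∞) : Measure ℝ≥0∞ :=
  (poissonMeasure r.toNNReal).map (fun n : ℕ => (n : ℝ≥0∞))

instance (r : ℝ≥0∞) : IsProbabilityMeasure (poissonCount r) :=
  Measure.isProbabilityMeasure_map Measurable.of_discrete.aemeasurable

section PoissonLaw

variable {X : Type*} [MeasurableSpace X]

/-- `Q` is the law of a Poisson process with intensity measure `μ`, where `μ` has finite mass over
every bounded interval of time. -/
structure IsPoissonLaw (Q : Measure (Config X)) (μ : Measure (ℝ × X)) : Prop where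
  measure_strip_ne_top : ∀ j, μ (Config.strip X j) ≠ ∞
  map_count : ∀ A, MeasurableSet A → μ A ≠ ∞ → Q.map (fun M => M.val A) = poissonCount (μ A)
  iIndepFun_count : ∀ A : ℕ → Set (ℝ × X), (∀ i, MeasurableSet (A i)) →
    Pairwise (fun i j => Disjoint (A i) (A j)) → iIndepFun (fun i (M : Config X) => M.val (A i)) Q

/-- The measurable sets of finite mean count. Unlike all measurable sets, they have counts whose
law is prescribed by `IsPoissonLaw`. -/
abbrev FiniteSet (μ : Measure (ℝ × X)) := {A : Set (ℝ × X) // MeasurableSet A ∧ μ A ≠ ∞}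

/-- The counts of a configuration in all sets of finite mean count. -/
def counts (μ : Measure (ℝ × X)) (M : Config X) (A : FiniteSet μ) : ℝ≥0∞ := M.val A.1

/-- The counts of a configuration in the Venn cells of a family of sets. -/
def cellCounts {ι : Type*} (B : ι → Set (ℝ × X)) (M : Config X) (σ : CellLabel ι) : ℝ≥0∞ :=
  M.val (vennCell B σ.1)

lemma measurable_cellCounts {ι : Type*} [Countable ι] {B : ι → Set (ℝ × X)}
    (hB : ∀ i, MeasurableSet (B i)) : Measurable (cellCounts B) :=
  measurable_pi_lambda _ fun σ => Config.measurable_coe (measurableSet_vennCell hB σ.1)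

section Counts

variable {μ : Measure (ℝ × X)}

lemma measurable_counts (μ : Measure (ℝ × X)) : Measurable (counts μ) :=
  measurable_pi_lambda _ fun A => Config.measurable_coe A.2.1

lemma measurable_of_counts (hμ : ∀ j, μ (Config.strip X j) ≠ ∞) {α : Type*} [MeasurableSpace α]
    {f : α → Config X} (hf : Measurable fun a => counts μ (f a)) : Measurable f := by
  refine Config.measurable_of_coe fun A hA => ?_
  have hAj : ∀ j, MeasurableSet (A ∩ Config.strip X j) := fun j =>
    hA.inter (Config.measurableSet_strip j)
  have hsum : ∀ M : Config X, M.val A = ∑' j, M.val (A ∩ Config.strip X j) := fun M => by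
    rw [← measure_iUnion _ hAj, ← Set.inter_iUnion, Config.iUnion_strip, Set.inter_univ]
    exact fun i j h => (Config.pairwise_disjoint_strip h).mono Set.inter_subset_right
      Set.inter_subset_right
  simp_rw [hsum]
  exact Measurable.tsum fun j => (measurable_pi_apply (⟨A ∩ Config.strip X j, hAj j,
    measure_ne_top_of_subset Set.inter_subset_right (hμ j)⟩ : FiniteSet μ)).comp hf

lemma comap_counts (hμ : ∀ j, μ (Config.strip X j) ≠ ∞) :
    MeasurableSpace.comap (counts μ) MeasurableSpace.pi = instMeasurableSpaceConfig (X := X) := by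
  refine le_antisymm (measurable_counts μ).comap_le ?_
  simpa using (@measurable_of_counts X _ μ hμ (Config X)
    (MeasurableSpace.comap (counts μ) MeasurableSpace.pi) id
    (comap_measurable (counts μ))).comap_le

lemma ext_of_counts (hμ : ∀ j, μ (Config.strip X j) ≠ ∞)
    {Q Q' : Measure (Config X)} [IsFiniteMeasure Q] [IsFiniteMeasure Q']
    (h : ∀ I : Finset (FiniteSet μ), Q.map (fun M (A : I) => M.val A.1.1) =
      Q'.map (fun M (A : I) => M.val A.1.1)) : Q = Q' := by
  have hproj : ∀ R : Measure (Config X), IsProjectiveLimit (R.map (counts μ))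
      fun I => R.map (fun M (A : I) => M.val A.1.1) := fun R I => by
    rw [Measure.map_map (Finset.measurable_restrict _) (measurable_counts μ)]
    rfl
  have hcounts : Q.map (counts μ) = Q'.map (counts μ) :=
    (hproj Q).unique fun I => (hproj Q' I).trans (h I).symm
  ext s hs
  rw [← comap_counts hμ] at hs
  obtain ⟨t, ht, rfl⟩ := hs
  rw [← Measure.map_apply (measurable_counts μ) ht, hcounts,
    Measure.map_apply (measurable_counts μ) ht]

lemma indepFun_of_indepFun_counts (hμ : ∀ j, μ (Config.strip X j) ≠ ∞) {Ω : Type*}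
    [MeasurableSpace Ω] {P : Measure Ω} {f g : Ω → Config X}
    (h : IndepFun (fun ω => counts μ (f ω)) (fun ω => counts μ (g ω)) P) : IndepFun f g P := by
  rw [IndepFun_iff_Indep] at h ⊢
  rw [← comap_counts hμ, MeasurableSpace.comap_comp, MeasurableSpace.comap_comp]
  exact h

end Counts

namespace IsPoissonLaw

variable {Q : Measure (Config X)} {μ : Measure (ℝ × X)}

lemma isProbabilityMeasure (hQ : IsPoissonLaw Q μ) : IsProbabilityMeasure Q := by
  have hmap := hQ.map_count ∅ MeasurableSet.empty (by simp)
  have : IsProbabilityMeasure (Q.map fun M => M.val ∅) := hmap ▸ inferInstance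
  exact Measure.isProbabilityMeasure_of_map (f := fun M : Config X => M.val ∅)

lemma iIndepFun_of_disjoint (hQ : IsPoissonLaw Q μ) {ι : Type*} [Countable ι]
    {B : ι → Set (ℝ × X)} (hB : ∀ i, MeasurableSet (B i))
    (hd : Pairwise (fun i j => Disjoint (B i) (B j))) :
    iIndepFun (fun i (M : Config X) => M.val (B i)) Q := by
  obtain ⟨e, he⟩ := exists_injective_nat ι
  let A : ℕ → Set (ℝ × X) := fun n => ⋃ i, ⋃ _ : e i = n, B i
  have hA : ∀ i, A (e i) = B i := fun i => by
    ext z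
    simp only [A, Set.mem_iUnion, exists_prop]
    exact ⟨fun ⟨j, hj, hz⟩ => he hj ▸ hz, fun hz => ⟨i, rfl, hz⟩⟩
  have hAd : Pairwise fun n m => Disjoint (A n) (A m) := fun n m h => by
    simp only [A, Set.disjoint_iUnion_left, Set.disjoint_iUnion_right]
    exact fun i hi j hj => hd fun hij => h (by rw [← hi, ← hj, hij])
  simpa only [hA] using (hQ.iIndepFun_count A
    (fun n => MeasurableSet.iUnion fun i => MeasurableSet.iUnion fun _ => hB i) hAd).precomp he

lemma map_counts_of_disjoint (hQ : IsPoissonLaw Q μ) {ι : Type*} [Fintype ι]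
    {B : ι → Set (ℝ × X)} (hB : ∀ i, MeasurableSet (B i)) (hf : ∀ i, μ (B i) ≠ ∞)
    (hd : Pairwise (fun i j => Disjoint (B i) (B j))) :
    Q.map (fun M i => M.val (B i)) = Measure.pi (fun i => poissonCount (μ (B i))) := by
  have := hQ.isProbabilityMeasure
  rw [(iIndepFun_iff_map_fun_eq_pi_map
    (fun i => (Config.measurable_coe (hB i)).aemeasurable)).1 (hQ.iIndepFun_of_disjoint hB hd)]
  congr 1
  ext1 i
  exact hQ.map_count _ (hB i) (hf i)

lemma map_cellCounts (hQ : IsPoissonLaw Q μ) {ι : Type*} [Fintype ι]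
    {B : ι → Set (ℝ × X)} (hB : ∀ i, MeasurableSet (B i)) (hf : ∀ i, μ (B i) ≠ ∞) :
    Q.map (cellCounts B) =
      Measure.pi (fun σ : CellLabel ι => poissonCount (μ (vennCell B σ.1))) :=
  hQ.map_counts_of_disjoint (fun σ => measurableSet_vennCell hB σ.1)
    (measure_vennCell_ne_top μ hf)
    (pairwise_disjoint_vennCell B)

lemma map_counts (hQ : IsPoissonLaw Q μ) {ι : Type*} [Fintype ι]
    {B : ι → Set (ℝ × X)} (hB : ∀ i, MeasurableSet (B i)) (hf : ∀ i, μ (B i) ≠ ∞) :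
    Q.map (fun M i => M.val (B i)) =
      (Measure.pi fun σ : CellLabel ι => poissonCount (μ (vennCell B σ.1))).map cellSum := by
  rw [← hQ.map_cellCounts hB hf, Measure.map_map measurable_cellSum (measurable_cellCounts hB)]
  congr 1
  ext M i
  exact measure_eq_cellSum M.val hB i

theorem unique {Q' : Measure (Config X)} (hQ : IsPoissonLaw Q μ) (hQ' : IsPoissonLaw Q' μ) :
    Q = Q' := by
  have := hQ.isProbabilityMeasure
  have := hQ'.isProbabilityMeasure
  refine ext_of_counts hQ.measure_strip_ne_top fun I => ?_
  rw [hQ.map_counts (fun A => A.1.2.1) (fun A => A.1.2.2),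
    hQ'.map_counts (fun A => A.1.2.1) (fun A => A.1.2.2)]

lemma indepFun_counts (hQ : IsPoissonLaw Q μ) {ι κ : Type*} [Finite ι] [Finite κ]
    {B : ι → Set (ℝ × X)} {C : κ → Set (ℝ × X)} {S T : Set (ℝ × X)} (hST : Disjoint S T)
    (hB : ∀ i, MeasurableSet (B i)) (hC : ∀ k, MeasurableSet (C k))
    (hBS : ∀ i, B i ⊆ S) (hCT : ∀ k, C k ⊆ T) :
    IndepFun (fun (M : Config X) i => M.val (B i)) (fun M k => M.val (C k)) Q := by
  classical
  have := Fintype.ofFinite ι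
  have := Fintype.ofFinite κ
  let D : CellLabel ι ⊕ CellLabel κ → Set (ℝ × X) :=
    Sum.elim (fun σ => vennCell B σ.1) (fun σ => vennCell C σ.1)
  have hD : ∀ i, MeasurableSet (D i) := by
    rintro (σ | σ)
    exacts [measurableSet_vennCell hB _, measurableSet_vennCell hC _]
  have hBC : ∀ (σ : CellLabel ι) (τ : CellLabel κ), Disjoint (vennCell B σ.1) (vennCell C τ.1) :=
    fun σ τ => hST.mono (vennCell_subset_of_forall hBS σ) (vennCell_subset_of_forall hCT τ)
  have hdisj : Pairwise (fun i j => Disjoint (D i) (D j)) := by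
    rintro (σ | σ) (τ | τ) h
    · exact pairwise_disjoint_vennCell B fun h' => h (congrArg Sum.inl h')
    · exact hBC σ τ
    · exact (hBC τ σ).symm
    · exact pairwise_disjoint_vennCell C fun h' => h (congrArg Sum.inr h')
  have hcells := (hQ.iIndepFun_of_disjoint hD hdisj).indepFun_finset
    (Finset.univ.map ⟨Sum.inl, Sum.inl_injective⟩) (Finset.univ.map ⟨Sum.inr, Sum.inr_injective⟩)
    (by rw [Finset.disjoint_left]; simp) (fun i => Config.measurable_coe (hD i))
  convert hcells.comp
    (φ := fun c => cellSum (fun σ : CellLabel ι => c ⟨Sum.inl σ, by simp⟩))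
    (ψ := fun c => cellSum (fun σ : CellLabel κ => c ⟨Sum.inr σ, by simp⟩))
    (measurable_cellSum.comp (measurable_pi_lambda _ fun σ => measurable_pi_apply _))
    (measurable_cellSum.comp (measurable_pi_lambda _ fun σ => measurable_pi_apply _)) using 1
  · ext M i
    exact measure_eq_cellSum M.val hB i
  · ext M k
    exact measure_eq_cellSum M.val hC k

theorem indepFun_restrict (hQ : IsPoissonLaw Q μ) {S T : Set (ℝ × X)} (hS : MeasurableSet S)
    (hT : MeasurableSet T) (hST : Disjoint S T) :
    IndepFun (fun M : Config X => M.restrict hS) (fun M => M.restrict hT) Q := by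
  have := hQ.isProbabilityMeasure
  refine indepFun_of_indepFun_counts hQ.measure_strip_ne_top ?_
  have hcounts : ∀ {U : Set (ℝ × X)} (hU : MeasurableSet U),
      (fun M : Config X => counts μ (M.restrict hU)) = fun M A => M.val (A.1 ∩ U) := fun hU => by
    ext M A
    exact M.restrict_apply hU A.2.1
  rw [hcounts hS, hcounts hT]
  refine IndepFun.process_indepFun_process
    (fun A => Config.measurable_coe (A.2.1.inter hS))
    (fun A => Config.measurable_coe (A.2.1.inter hT)) fun I J => ?_
  exact hQ.indepFun_counts hST (fun A => A.1.2.1.inter hS) (fun A => A.1.2.1.inter hT)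
    (fun _ => Set.inter_subset_right) (fun _ => Set.inter_subset_right)

end IsPoissonLaw

end PoissonLaw

section PoissonCount

lemma lintegral_poissonMeasure (r : ℝ≥0) (ψ : ℕ → ℝ≥0∞) :
    ∫⁻ n, ψ n ∂(poissonMeasure r) =
      ∑' n : ℕ, ENNReal.ofReal (Real.exp (-r) * r ^ n / n.factorial) * ψ n := by
  rw [poissonMeasure, lintegral_sum_measure]
  refine tsum_congr fun n => ?_
  rw [lintegral_smul_measure, lintegral_dirac' _ Measurable.of_discrete, smul_eq_mul]

lemma lintegral_mul_poissonCount {r : ℝ≥0∞} (hr : r ≠ ∞) {ψ : ℝ≥0∞ → ℝ≥0∞}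
    (hψ : Measurable ψ) :
    ∫⁻ y, y * ψ y ∂(poissonCount r) = r * ∫⁻ y, ψ (y + 1) ∂(poissonCount r) := by
  lift r to ℝ≥0 using hr
  rw [poissonCount, lintegral_map (by fun_prop) Measurable.of_discrete,
    lintegral_map (by fun_prop) Measurable.of_discrete, lintegral_poissonMeasure,
    lintegral_poissonMeasure, tsum_eq_zero_add' ENNReal.summable, ← ENNReal.tsum_mul_left]
  simp only [ENNReal.toNNReal_coe, CharP.cast_eq_zero, zero_mul, mul_zero, zero_add, Nat.cast_succ]
  refine tsum_congr fun n => ?_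
  have hn : (n + 1 : ℝ≥0∞) = ENNReal.ofReal (n + 1) := by
    rw [← Nat.cast_succ, ← ENNReal.ofReal_natCast, Nat.cast_succ]
  rw [← mul_assoc, ← mul_assoc]
  congr 1
  rw [hn, ← ENNReal.ofReal_coe_nnreal, ← ENNReal.ofReal_mul (by positivity),
    ← ENNReal.ofReal_mul (by positivity), Nat.factorial_succ]
  congr 1
  push_cast
  field_simp
  ring

variable {ι : Type*} [DecidableEq ι]

lemma measurable_update_add_one (i : ι) :
    Measurable fun c : ι → ℝ≥0∞ => Function.update c i (c i + 1) := by
  refine measurable_pi_lambda _ fun j => ?_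
  by_cases h : j = i
  · subst h
    simpa using (measurable_pi_apply j).add_const 1
  · simpa [Function.update_of_ne h] using measurable_pi_apply j

lemma lintegral_mul_pi_poissonCount [Fintype ι] {m : ι → ℝ≥0∞}
    (hm : ∀ i, m i ≠ ∞) {ψ : (ι → ℝ≥0∞) → ℝ≥0∞} (hψ : Measurable ψ) (i : ι) :
    ∫⁻ c, c i * ψ c ∂(Measure.pi fun i => poissonCount (m i)) =
      m i * ∫⁻ c, ψ (Function.update c i (c i + 1)) ∂(Measure.pi fun i => poissonCount (m i)) := by
  have hψ' : Measurable fun c : ι → ℝ≥0∞ => ψ (Function.update c i (c i + 1)) :=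
    hψ.comp (measurable_update_add_one i)
  have hcoord : (fun x : ι → ℝ≥0∞ => ∫⁻ y, Function.update x i y i * ψ (Function.update x i y)
        ∂(poissonCount (m i))) =
      fun x => m i * ∫⁻ y, ψ (Function.update (Function.update x i y) i
        (Function.update x i y i + 1)) ∂(poissonCount (m i)) := by
    ext x
    simp only [Function.update_self, Function.update_idem]
    exact lintegral_mul_poissonCount (hm i) (ψ := fun y => ψ (Function.update x i y))
      (hψ.comp (measurable_update x))
  have hmeas : Measurable fun x : ι → ℝ≥0∞ => ∫⁻ y, ψ (Function.update (Function.update x i y) i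
      (Function.update x i y i + 1)) ∂(poissonCount (m i)) :=
    Measurable.lintegral_prod_right' (f := fun p : (ι → ℝ≥0∞) × ℝ≥0∞ =>
      ψ (Function.update (Function.update p.1 i p.2) i (Function.update p.1 i p.2 i + 1)))
      (hψ'.comp (measurable_update' (a := i)))
  rw [lintegral_eq_lmarginal_univ (0 : ι → ℝ≥0∞), lintegral_eq_lmarginal_univ (0 : ι → ℝ≥0∞),
    lmarginal_erase' _ (by fun_prop) (Finset.mem_univ i),
    lmarginal_erase' _ hψ' (Finset.mem_univ i), hcoord, lmarginal, lmarginal,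
    lintegral_const_mul]
  exact hmeas.comp measurable_updateFinset

end PoissonCount

section Mecke

variable {X : Type*} [MeasurableSpace X]

lemma cellCounts_add {ι : Type*} [Countable ι] [DecidableEq ι] {B : ι → Set (ℝ × X)}
    (hB : ∀ i, MeasurableSet (B i)) (M : Config X) {σ : CellLabel ι} {z : ℝ × X}
    (hz : z ∈ vennCell B σ.1) :
    cellCounts B (M.add z) = Function.update (cellCounts B M) σ (cellCounts B M σ + 1) := by
  ext τ
  simp only [cellCounts, Config.add_val, Measure.add_apply,
    Measure.dirac_apply' _ (measurableSet_vennCell hB _)]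
  by_cases h : τ = σ
  · subst h
    simp [hz]
  · have hzτ : z ∉ vennCell B τ.1 := Set.disjoint_right.1 (pairwise_disjoint_vennCell B h) hz
    simp [cellCounts, Function.update_of_ne h, hzτ]

namespace IsPoissonLaw

variable {Q : Measure (Config X)} {μ : Measure (ℝ × X)} (hQ : IsPoissonLaw Q μ)

include hQ

lemma lintegral_count {A : Set (ℝ × X)} (hA : MeasurableSet A) (hf : μ A ≠ ∞) :
    ∫⁻ M, M.val A ∂Q = μ A := by
  rw [← lintegral_map (f := fun y => y) measurable_id (Config.measurable_coe hA),
    hQ.map_count A hA hf]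
  simpa using lintegral_mul_poissonCount hf (ψ := fun _ => 1) measurable_const

section Finite

variable {ι : Type*} [Finite ι] {B : ι → Set (ℝ × X)} (hB : ∀ i, MeasurableSet (B i))
  (hf : ∀ i, μ (B i) ≠ ∞)

include hB hf

lemma lintegral_cellCounts_mul {φ : (CellLabel ι → ℝ≥0∞) → ℝ≥0∞} (hφ : Measurable φ)
    (σ : CellLabel ι) :
    ∫⁻ M, cellCounts B M σ * φ (cellCounts B M) ∂Q =
      ∫⁻ z in vennCell B σ.1, ∫⁻ M, φ (cellCounts B (M.add z)) ∂Q ∂μ := by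
  classical
  have := Fintype.ofFinite ι
  have hc := measurable_cellCounts hB
  have hpi := lintegral_mul_pi_poissonCount (measure_vennCell_ne_top μ hf) hφ σ
  rw [← hQ.map_cellCounts hB hf, lintegral_map (by fun_prop) hc,
    lintegral_map (f := fun c => φ (Function.update c σ (c σ + 1)))
      (hφ.comp (measurable_update_add_one σ)) hc] at hpi
  rw [hpi, setLIntegral_congr_fun (measurableSet_vennCell hB _)
    (fun z hz => lintegral_congr fun M => by rw [cellCounts_add hB M hz]), setLIntegral_const,
    mul_comm]

lemma lintegral_count_mul_cellCounts {φ : (CellLabel ι → ℝ≥0∞) → ℝ≥0∞} (hφ : Measurable φ)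
    (i : ι) :
    ∫⁻ M, M.val (B i) * φ (cellCounts B M) ∂Q =
      ∫⁻ z in B i, ∫⁻ M, φ (cellCounts B (M.add z)) ∂Q ∂μ := by
  classical
  have := Fintype.ofFinite ι
  have hc := measurable_cellCounts hB
  have hsum : ∀ M : Config X, M.val (B i) * φ (cellCounts B M) =
      ∑ σ : CellLabel ι, if i ∈ σ.1 then cellCounts B M σ * φ (cellCounts B M) else 0 := fun M => by
    rw [measure_eq_cellSum M.val hB i, cellSum, Finset.sum_mul]
    exact Finset.sum_congr rfl fun σ _ => by rw [ite_mul, zero_mul]; rfl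
  have hmeas : ∀ σ : CellLabel ι, Measurable fun M : Config X =>
      if i ∈ σ.1 then cellCounts B M σ * φ (cellCounts B M) else 0 := fun σ => by
    split_ifs
    exacts [((measurable_pi_apply σ).comp hc).mul (hφ.comp hc), measurable_const]
  simp_rw [hsum]
  rw [lintegral_finsetSum _ fun σ _ => hmeas σ, setLIntegral_eq_cellSum μ hB, cellSum]
  refine Finset.sum_congr rfl fun σ _ => ?_
  split_ifs
  exacts [hQ.lintegral_cellCounts_mul hB hf hφ σ, lintegral_zero]

lemma lintegral_count_mul {A : Set (ℝ × X)} (hA : MeasurableSet A) (hAf : μ A ≠ ∞)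
    {ψ : (ι → ℝ≥0∞) → ℝ≥0∞} (hψ : Measurable ψ) :
    ∫⁻ M, M.val A * ψ (fun i => M.val (B i)) ∂Q =
      ∫⁻ z in A, ∫⁻ M, ψ (fun i => (M.add z).val (B i)) ∂Q ∂μ := by
  have := Fintype.ofFinite ι
  let D : Option ι → Set (ℝ × X) := fun o => o.elim A B
  have hD : ∀ o, MeasurableSet (D o) := by
    rintro (_ | i)
    exacts [hA, hB i]
  have hDf : ∀ o, μ (D o) ≠ ∞ := by
    rintro (_ | i)
    exacts [hAf, hf i]
  have hcount : ∀ M : Config X, (fun i => M.val (B i)) =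
      fun i => cellSum (cellCounts D M) (some i) :=
    fun M => funext fun i => measure_eq_cellSum M.val hD (some i)
  simp_rw [hcount]
  exact hQ.lintegral_count_mul_cellCounts hD hDf
    (φ := fun c => ψ fun i => cellSum c (some i)) (hψ.comp (measurable_pi_lambda _ fun i =>
      (measurable_pi_apply _).comp measurable_cellSum)) none

end Finite

lemma withDensity_count {A : Set (ℝ × X)} (hA : MeasurableSet A) (hf : μ A ≠ ∞) :
    Q.withDensity (fun M => M.val A) = ((μ.restrict A).prod Q).map (fun p => p.2.add p.1) := by
  have := hQ.isProbabilityMeasure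
  have hadd : Measurable (fun p : (ℝ × X) × Config X => p.2.add p.1) :=
    Config.measurable_add.comp measurable_swap
  have : IsFiniteMeasure (Q.withDensity (fun M => M.val A)) :=
    isFiniteMeasure_withDensity (by rw [hQ.lintegral_count hA hf]; exact hf)
  have : IsFiniteMeasure (μ.restrict A) := ⟨by simpa using hf.lt_top⟩
  refine ext_of_counts hQ.measure_strip_ne_top fun I => Measure.ext fun K hK => ?_
  let ev : Config X → I → ℝ≥0∞ := fun M B => M.val B.1.1
  have hev : Measurable ev := measurable_pi_lambda _ fun B => Config.measurable_coe B.1.2.1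
  have hmecke := hQ.lintegral_count_mul (fun B : I => B.1.2.1) (fun B => B.1.2.2) hA hf
    (measurable_one.indicator hK)
  calc (Q.withDensity fun M => M.val A).map ev K
      = ∫⁻ M, M.val A * K.indicator 1 (ev M) ∂Q := by
        rw [Measure.map_apply hev hK, withDensity_apply _ (hev hK), ← lintegral_indicator (hev hK)]
        exact lintegral_congr fun M => by by_cases h : ev M ∈ K <;> simp [h]
    _ = ∫⁻ z in A, ∫⁻ M, K.indicator 1 (ev (M.add z)) ∂Q ∂μ := hmecke
    _ = (((μ.restrict A).prod Q).map fun p => p.2.add p.1).map ev K := by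
        rw [Measure.map_apply hev hK, Measure.map_apply hadd (hev hK),
          Measure.prod_apply (hadd (hev hK))]
        refine lintegral_congr fun z => ?_
        rw [← lintegral_indicator_one (measurable_prodMk_left (hadd (hev hK)))]
        rfl

lemma sigmaFinite : SigmaFinite μ :=
  Measure.sigmaFinite_of_countable (Set.countable_range (Config.strip X))
    (Set.forall_mem_range.2 fun j => (hQ.measure_strip_ne_top j).lt_top)
    (by rw [Set.sUnion_range, Config.iUnion_strip])

lemma compProd_countingKernel :
    Q ⊗ₘ Config.countingKernel X = (μ.prod Q).map (fun p => (p.2.add p.1, p.1)) := by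
  have := hQ.isProbabilityMeasure
  have := hQ.sigmaFinite
  have hadd : Measurable (fun p : (ℝ × X) × Config X => p.2.add p.1) :=
    Config.measurable_add.comp measurable_swap
  have hprod : ∀ {C : Set (Config X)} {A : Set (ℝ × X)}, MeasurableSet C → MeasurableSet A →
      μ A ≠ ∞ → (Q ⊗ₘ Config.countingKernel X) (C ×ˢ A) =
        (μ.prod Q).map (fun p => (p.2.add p.1, p.1)) (C ×ˢ A) := by
    intro C A hC hA hf
    rw [Measure.compProd_apply_prod hC hA, Measure.map_apply (hadd.prodMk measurable_fst)
      (hC.prod hA)]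
    simp only [Config.countingKernel_apply]
    rw [← withDensity_apply _ hC, hQ.withDensity_count hA hf, Measure.map_apply hadd hC,
      ← Measure.restrict_univ (μ := Q), Measure.prod_restrict, Measure.restrict_univ,
      Measure.restrict_apply (hadd hC)]
    congr 1
    ext p
    simp
  have hstrip := Config.measurableSet_strip (X := X)
  refine Measure.ext_of_generateFrom_of_cover generateFrom_prod.symm
    (T := Set.range fun j => Set.univ ×ˢ Config.strip X j) (Set.countable_range _) isPiSystem_prod
    ?_ ?_ ?_ ?_
  · rw [Set.sUnion_range, ← Set.prod_iUnion, Config.iUnion_strip, Set.univ_prod_univ]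
  · rintro _ ⟨j, rfl⟩
    rw [Measure.compProd_apply_prod .univ (hstrip j), Measure.restrict_univ]
    simp only [Config.countingKernel_apply]
    rw [hQ.lintegral_count (hstrip j) (hQ.measure_strip_ne_top j)]
    exact hQ.measure_strip_ne_top j
  · rintro _ ⟨j, rfl⟩ _ ⟨C, hC, A, hA, rfl⟩
    rw [Set.prod_inter_prod]
    exact hprod (MeasurableSet.inter hC .univ) (MeasurableSet.inter hA (hstrip j))
      (measure_ne_top_of_subset Set.inter_subset_right (hQ.measure_strip_ne_top j))
  · rintro _ ⟨j, rfl⟩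
    exact hprod .univ (hstrip j) (hQ.measure_strip_ne_top j)

theorem mecke {g : Config X × (ℝ × X) → ℝ≥0∞} (hg : Measurable g) :
    ∫⁻ M, ∫⁻ z, g (M, z) ∂M.val ∂Q = ∫⁻ z, ∫⁻ M, g (M.add z, z) ∂Q ∂μ := by
  have := hQ.isProbabilityMeasure
  have := hQ.sigmaFinite
  have hmap : Measurable (fun p : (ℝ × X) × Config X => (p.2.add p.1, p.1)) :=
    (Config.measurable_add.comp measurable_swap).prodMk measurable_fst
  calc ∫⁻ M, ∫⁻ z, g (M, z) ∂M.val ∂Q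
      = ∫⁻ p, g p ∂(Q ⊗ₘ Config.countingKernel X) := by
        rw [Measure.lintegral_compProd hg]
        rfl
    _ = ∫⁻ p, g (p.2.add p.1, p.1) ∂(μ.prod Q) := by
        rw [hQ.compProd_countingKernel, lintegral_map hg hmap]
    _ = ∫⁻ z, ∫⁻ M, g (M.add z, z) ∂Q ∂μ := lintegral_prod _ (hg.comp hmap).aemeasurable

lemma mecke_set {D : Set (Config X × (ℝ × X))} (hD : MeasurableSet D) :
    ∫⁻ M, M.val {z | (M, z) ∈ D} ∂Q = ∫⁻ z, Q {M | (M.add z, z) ∈ D} ∂μ := by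
  have hleft : ∀ M : Config X, ∫⁻ z, D.indicator 1 (M, z) ∂M.val = M.val {z | (M, z) ∈ D} :=
    fun M => lintegral_indicator_one (s := {z | (M, z) ∈ D}) (measurable_prodMk_left hD)
  have hright : ∀ z, ∫⁻ M, D.indicator 1 (M.add z, z) ∂Q = Q {M | (M.add z, z) ∈ D} :=
    fun z => lintegral_indicator_one (s := {M : Config X | (M.add z, z) ∈ D})
      (((Config.measurable_add.comp (measurable_id.prodMk measurable_const)).prodMk
        measurable_const) hD)
  simpa only [hleft, hright] using hQ.mecke (g := D.indicator 1) (measurable_one.indicator hD)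

end IsPoissonLaw

end Mecke

section Successive

variable {U : Set ℝ} (hf : ∀ R, (U ∩ Set.Iic R).Finite)

include hf

lemma isLeast_sInf_of_finite {S : Set ℝ} (hS : S ⊆ U) (hne : S.Nonempty) :
    IsLeast S (sInf S) := by
  obtain ⟨x, hx⟩ := hne
  obtain ⟨m, ⟨hmS, hmx⟩, hmin⟩ := ((hf x).subset
    (Set.inter_subset_inter_left _ hS)).exists_minimal ⟨x, hx, Set.self_mem_Iic⟩
  have hm : IsLeast S m := by
    refine ⟨hmS, fun y hy => ?_⟩
    rcases le_total y x with hyx | hxy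
    · exact (le_total m y).elim id fun hym => hmin ⟨hy, hyx⟩ hym
    · exact hmx.trans hxy
  rwa [hm.csInf_eq]

variable (hU : U.Infinite)

include hU

lemma exists_gt_of_infinite (R : ℝ) : {t | t ∈ U ∧ R < t}.Nonempty := by
  by_contra h
  exact hU ((hf R).subset fun t ht => ⟨ht, not_lt.1 fun h' => h ⟨t, ht, h'⟩⟩)

lemma isLeast_successive_zero : IsLeast U (successive U 0) :=
  isLeast_sInf_of_finite hf subset_rfl hU.nonempty

lemma isLeast_successive_succ (n : ℕ) :
    IsLeast {t | t ∈ U ∧ successive U n < t} (successive U (n + 1)) :=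
  isLeast_sInf_of_finite hf (fun _ h => h.1) (exists_gt_of_infinite hf hU _)

lemma successive_mem : ∀ n, successive U n ∈ U
  | 0 => (isLeast_successive_zero hf hU).1
  | n + 1 => (isLeast_successive_succ hf hU n).1.1

lemma strictMono_successive : StrictMono (successive U) :=
  strictMono_nat_of_lt_succ fun n => (isLeast_successive_succ hf hU n).1.2

lemma range_successive : Set.range (successive U) = U := by
  refine Set.Subset.antisymm (Set.range_subset_iff.2 (successive_mem hf hU)) fun x hx => ?_
  by_contra hxr
  have hlt : ∀ n, successive U n < x := by
    intro n
    induction n with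
    | zero => exact ((isLeast_successive_zero hf hU).2 hx).lt_of_ne fun h => hxr ⟨0, h⟩
    | succ n ih =>
      exact ((isLeast_successive_succ hf hU n).2 ⟨hx, ih⟩).lt_of_ne fun h => hxr ⟨n + 1, h⟩
  refine Set.infinite_range_of_injective (strictMono_successive hf hU).injective
    ((hf x).subset ?_)
  rintro _ ⟨n, rfl⟩
  exact ⟨successive_mem hf hU n, (hlt n).le⟩

lemma encard_inter_Iio_successive (n : ℕ) : (U ∩ Set.Iio (successive U n)).encard = n := by
  have himage : U ∩ Set.Iio (successive U n) = successive U '' Set.Iio n := by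
    ext t
    constructor
    · rintro ⟨ht, htn⟩
      obtain ⟨m, rfl⟩ := (range_successive hf hU).ge ht
      exact ⟨m, (strictMono_successive hf hU).lt_iff_lt.1 htn, rfl⟩
    · rintro ⟨m, hm, rfl⟩
      exact ⟨successive_mem hf hU m, strictMono_successive hf hU hm⟩
  rw [himage, (strictMono_successive hf hU).injective.encard_image, ← Set.coe_fintypeCard]
  simp

lemma eq_successive_of_encard {t : ℝ} (ht : t ∈ U) {n : ℕ}
    (h : (U ∩ Set.Iio t).encard = n) : t = successive U n := by
  obtain ⟨m, rfl⟩ := (range_successive hf hU).ge ht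
  rw [encard_inter_Iio_successive hf hU] at h
  rw [Nat.cast_inj.1 h]

lemma le_encard_inter_Iic_iff (n : ℕ) (t : ℝ) :
    ((n + 1 : ℕ) : ℕ∞) ≤ (U ∩ Set.Iic t).encard ↔ successive U n ≤ t := by
  constructor
  · intro hle
    by_contra! hlt
    have hcard := hle.trans (Set.encard_le_encard (t := U ∩ Set.Iio (successive U n))
      fun s hs => ⟨hs.1, lt_of_le_of_lt hs.2 hlt⟩)
    rw [encard_inter_Iio_successive hf hU, Nat.cast_le] at hcard
    omega
  · intro hle
    rw [← encard_inter_Iio_successive hf hU (n + 1)]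
    refine Set.encard_le_encard fun s ⟨hsU, hs⟩ => ⟨hsU, ?_⟩
    rw [Set.mem_Iic, ← not_lt]
    exact fun hts => hs.not_ge ((isLeast_successive_succ hf hU n).2 ⟨hsU, hle.trans_lt hts⟩)

end Successive

section Atoms

variable {X : Type*} [MeasurableSpace X]

namespace Config

/-- The points of a configuration, without their multiplicities. -/
def atoms (M : Config X) : Set (ℝ × X) := {z | M.val {z} ≠ 0}

/-- A configuration is simple if its points have distinct times. -/
def Simple (M : Config X) : Prop := ∀ a, M.val {z | z.1 = a} ≤ 1

lemma measurableSet_time (a : ℝ) : MeasurableSet {z : ℝ × X | z.1 = a} :=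
  measurable_fst (measurableSet_singleton a)

lemma ext_of_measure_eq {M N : Config X} (h : ∀ A, MeasurableSet A → M.val A = N.val A) :
    M = N := by
  cases M
  cases N
  congr
  exact Measure.ext h

lemma Simple.simple_restrict {M : Config X} (hM : M.Simple) {A : Set (ℝ × X)}
    (hA : MeasurableSet A) : (M.restrict hA).Simple := fun a => by
  rw [restrict_apply _ _ (measurableSet_time a)]
  exact (measure_mono Set.inter_subset_left).trans (hM a)

variable [MeasurableSingletonClass X]

lemma exists_enumeration (M : Config X) : ∃ (ι : Type) (x : ι → ℝ × X),
    (∀ A, MeasurableSet A → M.val A = ({i | x i ∈ A}.encard : ℝ≥0∞)) ∧ M.atoms = Set.range x ∧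
      ∀ R : ℝ, {i | |(x i).1| ≤ R}.Finite := by
  obtain ⟨ι, x, hM, hfin⟩ := M.isConfig
  have hcount : ∀ A, MeasurableSet A → M.val A = ({i | x i ∈ A}.encard : ℝ≥0∞) := fun A hA => by
    rw [hM, sum_dirac_apply x hA]
  refine ⟨ι, x, hcount, ?_, hfin⟩
  ext z
  rw [atoms, Set.mem_ofPred_eq, hcount _ (measurableSet_singleton z)]
  simp [Set.ext_iff]

lemma measure_eq_zero_iff (M : Config X) {A : Set (ℝ × X)} (hA : MeasurableSet A) :
    M.val A = 0 ↔ ∀ z ∈ M.atoms, z ∉ A := by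
  obtain ⟨ι, x, hcount, hx, -⟩ := M.exists_enumeration
  rw [hcount A hA, hx]
  simp [Set.ext_iff]

lemma finite_atoms (M : Config X) (R : ℝ) : (M.atoms ∩ {z | |z.1| ≤ R}).Finite := by
  obtain ⟨ι, x, -, hx, hfin⟩ := M.exists_enumeration
  refine ((hfin R).image x).subset ?_
  rintro z ⟨hz, hR⟩
  rw [hx] at hz
  obtain ⟨i, rfl⟩ := hz
  exact ⟨i, hR, rfl⟩

lemma atoms_add (M : Config X) (z : ℝ × X) : (M.add z).atoms = insert z M.atoms := by
  ext w
  by_cases h : w = z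
  · simp [atoms, add_val, h]
  · simp [atoms, add_val, h, Ne.symm h]

lemma atoms_restrict (M : Config X) {A : Set (ℝ × X)} (hA : MeasurableSet A) :
    (M.restrict hA).atoms = M.atoms ∩ A := by
  ext w
  rw [atoms, Set.mem_ofPred_eq, restrict_apply M hA (measurableSet_singleton w)]
  by_cases h : w ∈ A <;> simp [h, atoms]

lemma Simple.exists_enumeration {M : Config X} (hM : M.Simple) : ∃ (ι : Type) (x : ι → ℝ × X),
    (∀ A, MeasurableSet A → M.val A = ({i | x i ∈ A}.encard : ℝ≥0∞)) ∧ M.atoms = Set.range x ∧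
      Function.Injective fun i => (x i).1 := by
  obtain ⟨ι, x, hcount, hx, -⟩ := M.exists_enumeration
  refine ⟨ι, x, hcount, hx, fun i j hij => ?_⟩
  have hle := hM (x i).1
  rw [hcount _ (measurableSet_time _), ← ENat.toENNReal_one, ENat.toENNReal_le,
    Set.encard_le_one_iff] at hle
  exact hle i j rfl hij.symm

lemma Simple.injOn_fst_atoms {M : Config X} (hM : M.Simple) : Set.InjOn Prod.fst M.atoms := by
  obtain ⟨ι, x, -, hx, hinj⟩ := hM.exists_enumeration
  rw [hx]
  rintro _ ⟨i, rfl⟩ _ ⟨j, rfl⟩ hij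
  rw [hinj hij]

lemma Simple.measure_eq_encard {M : Config X} (hM : M.Simple) {A : Set (ℝ × X)}
    (hA : MeasurableSet A) : M.val A = ((Prod.fst '' (M.atoms ∩ A)).encard : ℝ≥0∞) := by
  obtain ⟨ι, x, hcount, hx, hinj⟩ := hM.exists_enumeration
  have himage : Prod.fst '' (M.atoms ∩ A) = (fun i => (x i).1) '' {i | x i ∈ A} := by
    rw [hx, ← Set.image_preimage_eq_range_inter, Set.image_image]
    rfl
  rw [hcount A hA, himage, hinj.encard_image]

lemma Simple.measure_eq_encard_of_forall {M : Config X} (hM : M.Simple) {A : Set (ℝ × X)}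
    (hA : MeasurableSet A) {S : Set ℝ} (hS : S ⊆ Prod.fst '' M.atoms)
    (hAS : ∀ z ∈ M.atoms, z ∈ A ↔ z.1 ∈ S) : M.val A = (S.encard : ℝ≥0∞) := by
  rw [hM.measure_eq_encard hA]
  congr 2
  ext a
  constructor
  · rintro ⟨z, ⟨hz, hzA⟩, rfl⟩
    exact (hAS z hz).1 hzA
  · intro ha
    obtain ⟨z, hz, rfl⟩ := hS ha
    exact ⟨z, ⟨hz, (hAS z hz).2 ha⟩, rfl⟩

end Config

end Atoms

namespace Config

section PastFuture

variable {X : Type*} [MeasurableSpace X]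

lemma restrict_add_of_notMem {A : Set (ℝ × X)} (hA : MeasurableSet A) (M : Config X) {z : ℝ × X}
    (hz : z ∉ A) : (M.add z).restrict hA = M.restrict hA := by
  refine ext_of_measure_eq fun B hB => ?_
  rw [restrict_apply _ hA hB, restrict_apply _ hA hB, add_val, Measure.add_apply,
    Measure.dirac_apply' _ (hB.inter hA)]
  simp [hz]

lemma measurableSet_before (a : ℝ) : MeasurableSet {z : ℝ × X | z.1 < a} :=
  measurableSet_lt measurable_fst measurable_const

lemma measurableSet_after (a : ℝ) : MeasurableSet {z : ℝ × X | a < z.1} :=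
  measurableSet_lt measurable_const measurable_fst

/-- The points strictly before time `a`. -/
def past (a : ℝ) (M : Config X) : Config X := M.restrict (measurableSet_before a)

/-- The points strictly after time `a`. -/
def future (a : ℝ) (M : Config X) : Config X := M.restrict (measurableSet_after a)

lemma Simple.simple_past {M : Config X} (hM : M.Simple) (a : ℝ) : (past a M).Simple :=
  hM.simple_restrict (measurableSet_before a)

lemma measurable_past : Measurable fun p : ℝ × Config X => past p.1 p.2 :=
  measurable_restrict_section (S := {q : (ℝ × Config X) × (ℝ × X) | q.2.1 < q.1.1})
    measurable_snd (measurableSet_lt (by fun_prop) (by fun_prop))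

lemma measurable_future : Measurable fun p : ℝ × Config X => future p.1 p.2 :=
  measurable_restrict_section (S := {q : (ℝ × Config X) × (ℝ × X) | q.1.1 < q.2.1})
    measurable_snd (measurableSet_lt (by fun_prop) (by fun_prop))

lemma past_add (M : Config X) (z : ℝ × X) : past z.1 (M.add z) = past z.1 M :=
  restrict_add_of_notMem _ M (by simp)

lemma future_add (M : Config X) (z : ℝ × X) : future z.1 (M.add z) = future z.1 M :=
  restrict_add_of_notMem _ M (by simp)

/-- The point `z` together with the points strictly after it. -/
def restart (M : Config X) (z : ℝ × X) : Config X := (future z.1 M).add z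

lemma measurable_restart : Measurable fun p : Config X × (ℝ × X) => p.1.restart p.2 :=
  measurable_add.comp ((measurable_future.comp
    (measurable_snd.fst.prodMk measurable_fst)).prodMk measurable_snd)

lemma restart_add (M : Config X) (z : ℝ × X) : (M.add z).restart z = M.restart z := by
  rw [restart, restart, future_add]

lemma atoms_restart [MeasurableSingletonClass X] (M : Config X) (z : ℝ × X) :
    (M.restart z).atoms = insert z (M.atoms ∩ {w | z.1 < w.1}) := by
  rw [restart, atoms_add, future, atoms_restrict]

lemma restart_restart (M : Config X) {z w : ℝ × X} (hzw : z.1 < w.1) :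
    (M.restart z).restart w = M.restart w := by
  have hz : z ∉ {p : ℝ × X | w.1 < p.1} := hzw.le.not_gt
  rw [restart, restart, restart, future, restrict_add_of_notMem _ _ hz]
  congr 1
  refine ext_of_measure_eq fun B hB => ?_
  rw [future, future, restrict_apply _ _ hB, restrict_apply _ _ (hB.inter (measurableSet_after _)),
    restrict_apply _ _ hB]
  congr 1
  ext p
  exact ⟨fun h => h.1, fun h => ⟨h, hzw.trans h.2⟩⟩

lemma Simple.simple_restart {M : Config X} (hM : M.Simple) (z : ℝ × X) : (M.restart z).Simple := by
  intro a
  rw [restart, add_val, Measure.add_apply, future, restrict_apply _ _ (measurableSet_time a),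
    Measure.dirac_apply' _ (measurableSet_time a)]
  rcases eq_or_ne z.1 a with rfl | ha
  · have hempty : {w : ℝ × X | w.1 = z.1} ∩ {w | z.1 < w.1} = ∅ :=
      Set.eq_empty_of_forall_notMem fun w hw => hw.2.ne' hw.1
    rw [hempty, measure_empty, zero_add]
    exact Set.indicator_le_self' (by simp) _
  · rw [Set.indicator_of_notMem (s := {w : ℝ × X | w.1 = a}) ha, add_zero]
    exact (measure_mono Set.inter_subset_left).trans (hM a)

lemma shift_restart (M : Config X) (a : ℝ) (x : X) :
    shift a (M.restart (a, x)) = (shift a M).restart (0, x) := by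
  refine ext_of_measure_eq fun B hB => ?_
  have hm : MeasurableSet {z : ℝ × X | (z.1 - a, z.2) ∈ B} :=
    (by fun_prop : Measurable fun z : ℝ × X => (z.1 - a, z.2)) hB
  simp only [restart, future, add_val, Measure.add_apply, shift_apply _ _ hB,
    restrict_apply _ (measurableSet_after _) hm, restrict_apply _ (measurableSet_after _) hB,
    shift_apply _ _ (hB.inter (measurableSet_after 0)), Measure.dirac_apply' _ hm,
    Measure.dirac_apply' _ hB]
  congr 1
  · congr 1
    ext z
    simp [sub_pos]
  · change B.indicator 1 (a - a, x) = B.indicator 1 (0, x)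
    rw [sub_self]

end PastFuture

end Config

namespace Config

/-- The marked times whose interval `[z.1, z.1 + z.2]` started before time `a` and contains it. -/
def busySet (a : ℝ) : Set (ℝ × ℝ) := {z | z.1 < a ∧ a ≤ z.1 + z.2}

/-- A time is vacant if it is not in an interval `[z.1, z.1 + z.2]` that started before. -/
def Vacant (M : Config ℝ) (a : ℝ) : Prop := M.val (busySet a) = 0

/-- The number of points that start at a vacant time in `S`. -/
def upCount (M : Config ℝ) (S : Set ℝ) : ℝ≥0∞ := M.val {z | z.1 ∈ S ∧ M.Vacant z.1}

/-- The positive vacant times at which an interval starts. -/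
def upTimes (M : Config ℝ) : Set ℝ := {a | 0 < a ∧ (∃ z ∈ M.atoms, z.1 = a) ∧ M.Vacant a}

lemma measurableSet_busySet (a : ℝ) : MeasurableSet (busySet a) :=
  (measurableSet_lt measurable_fst measurable_const).inter
    (measurableSet_le measurable_const (measurable_fst.add measurable_snd))

lemma vacant_iff {M : Config ℝ} {a : ℝ} :
    M.Vacant a ↔ ∀ z ∈ M.atoms, z.1 < a → z.1 + z.2 < a := by
  rw [Vacant, M.measure_eq_zero_iff (measurableSet_busySet a)]
  simp [busySet]

lemma measurableSet_vacant : MeasurableSet {p : ℝ × Config ℝ | p.2.Vacant p.1} := by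
  refine measurable_measure_section (f := fun p : ℝ × Config ℝ => p.2) measurable_snd
    (S := {q : (ℝ × Config ℝ) × (ℝ × ℝ) | q.2.1 < q.1.1 ∧ q.1.1 ≤ q.2.1 + q.2.2}) ?_
    (measurableSet_singleton 0)
  exact (measurableSet_lt measurable_snd.fst measurable_fst.fst).inter
    (measurableSet_le measurable_fst.fst (measurable_snd.fst.add measurable_snd.snd))

lemma measurableSet_start_vacant (M : Config ℝ) {S : Set ℝ} (hS : MeasurableSet S) :
    MeasurableSet {z : ℝ × ℝ | z.1 ∈ S ∧ M.Vacant z.1} :=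
  (measurable_fst hS).inter
    (measurableSet_vacant.preimage (f := fun z : ℝ × ℝ => (z.1, M)) (by fun_prop))

lemma measurable_upCount {α : Type*} [MeasurableSpace α] {f : α → Config ℝ} (hf : Measurable f)
    {S : Set (α × ℝ)} (hS : MeasurableSet S) :
    Measurable fun a => (f a).upCount {s | (a, s) ∈ S} := by
  refine measurable_measure_section hf
    (S := {q : α × (ℝ × ℝ) | (q.1, q.2.1) ∈ S ∧ (f q.1).Vacant q.2.1}) ?_
  exact (hS.preimage (f := fun q : α × (ℝ × ℝ) => (q.1, q.2.1)) (by fun_prop)).inter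
    (measurableSet_vacant.preimage (f := fun q : α × (ℝ × ℝ) => (q.2.1, f q.1))
      (measurable_snd.fst.prodMk (hf.comp measurable_fst)))

lemma measurable_upCount_Ioc {α : Type*} [MeasurableSpace α] {f : α → Config ℝ}
    (hf : Measurable f) {s t : α → ℝ} (hs : Measurable s) (ht : Measurable t) :
    Measurable fun a => (f a).upCount (Set.Ioc (s a) (t a)) :=
  measurable_upCount hf (S := {p | s p.1 < p.2 ∧ p.2 ≤ t p.1})
    ((measurableSet_lt (hs.comp measurable_fst) measurable_snd).inter
      (measurableSet_le measurable_snd (ht.comp measurable_fst)))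

lemma upCount_eq_zero_iff {M : Config ℝ} {S : Set ℝ} (hS : MeasurableSet S) :
    M.upCount S = 0 ↔ ∀ z ∈ M.atoms, z.1 ∈ S → ¬ M.Vacant z.1 := by
  rw [upCount, M.measure_eq_zero_iff (M.measurableSet_start_vacant hS)]
  simp only [Set.mem_ofPred_eq, not_and]

lemma upCount_Ioc_eq_zero_iff {M : Config ℝ} {s : ℝ} (hs : 0 ≤ s) (t : ℝ) :
    M.upCount (Set.Ioc s t) = 0 ↔ ∀ a ∈ M.upTimes, a ≤ t → a ≤ s := by
  rw [upCount_eq_zero_iff measurableSet_Ioc]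
  constructor
  · rintro H _ ⟨-, ⟨z, hz, rfl⟩, hv⟩ hzt
    by_contra! hsz
    exact H z hz ⟨hsz, hzt⟩ hv
  · exact fun H z hz hzS hv =>
      (H z.1 ⟨hs.trans_lt hzS.1, ⟨z, hz, rfl⟩, hv⟩ hzS.2).not_gt hzS.1

lemma Simple.upCount_eq_encard {M : Config ℝ} (hM : M.Simple) {S : Set ℝ} (hS : MeasurableSet S)
    (hpos : S ⊆ Set.Ioi 0) : M.upCount S = ((M.upTimes ∩ S).encard : ℝ≥0∞) := by
  rw [upCount, hM.measure_eq_encard (M.measurableSet_start_vacant hS)]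
  congr 2
  ext a
  constructor
  · rintro ⟨z, ⟨hz, hzS, hv⟩, rfl⟩
    exact ⟨⟨hpos hzS, ⟨z, hz, rfl⟩, hv⟩, hzS⟩
  · rintro ⟨⟨-, ⟨z, hz, rfl⟩, hv⟩, hzS⟩
    exact ⟨z, ⟨hz, hzS, hv⟩, rfl⟩

lemma finite_upTimes (M : Config ℝ) (R : ℝ) : (M.upTimes ∩ Set.Iic R).Finite := by
  refine ((M.finite_atoms R).image Prod.fst).subset ?_
  rintro _ ⟨⟨hpos, ⟨z, hz, rfl⟩, -⟩, hR⟩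
  exact ⟨z, ⟨hz, (abs_of_pos hpos).trans_le hR⟩, rfl⟩

lemma vacant_past_iff {M : Config ℝ} {a b : ℝ} (hab : a ≤ b) :
    (past b M).Vacant a ↔ M.Vacant a := by
  rw [vacant_iff, vacant_iff, past, atoms_restrict]
  exact ⟨fun H z hz hza => H z ⟨hz, hza.trans_le hab⟩ hza, fun H z hz hza => H z hz.1 hza⟩

lemma upTimes_past (M : Config ℝ) (b : ℝ) : (past b M).upTimes = M.upTimes ∩ Set.Iio b := by
  ext a
  simp only [upTimes, past, atoms_restrict, Set.mem_inter_iff, Set.mem_ofPred_eq, Set.mem_Iio]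
  constructor
  · rintro ⟨hpos, ⟨z, ⟨hz, hzb⟩, rfl⟩, hv⟩
    exact ⟨⟨hpos, ⟨z, hz, rfl⟩, (vacant_past_iff hzb.le).1 hv⟩, hzb⟩
  · rintro ⟨⟨hpos, ⟨z, hz, rfl⟩, hv⟩, hzb⟩
    exact ⟨hpos, ⟨z, ⟨hz, hzb⟩, rfl⟩, (vacant_past_iff hzb.le).2 hv⟩

lemma vacant_restart_iff {M : Config ℝ} {z : ℝ × ℝ} {a : ℝ} (ha : z.1 < a) :
    (M.restart z).Vacant a ↔
      z.1 + z.2 < a ∧ ∀ w ∈ M.atoms, z.1 < w.1 → w.1 < a → w.1 + w.2 < a := by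
  rw [vacant_iff, Config.atoms_restart, Set.forall_mem_insert]
  exact and_congr (forall_prop_of_true ha)
    ⟨fun H w hw hzw => H w ⟨hw, hzw⟩, fun H w hw => H w hw.1 hw.2⟩

lemma vacant_restart_past_iff {M : Config ℝ} {z : ℝ × ℝ} {a : ℝ} (ha : z.1 < a) :
    ((past a M).restart z).Vacant a ↔ (M.restart z).Vacant a := by
  rw [vacant_restart_iff ha, vacant_restart_iff ha, past, atoms_restrict]
  exact and_congr_right fun _ => ⟨fun H w hw hzw hwa => H w ⟨hw, hwa⟩ hzw hwa,
    fun H w hw => H w hw.1⟩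

lemma Simple.atoms_restart {M : Config ℝ} (hM : M.Simple) {z : ℝ × ℝ} (hz : z ∈ M.atoms) :
    (M.restart z).atoms = M.atoms ∩ {w | z.1 ≤ w.1} := by
  rw [Config.atoms_restart]
  ext w
  simp only [Set.mem_insert_iff, Set.mem_inter_iff, Set.mem_ofPred_eq]
  constructor
  · rintro (rfl | ⟨hw, hzw⟩)
    exacts [⟨hz, le_rfl⟩, ⟨hw, hzw.le⟩]
  · rintro ⟨hw, hzw⟩
    exact hzw.eq_or_lt.imp (fun h => hM.injOn_fst_atoms hw hz h.symm) fun h => ⟨hw, h⟩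

lemma Simple.vacant_restart_iff {M : Config ℝ} (hM : M.Simple) {z : ℝ × ℝ} (hz : z ∈ M.atoms)
    (hv : M.Vacant z.1) {a : ℝ} (ha : z.1 < a) :
    (M.restart z).Vacant a ↔ M.Vacant a := by
  rw [vacant_iff, vacant_iff, hM.atoms_restart hz]
  refine ⟨fun H w hw hwa => ?_, fun H w hw hwa => H w hw.1 hwa⟩
  rcases lt_or_ge w.1 z.1 with h | h
  · exact (vacant_iff.1 hv w hw h).trans ha
  · exact H w ⟨hw, h⟩ hwa

lemma Simple.upCount_restart_eq_zero_iff {M : Config ℝ} (hM : M.Simple) {z : ℝ × ℝ}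
    (hz : z ∈ M.atoms) (hv : M.Vacant z.1) (t : ℝ) :
    (M.restart z).upCount (Set.Ioc z.1 t) = 0 ↔ M.upCount (Set.Ioc z.1 t) = 0 := by
  rw [upCount_eq_zero_iff measurableSet_Ioc, upCount_eq_zero_iff measurableSet_Ioc,
    hM.atoms_restart hz]
  have hvac : ∀ a ∈ Set.Ioc z.1 t, (M.restart z).Vacant a ↔ M.Vacant a :=
    fun a ha => hM.vacant_restart_iff hz hv ha.1
  exact ⟨fun H w hw hwS => (hvac _ hwS).not.1 (H w ⟨hw, hwS.1.le⟩ hwS),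
    fun H w hw hwS => (hvac _ hwS).not.2 (H w hw.1 hwS)⟩

lemma vacant_shift_iff {M : Config ℝ} {s a : ℝ} : (shift s M).Vacant a ↔ M.Vacant (a + s) := by
  have hbusy : {z : ℝ × ℝ | (z.1 - s, z.2) ∈ busySet a} = busySet (a + s) := by
    ext z
    constructor <;> rintro ⟨h₁, h₂⟩ <;> constructor <;> dsimp only at * <;> linarith
  rw [Vacant, Vacant, shift_apply s M (measurableSet_busySet a), hbusy]

lemma upCount_shift {M : Config ℝ} {s a b : ℝ} :
    (shift s M).upCount (Set.Ioc a b) = M.upCount (Set.Ioc (a + s) (b + s)) := by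
  rw [upCount, shift_apply s M (measurableSet_start_vacant _ measurableSet_Ioc), upCount]
  congr 1
  ext z
  simp only [Set.mem_ofPred_eq, vacant_shift_iff, sub_add_cancel, Set.mem_Ioc,
    lt_sub_iff_add_lt, sub_le_iff_le_add]

end Config

section Intensity

variable {X : Type*} [MeasurableSpace X]

/-- The intensity measure of points that arrive at rate `f` and carry independent marks of law
`G`. -/
def intensity (f : ℝ) (G : Measure X) : Measure (ℝ × X) :=
  ENNReal.ofReal f • (volume : Measure ℝ).prod G

variable {f : ℝ} {G : Measure X}

lemma lintegral_intensity [SFinite G] {g : ℝ × X → ℝ≥0∞} (hg : Measurable g) :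
    ∫⁻ z, g z ∂(intensity f G) = ENNReal.ofReal f * ∫⁻ a, ∫⁻ x, g (a, x) ∂G := by
  rw [intensity, lintegral_smul_measure, lintegral_prod _ hg.aemeasurable, smul_eq_mul]

lemma intensity_preimage_fst [IsProbabilityMeasure G] (S : Set ℝ) :
    intensity f G (Prod.fst ⁻¹' S) = ENNReal.ofReal f * volume S := by
  rw [intensity, Measure.smul_apply, ← Set.prod_univ, Measure.prod_prod, measure_univ, mul_one,
    smul_eq_mul]

lemma measurePreserving_intensity [SFinite G] (s : ℝ) :
    MeasurePreserving (fun z : ℝ × X => (z.1 - s, z.2)) (intensity f G) (intensity f G) :=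
  ((measurePreserving_sub_right volume s).prod (MeasurePreserving.id G)).smul_measure _

end Intensity

lemma poissonCount_singleton_zero (r : ℝ≥0∞) :
    poissonCount r {0} = ENNReal.ofReal (Real.exp (-r.toReal)) := by
  have hzero : (fun n : ℕ => (n : ℝ≥0∞)) ⁻¹' {0} = {0} := by ext n; simp
  rw [poissonCount, Measure.map_apply Measurable.of_discrete (measurableSet_singleton _), hzero,
    poissonMeasure_singleton]
  simp [ENNReal.toReal]

namespace IsPoissonLaw

open Config

section General

variable {X : Type*} [MeasurableSpace X] {Q : Measure (Config X)} {μ : Measure (ℝ × X)}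

lemma measure_void (hQ : IsPoissonLaw Q μ) {A : Set (ℝ × X)} (hA : MeasurableSet A)
    (hf : μ A ≠ ∞) : Q {M | M.val A = 0} = ENNReal.ofReal (Real.exp (-(μ A).toReal)) := by
  rw [← poissonCount_singleton_zero, ← hQ.map_count A hA hf,
    Measure.map_apply (measurable_coe hA) (measurableSet_singleton _)]
  rfl

lemma ae_eq_zero (hQ : IsPoissonLaw Q μ) {A : Set (ℝ × X)} (hA : MeasurableSet A)
    (h0 : μ A = 0) : ∀ᵐ M ∂Q, M.val A = 0 := by
  have hmean := hQ.lintegral_count hA (by simp [h0])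
  rwa [h0, lintegral_eq_zero_iff (measurable_coe hA)] at hmean

theorem map_shift (hQ : IsPoissonLaw Q μ) {s : ℝ}
    (hμ : MeasurePreserving (fun z : ℝ × X => (z.1 - s, z.2)) μ μ) :
    IsPoissonLaw (Q.map (shift s)) μ := by
  have := hQ.isProbabilityMeasure
  have := Measure.isProbabilityMeasure_map (μ := Q) (measurable_shift (X := X) s).aemeasurable
  let φ : ℝ × X → ℝ × X := fun z => (z.1 - s, z.2)
  have hcount : ∀ {A : Set (ℝ × X)}, MeasurableSet A →
      (fun M : Config X => M.val A) ∘ shift s = fun M => M.val (φ ⁻¹' A) :=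
    fun hA => funext fun M => shift_apply s M hA
  refine ⟨hQ.measure_strip_ne_top, fun A hA hAf => ?_, fun A hA hdisj => ?_⟩
  · have hμA : μ (φ ⁻¹' A) = μ A := hμ.measure_preimage hA.nullMeasurableSet
    rw [Measure.map_map (measurable_coe hA) (measurable_shift s), hcount hA,
      hQ.map_count _ (hμ.measurable hA) (hμA.trans_ne hAf), hμA]
  · have hindep := hQ.iIndepFun_count (fun i => φ ⁻¹' A i)
      (fun i => hμ.measurable (hA i)) fun i j hij => (hdisj hij).preimage _
    rw [iIndepFun_iff_map_fun_eq_infinitePi_map fun i => measurable_coe (hA i)]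
    rw [iIndepFun_iff_map_fun_eq_infinitePi_map fun i => measurable_coe (hμ.measurable (hA i))]
      at hindep
    rw [Measure.map_map (measurable_pi_lambda _ fun i => measurable_coe (hA i))
      (measurable_shift s)]
    simp_rw [Measure.map_map (measurable_coe (hA _)) (measurable_shift s), hcount (hA _)]
    rw [← hindep]
    congr 1
    exact funext fun M => funext fun i => shift_apply s M (hA i)

end General

section Intensity

variable {X : Type*} [MeasurableSpace X] {Q : Measure (Config X)} {f : ℝ} {G : Measure X}

lemma map_shift_eq [SFinite G] (hQ : IsPoissonLaw Q (intensity f G)) (s : ℝ) :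
    Q.map (shift s) = Q :=
  (hQ.map_shift (measurePreserving_intensity s)).unique hQ

theorem ae_simple [MeasurableSingletonClass X] [IsProbabilityMeasure G]
    (hQ : IsPoissonLaw Q (intensity f G)) : ∀ᵐ M ∂Q, M.Simple := by
  -- By Mecke's formula, the mean number of points that share their time is the integral of the
  -- probability that a new point meets one at its own time.
  let D : Set (Config X × (ℝ × X)) := {p | 1 < p.1.val {w | w.1 = p.2.1}}
  have hcount : Measurable fun p : Config X × (ℝ × X) => p.1.val {w | w.1 = p.2.1} :=
    measurable_measure_section measurable_fst
      (S := {q : (Config X × (ℝ × X)) × (ℝ × X) | q.2.1 = q.1.2.1})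
      (measurableSet_eq_fun measurable_snd.fst measurable_fst.snd.fst)
  have hD : MeasurableSet D := hcount measurableSet_Ioi
  have hadd : ∀ z : ℝ × X, Q {M | (M.add z, z) ∈ D} = 0 := by
    intro z
    have hnull : intensity f G {w | w.1 = z.1} = 0 :=
      (intensity_preimage_fst {z.1}).trans (by rw [Real.volume_singleton, mul_zero])
    refine measure_eq_zero_iff_ae_notMem.2 ?_
    filter_upwards [hQ.ae_eq_zero (measurableSet_time z.1) hnull] with M hM
    simp only [D, Set.mem_ofPred_eq, add_val, Measure.add_apply, hM, zero_add, not_lt]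
    exact prob_le_one
  have hmean : ∫⁻ M, M.val {z | (M, z) ∈ D} ∂Q = 0 := by
    rw [hQ.mecke_set hD]
    simp only [hadd, lintegral_zero]
  rw [lintegral_eq_zero_iff 
    (measurable_measure_section (f := fun M : Config X => M) measurable_id hD)] at hmean
  filter_upwards [hmean] with M hM a
  by_contra! ha
  obtain ⟨z, hz, rfl⟩ : ∃ z ∈ M.atoms, z.1 = a := by
    by_contra! hno
    exact (zero_lt_one.trans ha).ne' ((M.measure_eq_zero_iff (measurableSet_time a)).2 hno)
  exact (M.measure_eq_zero_iff (measurable_prodMk_left hD)).1 hM z hz ha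

lemma ae_mark_mem [MeasurableSingletonClass X] [SFinite G] (hQ : IsPoissonLaw Q (intensity f G))
    {S : Set X} (hS : MeasurableSet S) (hGS : ∀ᵐ x ∂G, x ∈ S) :
    ∀ᵐ M ∂Q, ∀ z ∈ M.atoms, z.2 ∈ S := by
  have hnull : intensity f G (Prod.snd ⁻¹' Sᶜ) = 0 := by
    have hGS' : G Sᶜ = 0 := hGS
    rw [intensity, Measure.smul_apply, ← Set.univ_prod, Measure.prod_prod, hGS', mul_zero,
      smul_zero]
  filter_upwards [hQ.ae_eq_zero (measurable_snd hS.compl) hnull] with M hM z hz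
  by_contra h
  exact (M.measure_eq_zero_iff (measurable_snd hS.compl)).1 hM z hz h

end Intensity

end IsPoissonLaw

section Tail

open Config

/-- The probability that no interval starts at a vacant time in `(0, t]`, when an interval of
length `l` starts at time `0` and those that started before are deleted. -/
def tailGiven (Q : Measure (Config ℝ)) (l t : ℝ) : ℝ≥0∞ :=
  Q {M | (M.restart (0, l)).upCount (Set.Ioc 0 t) = 0}

/-- The probability that no interval starts at a vacant time in `(0, t]`, when an interval with a
length of law `G` starts at time `0` and those that started before are deleted. -/
def tail (Q : Measure (Config ℝ)) (G : Measure ℝ) (t : ℝ) : ℝ≥0∞ :=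
  ∫⁻ l, tailGiven Q l t ∂G

lemma measurable_tailGiven (Q : Measure (Config ℝ)) [SFinite Q] {α : Type*} [MeasurableSpace α]
    {l t : α → ℝ} (hl : Measurable l) (ht : Measurable t) :
    Measurable fun a => tailGiven Q (l a) (t a) := by
  have hrestart : Measurable fun q : α × Config ℝ => q.2.restart (0, l q.1) :=
    measurable_restart.comp
      (measurable_snd.prodMk (measurable_const.prodMk (hl.comp measurable_fst)))
  exact measurable_measure_prodMk_left (s := {q : α × Config ℝ |
      (q.2.restart (0, l q.1)).upCount (Set.Ioc 0 (t q.1)) = 0})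
    (measurable_upCount_Ioc hrestart measurable_const (ht.comp measurable_fst)
      (measurableSet_singleton 0))

namespace IsPoissonLaw

variable {Q : Measure (Config ℝ)} {f : ℝ} {G : Measure ℝ}

lemma measure_past_restart [SFinite G] (hQ : IsPoissonLaw Q (intensity f G))
    {A : Set (Config ℝ)} (hA : MeasurableSet A) (z : ℝ × ℝ) (t : ℝ) :
    Q {M | past z.1 M ∈ A ∧ (M.restart z).upCount (Set.Ioc z.1 (z.1 + t)) = 0} =
      Q {M | past z.1 M ∈ A} * tailGiven Q z.2 t := by
  have hindep : IndepFun (past z.1) (future z.1) Q :=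
    hQ.indepFun_restrict (measurableSet_before _) (measurableSet_after _)
      (Set.disjoint_left.2 fun w (h : w.1 < z.1) (h' : z.1 < w.1) => lt_asymm h h')
  have hfuture : MeasurableSet {N : Config ℝ | (N.add z).upCount (Set.Ioc z.1 (z.1 + t)) = 0} :=
    measurable_upCount_Ioc (Config.measurable_add.comp (measurable_id.prodMk measurable_const))
      measurable_const measurable_const (measurableSet_singleton 0)
  have hrestart : MeasurableSet {M : Config ℝ | (M.restart (0, z.2)).upCount (Set.Ioc 0 t) = 0} :=
    measurable_upCount_Ioc (measurable_restart.comp (measurable_id.prodMk measurable_const))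
      measurable_const measurable_const (measurableSet_singleton 0)
  refine (hindep.measure_inter_preimage_eq_mul _ _ hA hfuture).trans ?_
  congr 1
  rw [tailGiven]
  conv_rhs => rw [← hQ.map_shift_eq z.1, Measure.map_apply (measurable_shift _) hrestart]
  congr 1
  ext M
  simp only [Set.mem_preimage, Set.mem_ofPred_eq]
  rw [← shift_restart, upCount_shift, zero_add, add_comm t, restart]

theorem lintegral_count_past_restart [SFinite G] (hQ : IsPoissonLaw Q (intensity f G))
    {H : Set (ℝ × Config ℝ)} (hH : MeasurableSet H) {τ : ℝ → ℝ} (hτ : Measurable τ) :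
    ∫⁻ M, M.val {z | (z.1, past z.1 M) ∈ H ∧
        (M.restart z).upCount (Set.Ioc z.1 (z.1 + τ z.1)) = 0} ∂Q =
      ENNReal.ofReal f * ∫⁻ a, Q {M | (a, past a M) ∈ H} * tail Q G (τ a) := by
  have := hQ.isProbabilityMeasure
  let pastHit : Set (Config ℝ × (ℝ × ℝ)) := {p | (p.2.1, past p.2.1 p.1) ∈ H}
  have hpastHit : MeasurableSet pastHit := hH.preimage
    (measurable_snd.fst.prodMk (measurable_past.comp (measurable_snd.fst.prodMk measurable_fst)))
  let noUp : Set (Config ℝ × (ℝ × ℝ)) :=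
    {p | (p.1.restart p.2).upCount (Set.Ioc p.2.1 (p.2.1 + τ p.2.1)) = 0}
  have hnoUp : MeasurableSet noUp :=
    measurable_upCount_Ioc measurable_restart measurable_snd.fst
      (measurable_snd.fst.add (hτ.comp measurable_snd.fst)) (measurableSet_singleton 0)
  have hsplit : ∀ z : ℝ × ℝ, Q {M | (M.add z, z) ∈ pastHit ∩ noUp} =
      Q {M | (z.1, past z.1 M) ∈ H} * tailGiven Q z.2 (τ z.1) := fun z => by
    simp only [pastHit, noUp, Set.mem_inter_iff, Set.mem_ofPred_eq, past_add, restart_add]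
    exact hQ.measure_past_restart (A := {M | (z.1, M) ∈ H}) (measurable_prodMk_left hH) z (τ z.1)
  have hpastProb : Measurable fun a : ℝ => Q {M | (a, past a M) ∈ H} :=
    measurable_measure_prodMk_left (s := (fun p : ℝ × Config ℝ => (p.1, past p.1 p.2)) ⁻¹' H)
      ((measurable_fst.prodMk measurable_past) hH)
  have hmecke := hQ.mecke_set (hpastHit.inter hnoUp)
  rw [lintegral_congr hsplit] at hmecke
  have hprod : Measurable fun z : ℝ × ℝ =>
      Q {M | (z.1, past z.1 M) ∈ H} * tailGiven Q z.2 (τ z.1) :=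
    (hpastProb.comp measurable_fst).mul
      (measurable_tailGiven Q measurable_snd (hτ.comp measurable_fst))
  rw [lintegral_intensity hprod] at hmecke
  refine hmecke.trans ?_
  congr 1
  exact lintegral_congr fun a => lintegral_const_mul (f := fun l => tailGiven Q l (τ a))
    (Q {M | (a, past a M) ∈ H}) (measurable_tailGiven Q measurable_id measurable_const)

end IsPoissonLaw

end Tail

lemma iIndepSet_iInter_preimage {Ω E ι κ : Type*} [MeasurableSpace Ω] [MeasurableSpace E]
    [Finite κ] {P : Measure Ω} {Y : ι × κ → Ω → E} (hY : ∀ p, Measurable (Y p))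
    (hindep : iIndepFun Y P) {T : κ → Set E} (hT : ∀ j, MeasurableSet (T j)) :
    iIndepSet (fun i => ⋂ j, Y (i, j) ⁻¹' T j) P := by
  have := Fintype.ofFinite κ
  rw [iIndepSet_iff_meas_biInter fun i => .iInter fun j => hY _ (hT j)]
  have hprod : ∀ S : Finset ι,
      P (⋂ i ∈ S, ⋂ j, Y (i, j) ⁻¹' T j) = ∏ i ∈ S, ∏ j, P (Y (i, j) ⁻¹' T j) := fun S => by
    rw [← Finset.prod_product', ← iIndepFun_iff_measure_inter_preimage_eq_mul.1 hindep
      (S ×ˢ Finset.univ) (sets := fun p => T p.2) fun p _ => hT p.2]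
    congr 1
    ext ω
    simp only [Set.mem_iInter, Finset.mem_product, Finset.mem_univ, and_true, Prod.forall]
    exact ⟨fun h i j hi => h i hi j, fun h i hi j => h i j hi⟩
  intro S
  rw [hprod]
  exact Finset.prod_congr rfl fun i _ => by simpa using (hprod {i}).symm

namespace Config

/-- The points with times in the `n`-th of the consecutive intervals of length `c` that start at
time `0`. -/
def window (X : Type*) (c : ℝ) (n : ℕ) : Set (ℝ × X) :=
  Prod.fst ⁻¹' Set.Ico (n * c) ((n + 1 : ℕ) * c)

lemma pairwise_disjoint_window (X : Type*) {c : ℝ} (hc : 0 ≤ c) :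
    Pairwise fun m n => Disjoint (window X c m) (window X c n) := by
  have hmono : Monotone fun n : ℕ => (n : ℝ) * c :=
    fun m n h => mul_le_mul_of_nonneg_right (Nat.cast_le.2 h) hc
  exact fun m n hmn => (hmono.pairwise_disjoint_on_Ico_succ hmn).preimage _

lemma measurableSet_window {X : Type*} [MeasurableSpace X] (c : ℝ) (n : ℕ) :
    MeasurableSet (window X c n) :=
  measurable_fst measurableSet_Ico

-- The first start after an empty window longer than every interval is at a vacant time.
lemma exists_upTime_of_window {M : Config ℝ} {d c : ℝ} (hd : 0 ≤ d) (hdc : d < c)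
    (hmark : ∀ z ∈ M.atoms, z.2 ≤ d) {n : ℕ} (hempty : M.val (window ℝ c n) = 0)
    (hne : M.val (window ℝ c (n + 1)) ≠ 0) : ∃ a ∈ M.upTimes, (n + 1) * c ≤ a := by
  rw [M.measure_eq_zero_iff (measurableSet_window c n)] at hempty
  obtain ⟨z₀, hz₀⟩ : (M.atoms ∩ window ℝ c (n + 1)).Nonempty := by
    by_contra hno
    refine hne ((M.measure_eq_zero_iff (measurableSet_window c (n + 1))).2 fun z hz hzw => ?_)
    exact hno ⟨z, hz, hzw⟩
  simp only [window, Set.mem_preimage, Set.mem_Ico, Nat.cast_add, Nat.cast_one] at hempty hz₀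
  have hstart : 0 < (n + 1) * c := by nlinarith
  have hfin : (M.atoms ∩ window ℝ c (n + 1)).Finite := by
    refine (M.finite_atoms ((n + 1 + 1) * c)).subset fun z ⟨hz, hz₁, hz₂⟩ => ⟨hz, ?_⟩
    push_cast at hz₁ hz₂
    exact abs_le.2 ⟨by linarith, hz₂.le⟩
  obtain ⟨z, ⟨hz, hz₁, hz₂⟩, hmin⟩ :=
    hfin.exists_minimalFor Prod.fst _ ⟨z₀, by simpa [window] using hz₀⟩
  push_cast at hz₁
  refine ⟨z.1, ⟨hstart.trans_le hz₁, ⟨z, hz, rfl⟩, vacant_iff.2 fun w hw hwz => ?_⟩, hz₁⟩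
  have hw_before : w.1 < (n + 1) * c := by
    by_contra! h
    exact hwz.not_ge (hmin ⟨hw, by exact_mod_cast h, hwz.trans hz₂⟩ hwz.le)
  have hw_empty : w.1 < n * c := by
    by_contra! h
    exact hempty w hw ⟨h, hw_before⟩
  linarith [hmark w hw]

end Config

namespace IsPoissonLaw

open Config

variable {X : Type*} [MeasurableSpace X] {Q : Measure (Config X)} {f c : ℝ}

lemma measure_window_eq_zero {G : Measure X} [IsProbabilityMeasure G]
    (hQ : IsPoissonLaw Q (intensity f G)) (n : ℕ) :
    Q {M | M.val (window X c n) = 0} =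
      ENNReal.ofReal (Real.exp (-(ENNReal.ofReal f * ENNReal.ofReal c).toReal)) := by
  have hμ : intensity f G (window X c n) = ENNReal.ofReal f * ENNReal.ofReal c := by
    rw [window, intensity_preimage_fst, Real.volume_Ico]
    push_cast
    ring_nf
  rw [hQ.measure_void (measurableSet_window c n) (hμ ▸ ENNReal.mul_ne_top (by simp) (by simp)), hμ]

theorem ae_frequently_window {G : Measure X} [IsProbabilityMeasure G]
    (hQ : IsPoissonLaw Q (intensity f G)) (hf : 0 < f) (hc : 0 < c) :
    ∀ᵐ M ∂Q, ∃ᶠ k in atTop,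
      M.val (window X c (2 * k)) = 0 ∧ M.val (window X c (2 * k + 1)) ≠ 0 := by
  have := hQ.isProbabilityMeasure
  let count : ℕ × Bool → Config X → ℝ≥0∞ := fun p M => M.val (window X c (2 * p.1 + p.2.toNat))
  let target : Bool → Set ℝ≥0∞ := fun b => if b then {0}ᶜ else {0}
  have hcount : ∀ p, Measurable (count p) := fun p => measurable_coe (measurableSet_window c _)
  have htarget : ∀ b, MeasurableSet (target b) := by
    rintro (_ | _)
    exacts [measurableSet_singleton 0, (measurableSet_singleton 0).compl]
  have hindep : iIndepFun count Q :=
    (hQ.iIndepFun_count (window X c) (measurableSet_window c)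
      (pairwise_disjoint_window X hc.le)).precomp (g := fun p : ℕ × Bool => 2 * p.1 + p.2.toNat)
      (by rintro ⟨j, _ | _⟩ ⟨k, _ | _⟩ <;> simp <;> omega)
  have hprob : ∀ k, Q (⋂ b, count (k, b) ⁻¹' target b) =
      (1 - ENNReal.ofReal (Real.exp (-(ENNReal.ofReal f * ENNReal.ofReal c).toReal))) *
        ENNReal.ofReal (Real.exp (-(ENNReal.ofReal f * ENNReal.ofReal c).toReal)) := fun k => by
    have hfactor := (hindep.precomp (Prod.mk_right_injective k)).meas_iInter
      (s := fun b => count (k, b) ⁻¹' target b) fun b => ⟨_, htarget b, rfl⟩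
    rw [hfactor, Fintype.prod_bool]
    congr 1
    · have hmeas : MeasurableSet {M : Config X | M.val (window X c (2 * k + 1)) = 0} :=
        measurable_coe (measurableSet_window c _) (measurableSet_singleton 0)
      rw [← hQ.measure_window_eq_zero (2 * k + 1), ← prob_compl_eq_one_sub hmeas]
      rfl
    · exact hQ.measure_window_eq_zero (2 * k)
  have hsum : ∑' k, Q (⋂ b, count (k, b) ⁻¹' target b) = ∞ := by
    simp_rw [hprob]
    refine ENNReal.tsum_const_eq_top_of_ne_zero (mul_ne_zero (tsub_pos_of_lt ?_).ne' ?_)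
    · simpa [hf.le, hc.le] using mul_pos hf hc
    · simp [Real.exp_pos]
  have hmeas : ∀ k, MeasurableSet (⋂ b, count (k, b) ⁻¹' target b) :=
    fun k => .iInter fun b => hcount _ (htarget b)
  have hlim := measure_limsup_eq_one hmeas (iIndepSet_iInter_preimage hcount hindep htarget) hsum
  filter_upwards [(mem_ae_iff_prob_eq_one (.measurableSet_limsup hmeas)).2 hlim] with M hM
  rw [mem_limsup_iff_frequently_mem] at hM
  refine hM.mono fun k hk => ?_
  rw [Set.mem_iInter] at hk
  exact ⟨hk false, hk true⟩

theorem ae_infinite_upTimes {Q : Measure (Config ℝ)} {G : Measure ℝ} [IsProbabilityMeasure G]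
    (hQ : IsPoissonLaw Q (intensity f G)) (hf : 0 < f) {d : ℝ} (hd : ∀ᵐ l ∂G, l ≤ d) :
    ∀ᵐ M ∂Q, M.upTimes.Infinite := by
  have hc : 0 < |d| + 1 := by positivity
  filter_upwards [hQ.ae_frequently_window hf hc, hQ.ae_mark_mem measurableSet_Iic hd]
    with M hM hmark
  refine Set.infinite_of_not_bddAbove fun ⟨R, hR⟩ => ?_
  obtain ⟨n, hn⟩ := exists_nat_gt R
  obtain ⟨k, hk, hempty, hne⟩ := frequently_atTop.1 hM n
  obtain ⟨a, ha, hka⟩ := exists_upTime_of_window (abs_nonneg d) (lt_add_one |d|)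
    (fun z hz => (hmark z hz).trans (le_abs_self d)) hempty hne
  have hkn : (n : ℝ) ≤ k := by exact_mod_cast hk
  push_cast at hka
  nlinarith [hR ha, abs_nonneg d, (Nat.cast_nonneg k : (0 : ℝ) ≤ k)]

end IsPoissonLaw

lemma measurable_sInf_of_isUpperSet {α : Type*} [MeasurableSpace α] {S : α → Set ℝ}
    (hS : ∀ t, MeasurableSet {a | t ∈ S a}) (hup : ∀ a, IsUpperSet (S a))
    (hbdd : ∀ a, BddBelow (S a)) : Measurable fun a => sInf (S a) := by
  refine measurable_of_Iio fun t => ?_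
  -- The second set takes care of the junk value `sInf ∅ = 0`.
  have hlt : (fun a => sInf (S a)) ⁻¹' Set.Iio t =
      (⋃ q : {q : ℚ // (q : ℝ) < t}, {a | (q : ℝ) ∈ S a}) ∪
        ({_a : α | 0 < t} ∩ ⋂ q : ℚ, {a | (q : ℝ) ∈ S a}ᶜ) := by
    ext a
    simp only [Set.mem_preimage, Set.mem_Iio, Set.mem_union, Set.mem_iUnion, Set.mem_ofPred_eq,
      Set.mem_inter_iff, Set.mem_iInter, Set.mem_compl_iff]
    rcases (S a).eq_empty_or_nonempty with hempty | hne
    · simp [hempty]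
    rw [csInf_lt_iff (hbdd a) hne]
    constructor
    · rintro ⟨s, hs, hst⟩
      obtain ⟨q, hsq, hqt⟩ := exists_rat_btwn hst
      exact Or.inl ⟨⟨q, hqt⟩, hup a hsq.le hs⟩
    · rintro (⟨⟨q, hqt⟩, hq⟩ | ⟨-, hno⟩)
      · exact ⟨q, hq, hqt⟩
      · obtain ⟨s, hs⟩ := hne
        obtain ⟨q, hq⟩ := exists_rat_gt s
        exact absurd (hup a hq.le hs) (hno q)
  rw [hlt]
  exact (MeasurableSet.iUnion fun q => hS _).union
    ((MeasurableSet.const _).inter (MeasurableSet.iInter fun q => (hS _).compl))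

namespace Config

/-- The first time by which at least `n + 1` intervals have started at positive vacant times. For a
simple configuration with infinitely many such times this is the `n`-th of them, counted from
`0`. -/
def upEpoch (n : ℕ) (M : Config ℝ) : ℝ :=
  sInf {t | ((n + 1 : ℕ) : ℝ≥0∞) ≤ M.upCount (Set.Ioc 0 t)}

lemma measurable_upEpoch (n : ℕ) : Measurable (upEpoch n) := by
  refine measurable_sInf_of_isUpperSet (fun t => ?_) (fun M s t hst hs => ?_) fun M =>
    ⟨0, fun t ht => ?_⟩
  · exact measurableSet_le measurable_const
      (measurable_upCount_Ioc measurable_id measurable_const measurable_const)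
  · have hsub : {z : ℝ × ℝ | z.1 ∈ Set.Ioc 0 s ∧ M.Vacant z.1} ⊆
        {z | z.1 ∈ Set.Ioc 0 t ∧ M.Vacant z.1} :=
      fun z hz => ⟨Set.Ioc_subset_Ioc_right hst hz.1, hz.2⟩
    exact le_trans hs (measure_mono hsub)
  · by_contra! h
    rw [Set.mem_ofPred_eq, Set.Ioc_eq_empty h.not_gt] at ht
    simp [upCount] at ht

lemma Simple.upEpoch_eq_of_encard {M : Config ℝ} (hM : M.Simple) {n : ℕ} {s : ℝ}
    (hs : ∀ t, ((n + 1 : ℕ) : ℕ∞) ≤ (M.upTimes ∩ Set.Iic t).encard ↔ s ≤ t) :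
    upEpoch n M = s := by
  have hIci : {t | ((n + 1 : ℕ) : ℝ≥0∞) ≤ M.upCount (Set.Ioc 0 t)} = Set.Ici s := by
    ext t
    have hIic : M.upTimes ∩ Set.Ioc 0 t = M.upTimes ∩ Set.Iic t := by
      ext a
      exact ⟨fun h => ⟨h.1, h.2.2⟩, fun h => ⟨h.1, h.1.1, h.2⟩⟩
    rw [Set.mem_Ici, ← hs t, Set.mem_ofPred_eq,
      hM.upCount_eq_encard measurableSet_Ioc fun a ha => ha.1, hIic, ← ENat.toENNReal_coe,
      ENat.toENNReal_le]
  rw [upEpoch, hIci, csInf_Ici]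

lemma Simple.upEpoch_eq_successive {M : Config ℝ} (hM : M.Simple) (hU : M.upTimes.Infinite)
    (n : ℕ) : upEpoch n M = successive M.upTimes n :=
  hM.upEpoch_eq_of_encard (le_encard_inter_Iic_iff M.finite_upTimes hU n)

lemma Simple.upEpoch_past {M : Config ℝ} (hM : M.Simple) (hU : M.upTimes.Infinite) {i n : ℕ}
    (hi : i < n) : upEpoch i (past (successive M.upTimes n) M) = successive M.upTimes i := by
  have hlt := strictMono_successive M.finite_upTimes hU hi
  refine (hM.simple_past _).upEpoch_eq_of_encard fun t => ?_
  rw [upTimes_past, Set.inter_assoc]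
  rcases lt_or_ge t (successive M.upTimes n) with ht | ht
  · rw [Set.inter_eq_right.2 (Set.Iic_subset_Iio.2 ht),
      le_encard_inter_Iic_iff M.finite_upTimes hU]
  · rw [Set.inter_eq_left.2 (Set.Iio_subset_Iic ht),
      encard_inter_Iio_successive M.finite_upTimes hU]
    exact iff_of_true (by exact_mod_cast hi) (hlt.le.trans ht)

/-- The sequence of the epochs, constant from the `n`-th one on. -/
def stoppedEpochs (n : ℕ) (M : Config ℝ) (i : ℕ) : ℝ := upEpoch (min i n) M

lemma measurable_stoppedEpochs (n : ℕ) : Measurable (stoppedEpochs n) :=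
  measurable_pi_lambda _ fun _ => measurable_upEpoch _

lemma Simple.stoppedEpochs_eq {M : Config ℝ} (hM : M.Simple) (hU : M.upTimes.Infinite) (n : ℕ) :
    stoppedEpochs n M = fun i => if i < n then
      upEpoch i (past (successive M.upTimes n) M) else successive M.upTimes n := by
  ext i
  rw [stoppedEpochs, hM.upEpoch_eq_successive hU]
  split_ifs with hi
  · rw [hM.upEpoch_past hU hi, min_eq_left hi.le]
  · rw [min_eq_right (not_lt.1 hi)]

/-- The time between two consecutive epochs. -/
def upGap (n : ℕ) (M : Config ℝ) : ℝ := upEpoch (n + 1) M - upEpoch n M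

lemma measurable_upGap (n : ℕ) : Measurable (upGap n) :=
  (measurable_upEpoch _).sub (measurable_upEpoch _)

lemma Simple.upGap_pos {M : Config ℝ} (hM : M.Simple) (hU : M.upTimes.Infinite) (n : ℕ) :
    0 < upGap n M := by
  rw [upGap, hM.upEpoch_eq_successive hU, hM.upEpoch_eq_successive hU, sub_pos]
  exact strictMono_successive M.finite_upTimes hU n.lt_succ_self

lemma Simple.upCount_Ioc_successive_eq_zero_iff {M : Config ℝ} (hM : M.Simple)
    (hU : M.upTimes.Infinite) (n : ℕ) (t : ℝ) :
    M.upCount (Set.Ioc (successive M.upTimes n) (successive M.upTimes n + t)) = 0 ↔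
      t < upGap n M := by
  have hnext := isLeast_successive_succ M.finite_upTimes hU n
  rw [upCount_Ioc_eq_zero_iff (successive_mem M.finite_upTimes hU n).1.le, upGap,
    hM.upEpoch_eq_successive hU, hM.upEpoch_eq_successive hU]
  refine ⟨fun H => ?_, fun ht a ha hat => ?_⟩
  · by_contra! h
    exact hnext.1.2.not_ge (H _ hnext.1.1 (by linarith))
  · by_contra! h
    linarith [hnext.2 ⟨ha, h⟩]

/-- The pairs of a time and a configuration before it such that this time is vacant and, if it is
the `n`-th epoch, the epochs up to it form a sequence in `K`. -/
def epochEvent (n : ℕ) (K : Set (ℕ → ℝ)) : Set (ℝ × Config ℝ) :=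
  {p | 0 < p.1 ∧ p.2.Vacant p.1 ∧ p.2.upCount (Set.Ioi 0) = n ∧
    (fun i => if i < n then upEpoch i p.2 else p.1) ∈ K}

lemma measurableSet_epochEvent (n : ℕ) {K : Set (ℕ → ℝ)} (hK : MeasurableSet K) :
    MeasurableSet (epochEvent n K) := by
  have hcount : Measurable fun p : ℝ × Config ℝ => p.2.upCount (Set.Ioi 0) :=
    measurable_upCount measurable_snd (S := {q : (ℝ × Config ℝ) × ℝ | 0 < q.2})
      (measurableSet_lt measurable_const measurable_snd)
  have hepochs : Measurable fun (p : ℝ × Config ℝ) (i : ℕ) =>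
      if i < n then upEpoch i p.2 else p.1 := by
    refine measurable_pi_lambda _ fun i => ?_
    split_ifs
    · exact (measurable_upEpoch i).comp measurable_snd
    · exact measurable_fst
  exact (measurableSet_lt measurable_const measurable_fst).inter
    (measurableSet_vacant.inter ((hcount (measurableSet_singleton _)).inter (hepochs hK)))

lemma Simple.mem_epochEvent_past_iff {M : Config ℝ} (hM : M.Simple) (hU : M.upTimes.Infinite)
    (n : ℕ) (K : Set (ℕ → ℝ)) {z : ℝ × ℝ} (hz : z ∈ M.atoms) :
    (z.1, past z.1 M) ∈ epochEvent n K ↔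
      z.1 = successive M.upTimes n ∧ stoppedEpochs n M ∈ K := by
  have hcount : (past z.1 M).upCount (Set.Ioi 0) = n ↔
      (M.upTimes ∩ Set.Iio z.1).encard = n := by
    have hpast : (past z.1 M).upTimes ∩ Set.Ioi 0 = M.upTimes ∩ Set.Iio z.1 := by
      rw [upTimes_past]
      exact Set.inter_eq_left.2 fun a ha => ha.1.1
    rw [(hM.simple_past _).upCount_eq_encard measurableSet_Ioi subset_rfl, hpast,
      ← ENat.toENNReal_coe, ENat.toENNReal_inj]
  rw [hM.stoppedEpochs_eq hU]
  constructor
  · rintro ⟨hpos, hv, hn, hzK⟩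
    have hzn := eq_successive_of_encard M.finite_upTimes hU
      ⟨hpos, ⟨z, hz, rfl⟩, (vacant_past_iff le_rfl).1 hv⟩ (hcount.1 hn)
    exact ⟨hzn, hzn ▸ hzK⟩
  · rintro ⟨hzn, hzK⟩
    obtain ⟨hpos, -, hv⟩ : z.1 ∈ M.upTimes := hzn ▸ successive_mem M.finite_upTimes hU n
    refine ⟨hpos, (vacant_past_iff le_rfl).2 hv, hcount.2 ?_, hzn ▸ hzK⟩
    rw [hzn, encard_inter_Iio_successive M.finite_upTimes hU]

lemma measurableSet_past_restart {H : Set (ℝ × Config ℝ)} (hH : MeasurableSet H) {τ : ℝ → ℝ}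
    (hτ : Measurable τ) (M : Config ℝ) : MeasurableSet {z : ℝ × ℝ | (z.1, past z.1 M) ∈ H ∧
      (M.restart z).upCount (Set.Ioc z.1 (z.1 + τ z.1)) = 0} := by
  have hpast : Measurable fun z : ℝ × ℝ => (z.1, past z.1 M) :=
    measurable_fst.prodMk (measurable_past.comp (measurable_fst.prodMk measurable_const))
  exact (hpast hH).inter (measurable_upCount_Ioc
    (measurable_restart.comp (measurable_const.prodMk measurable_id)) measurable_fst
    (measurable_fst.add (hτ.comp measurable_fst)) (measurableSet_singleton 0))

-- The only contribution comes from the interval that starts at the `n`-th epoch.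
lemma Simple.measure_epochEvent {M : Config ℝ} (hM : M.Simple) (hU : M.upTimes.Infinite) (n : ℕ)
    {K : Set (ℕ → ℝ)} (hK : MeasurableSet K) (t : ℝ) :
    M.val {z | (z.1, past z.1 M) ∈ epochEvent n K ∧
        (M.restart z).upCount (Set.Ioc z.1 (z.1 + t)) = 0} =
      {M | stoppedEpochs n M ∈ K ∧ t < upGap n M}.indicator 1 M := by
  have hmem := successive_mem M.finite_upTimes hU n
  rw [hM.measure_eq_encard_of_forall
    (S := {a | a = successive M.upTimes n ∧ stoppedEpochs n M ∈ K ∧ t < upGap n M})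
    (measurableSet_past_restart (measurableSet_epochEvent n hK) measurable_const M)]
  · by_cases hev : stoppedEpochs n M ∈ K ∧ t < upGap n M
    · rw [Set.indicator_of_mem (by exact hev)]
      simp [hev]
    · rw [Set.indicator_of_notMem (by exact hev)]
      simp [hev]
  · rintro _ ⟨rfl, -⟩
    exact hmem.2.1
  · intro z hz
    simp only [Set.mem_ofPred_eq, hM.mem_epochEvent_past_iff hU n K hz, and_assoc]
    refine and_congr_right fun hzn => and_congr_right fun _ => ?_
    rw [hM.upCount_restart_eq_zero_iff hz (hzn ▸ hmem.2.2), hzn,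
      hM.upCount_Ioc_successive_eq_zero_iff hU]

end Config

lemma indepFun_of_measure_inter_Ioi {Ω E : Type*} [MeasurableSpace Ω] [MeasurableSpace E]
    {P : Measure Ω} [IsProbabilityMeasure P] {X : Ω → E} {Y : Ω → ℝ} (hX : Measurable X)
    (hY : Measurable Y) (h : ∀ K, MeasurableSet K → ∀ t,
      P (X ⁻¹' K ∩ Y ⁻¹' Set.Ioi t) = P (X ⁻¹' K) * P (Y ⁻¹' Set.Ioi t)) : IndepFun X Y P := by
  have hYcomap : (borel ℝ).comap Y =
      MeasurableSpace.generateFrom (Set.preimage Y '' Set.range Set.Ioi) := by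
    rw [borel_eq_generateFrom_Ioi, MeasurableSpace.comap_generateFrom]
  rw [IndepFun_iff_Indep]
  refine IndepSets.indep hX.comap_le hY.comap_le (p1 := {A | ∃ K, MeasurableSet K ∧ X ⁻¹' K = A})
    (p2 := Set.preimage Y '' Set.range Set.Ioi) ?_ (isPiSystem_Ioi.comap Y)
    ?_ ?_ ?_
  · rintro _ ⟨K, hK, rfl⟩ _ ⟨K', hK', rfl⟩ -
    exact ⟨K ∩ K', hK.inter hK', rfl⟩
  · exact (@MeasurableSpace.generateFrom_measurableSet _ (MeasurableSpace.comap X _)).symm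
  · rw [← hYcomap, (inferInstance : BorelSpace ℝ).measurable_eq]
  · rw [IndepSets_iff]
    rintro _ _ ⟨K, hK, rfl⟩ ⟨_, ⟨t, rfl⟩, rfl⟩
    exact h K hK t

lemma iIndepFun_of_indepFun_succ {Ω E : Type*} [MeasurableSpace Ω] [MeasurableSpace E]
    {P : Measure Ω} [IsProbabilityMeasure P] {X : ℕ → Ω → E}
    (h : ∀ n, IndepFun (fun ω i => X (min i n) ω) (X (n + 1)) P) : iIndepFun X P := by
  classical
  have hrange : ∀ n (B : ℕ → Set E), (∀ i, MeasurableSet (B i)) →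
      P (⋂ i ∈ Finset.range (n + 1), X i ⁻¹' B i) =
        ∏ i ∈ Finset.range (n + 1), P (X i ⁻¹' B i) := by
    intro n B hB
    induction n with
    | zero => simp
    | succ n ih =>
      have hinit : (⋂ i ∈ Finset.range (n + 1), X i ⁻¹' B i) =
          (fun ω i => X (min i n) ω) ⁻¹' (⋂ i ∈ Finset.range (n + 1), {x | x i ∈ B i}) := by
        ext ω
        simp only [Set.mem_iInter, Finset.mem_range, Set.mem_preimage, Set.mem_ofPred_eq]
        refine forall₂_congr fun i hi => ?_
        rw [min_eq_left (Nat.le_of_lt_succ hi)]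
      rw [Finset.prod_range_succ, ← ih, Finset.range_add_one (n := n + 1),
        Finset.set_biInter_insert, Set.inter_comm, hinit,
        (h n).measure_inter_preimage_eq_mul _ _ _ (hB _)]
      exact Finset.measurableSet_biInter _ fun i _ => measurable_pi_apply i (hB i)
  rw [iIndepFun_iff_measure_inter_preimage_eq_mul]
  intro S B hB
  obtain ⟨n, hn⟩ : ∃ n, S ⊆ Finset.range (n + 1) :=
    ⟨S.sup id, fun i hi => Finset.mem_range.2 (Nat.lt_succ_of_le (Finset.le_sup (f := id) hi))⟩
  have hpad := hrange n (fun i => if i ∈ S then B i else Set.univ) fun i => by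
    split_ifs
    exacts [hB i ‹_›, .univ]
  convert hpad using 1
  · congr 1
    ext ω
    simp only [Set.mem_iInter, Set.mem_preimage]
    refine forall_congr' fun i => ?_
    by_cases hi : i ∈ S
    · simp [hi, Finset.mem_range.1 (hn hi)]
    · simp [hi]
  · rw [← Finset.prod_subset hn fun i _ hi => by simp [hi]]
    exact Finset.prod_congr rfl fun i hi => by simp [hi]

section Renewal

open Config

lemma tail_zero (Q : Measure (Config ℝ)) [IsProbabilityMeasure Q] (G : Measure ℝ)
    [IsProbabilityMeasure G] : tail Q G 0 = 1 := by
  simp [tail, tailGiven, upCount]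

namespace IsPoissonLaw

variable {Q : Measure (Config ℝ)} {f : ℝ} {G : Measure ℝ} [IsProbabilityMeasure G]

lemma measure_stoppedEpochs_inter (hQ : IsPoissonLaw Q (intensity f G))
    (hinf : ∀ᵐ M ∂Q, M.upTimes.Infinite) (n : ℕ) {K : Set (ℕ → ℝ)} (hK : MeasurableSet K)
    (t : ℝ) : Q {M | stoppedEpochs n M ∈ K ∧ t < upGap n M} =
      (ENNReal.ofReal f * ∫⁻ a, Q {M | (a, past a M) ∈ epochEvent n K}) * tail Q G t := by
  have := hQ.isProbabilityMeasure
  have hpast : Measurable fun a : ℝ => Q {M | (a, past a M) ∈ epochEvent n K} :=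
    measurable_measure_prodMk_left (s := (fun p : ℝ × Config ℝ => (p.1, past p.1 p.2)) ⁻¹' _)
      ((measurable_fst.prodMk measurable_past) (measurableSet_epochEvent n hK))
  have hev : MeasurableSet {M | stoppedEpochs n M ∈ K ∧ t < upGap n M} :=
    (measurable_stoppedEpochs n hK).inter (measurableSet_lt measurable_const (measurable_upGap n))
  rw [mul_assoc, ← lintegral_mul_const _ hpast,
    ← hQ.lintegral_count_past_restart (measurableSet_epochEvent n hK) measurable_const,
    ← lintegral_indicator_one hev]
  refine lintegral_congr_ae ?_
  filter_upwards [hQ.ae_simple, hinf] with M hM hU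
  exact (hM.measure_epochEvent hU n hK t).symm

-- The constant in `measure_stoppedEpochs_inter` is identified by letting `t = 0`.
theorem measure_stoppedEpochs_inter_eq_mul (hQ : IsPoissonLaw Q (intensity f G))
    (hinf : ∀ᵐ M ∂Q, M.upTimes.Infinite) (n : ℕ) {K : Set (ℕ → ℝ)} (hK : MeasurableSet K)
    (t : ℝ) : Q {M | stoppedEpochs n M ∈ K ∧ t < upGap n M} =
      Q {M | stoppedEpochs n M ∈ K} * tail Q G t := by
  have := hQ.isProbabilityMeasure
  have hpos : Q {M | stoppedEpochs n M ∈ K ∧ 0 < upGap n M} = Q {M | stoppedEpochs n M ∈ K} := by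
    refine measure_congr ?_
    filter_upwards [hQ.ae_simple, hinf] with M hM hU
    exact propext (and_iff_left (hM.upGap_pos hU n))
  rw [hQ.measure_stoppedEpochs_inter hinf n hK t, ← hpos,
    hQ.measure_stoppedEpochs_inter hinf n hK 0, tail_zero, mul_one]

theorem measure_lt_upGap (hQ : IsPoissonLaw Q (intensity f G))
    (hinf : ∀ᵐ M ∂Q, M.upTimes.Infinite) (n : ℕ) (t : ℝ) :
    Q {M | t < upGap n M} = tail Q G t := by
  have := hQ.isProbabilityMeasure
  simpa using hQ.measure_stoppedEpochs_inter_eq_mul hinf n MeasurableSet.univ t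

theorem indepFun_stoppedEpochs_upGap (hQ : IsPoissonLaw Q (intensity f G))
    (hinf : ∀ᵐ M ∂Q, M.upTimes.Infinite) (n : ℕ) :
    IndepFun (stoppedEpochs n) (upGap n) Q := by
  have := hQ.isProbabilityMeasure
  refine indepFun_of_measure_inter_Ioi (measurable_stoppedEpochs n) (measurable_upGap n)
    fun K hK t => ?_
  have h := hQ.measure_stoppedEpochs_inter_eq_mul hinf n hK t
  rwa [← hQ.measure_lt_upGap hinf n t] at h

theorem iIndepFun_epoch_gaps (hQ : IsPoissonLaw Q (intensity f G))
    (hinf : ∀ᵐ M ∂Q, M.upTimes.Infinite) :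
    iIndepFun (fun (n : ℕ) M => if n = 0 then upEpoch 0 M else upEpoch n M - upEpoch (n - 1) M)
      Q := by
  have := hQ.isProbabilityMeasure
  refine iIndepFun_of_indepFun_succ fun n => ?_
  let gaps : (ℕ → ℝ) → ℕ → ℝ := fun x i =>
    if min i n = 0 then x 0 else x (min i n) - x (min i n - 1)
  have hgaps : Measurable gaps := measurable_pi_lambda _ fun i => by
    simp only [gaps]
    split_ifs
    · exact measurable_pi_apply 0
    · exact (measurable_pi_apply _).sub (measurable_pi_apply _)
  convert (hQ.indepFun_stoppedEpochs_upGap hinf n).comp hgaps measurable_id using 1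
  · ext M i
    simp only [gaps, Function.comp_apply, stoppedEpochs]
    by_cases hi : min i n = 0
    · simp [hi]
    · rw [if_neg hi, if_neg hi, min_eq_left (min_le_right i n),
        min_eq_left ((Nat.sub_le _ _).trans (min_le_right i n))]
  · ext M
    simp [upGap]

end IsPoissonLaw

end Renewal

section RenewalEquation

lemma encard_setOf_isGreatest {S : Set ℝ} (hS : S.Finite) :
    ({a | IsGreatest S a}.encard : ℝ≥0∞) = {T : Set ℝ | T.Nonempty}.indicator 1 S := by
  by_cases hne : S.Nonempty
  · have hmax : IsGreatest S (sSup S) :=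
      ⟨hne.csSup_mem hS, fun a ha => le_csSup hS.bddAbove ha⟩
    have hunique : {a | IsGreatest S a} = {sSup S} :=
      Set.eq_singleton_iff_unique_mem.2 ⟨hmax, fun a ha => ha.unique hmax⟩
    simp [hunique, hne]
  · have hempty : {a | IsGreatest S a} = ∅ :=
      Set.eq_empty_of_forall_notMem fun a ha => hne ha.nonempty
    simp [hempty, hne]

namespace Config

/-- The times `a` in `(0, t]` that are vacant when an interval of length `l` starts at time `0` and
those that started before are deleted. -/
def vacantTimes (l t : ℝ) : Set (ℝ × Config ℝ) :=
  {p | p.1 ∈ Set.Ioc 0 t ∧ (p.2.restart (0, l)).Vacant p.1}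

lemma measurableSet_vacantTimes (l t : ℝ) : MeasurableSet (vacantTimes l t) :=
  (measurable_fst measurableSet_Ioc).inter <| measurableSet_vacant.preimage <|
    measurable_fst.prodMk (measurable_restart.comp (measurable_snd.prodMk measurable_const))

lemma Simple.isGreatest_upTimes_restart_iff {M : Config ℝ} (hM : M.Simple) (l t : ℝ) {z : ℝ × ℝ}
    (hz : z ∈ M.atoms) : ((z.1, past z.1 M) ∈ vacantTimes l t ∧
        (M.restart z).upCount (Set.Ioc z.1 t) = 0) ↔
      IsGreatest ((M.restart (0, l)).upTimes ∩ Set.Iic t) z.1 := by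
  have hlater : 0 < z.1 → (M.restart (0, l)).Vacant z.1 →
      ((M.restart z).upCount (Set.Ioc z.1 t) = 0 ↔
        ∀ a ∈ (M.restart (0, l)).upTimes, a ≤ t → a ≤ z.1) := fun hpos hv => by
    have hz' : z ∈ (M.restart (0, l)).atoms := by
      rw [Config.atoms_restart]
      exact Set.mem_insert_of_mem _ ⟨hz, hpos⟩
    rw [← restart_restart M (z := (0, l)) hpos,
      (hM.simple_restart _).upCount_restart_eq_zero_iff hz' hv,
      upCount_Ioc_eq_zero_iff hpos.le]
  constructor
  · rintro ⟨⟨⟨hpos, ht⟩, hv⟩, hup⟩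
    have hv' : (M.restart (0, l)).Vacant z.1 := (vacant_restart_past_iff hpos).1 hv
    refine ⟨⟨⟨hpos, ⟨z, ?_, rfl⟩, hv'⟩, ht⟩, fun a ha => (hlater hpos hv').1 hup a ha.1 ha.2⟩
    rw [Config.atoms_restart]
    exact Set.mem_insert_of_mem _ ⟨hz, hpos⟩
  · rintro ⟨⟨⟨hpos, -, hv⟩, ht⟩, hmax⟩
    exact ⟨⟨⟨hpos, ht⟩, (vacant_restart_past_iff hpos).2 hv⟩,
      (hlater hpos hv).2 fun a ha hat => hmax ⟨ha, hat⟩⟩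

-- The last epoch up to time `t` is the only one that is not followed by another one.
lemma Simple.measure_vacantTimes {M : Config ℝ} (hM : M.Simple) (l t : ℝ) :
    M.val {z | (z.1, past z.1 M) ∈ vacantTimes l t ∧
        (M.restart z).upCount (Set.Ioc z.1 (z.1 + (t - z.1))) = 0} =
      {M | (M.restart (0, l)).upCount (Set.Ioc 0 t) = 0}ᶜ.indicator 1 M := by
  set U := (M.restart (0, l)).upTimes ∩ Set.Iic t
  have hmeas := measurableSet_past_restart (measurableSet_vacantTimes l t)
    (τ := fun a => t - a) (by fun_prop) M
  rw [hM.measure_eq_encard_of_forall hmeas (S := {a | IsGreatest U a}),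
    encard_setOf_isGreatest ((M.restart (0, l)).finite_upTimes t)]
  · have hiff : U.Nonempty ↔ ¬ (M.restart (0, l)).upCount (Set.Ioc 0 t) = 0 := by
      rw [upCount_Ioc_eq_zero_iff le_rfl]
      push Not
      exact ⟨fun ⟨a, ha, hat⟩ => ⟨a, ha, hat, ha.1⟩, fun ⟨a, ha, hat, _⟩ => ⟨a, ha, hat⟩⟩
    exact Set.indicator_eq_indicator hiff rfl
  · rintro a ⟨⟨⟨hpos, ⟨z, hz, rfl⟩, -⟩, -⟩, -⟩
    rw [Config.atoms_restart] at hz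
    rcases hz with rfl | hz
    · exact absurd hpos (lt_irrefl 0)
    · exact ⟨z, hz.1, rfl⟩
  · intro z hz
    rw [Set.mem_ofPred_eq, add_sub_cancel]
    exact hM.isGreatest_upTimes_restart_iff l t hz

end Config

open Config

/-- The probability that no interval started after time `0` contains the time `a`. -/
def vacancy (Q : Measure (Config ℝ)) (a : ℝ) : ℝ≥0∞ :=
  Q {M | M.val ({z | 0 < z.1} ∩ busySet a) = 0}

lemma measurable_vacancy (Q : Measure (Config ℝ)) [SFinite Q] : Measurable (vacancy Q) := by
  have hcount : Measurable fun p : ℝ × Config ℝ => p.2.val ({z | 0 < z.1} ∩ busySet p.1) :=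
    measurable_measure_section measurable_snd
      (S := {q : (ℝ × Config ℝ) × (ℝ × ℝ) | 0 < q.2.1 ∧ q.2.1 < q.1.1 ∧ q.1.1 ≤ q.2.1 + q.2.2})
      ((measurableSet_lt measurable_const measurable_snd.fst).inter
        ((measurableSet_lt measurable_snd.fst measurable_fst.fst).inter
          (measurableSet_le measurable_fst.fst (measurable_snd.fst.add measurable_snd.snd))))
  exact measurable_measure_prodMk_left (hcount (measurableSet_singleton 0))

lemma measure_vacant_restart (Q : Measure (Config ℝ)) (l : ℝ) {a : ℝ} (ha : 0 < a) :
    Q {M | (M.restart (0, l)).Vacant a} = (Set.Iio a).indicator 1 l * vacancy Q a := by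
  have hvacant : ∀ M : Config ℝ, (M.restart (0, l)).Vacant a ↔
      l < a ∧ M.val ({z | 0 < z.1} ∩ busySet a) = 0 := fun M => by
    rw [vacant_restart_iff (z := (0, l)) ha, zero_add,
      M.measure_eq_zero_iff ((measurableSet_after 0).inter (measurableSet_busySet a))]
    exact and_congr_right fun _ => forall₂_congr fun w _ =>
      ⟨fun h hw => (h hw.1 hw.2.1).not_ge hw.2.2,
        fun h h0 hwa => not_le.1 fun hle => h ⟨h0, hwa, hle⟩⟩
  by_cases hl : l < a <;> simp [hvacant, hl, vacancy]

lemma antitone_tail (Q : Measure (Config ℝ)) (G : Measure ℝ) : Antitone (tail Q G) := by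
  intro s t hst
  refine lintegral_mono fun l => measure_mono fun M hM => measure_mono_null ?_ hM
  exact fun z hz => ⟨⟨hz.1.1, hz.1.2.trans hst⟩, hz.2⟩

lemma tail_le_one (Q : Measure (Config ℝ)) [IsProbabilityMeasure Q] (G : Measure ℝ)
    [IsProbabilityMeasure G] (t : ℝ) : tail Q G t ≤ 1 :=
  (lintegral_mono fun _ => prob_le_one).trans (by simp)

namespace IsPoissonLaw

variable {Q : Measure (Config ℝ)} {f : ℝ} {G : Measure ℝ}

lemma tailGiven_equation [IsProbabilityMeasure G] (hQ : IsPoissonLaw Q (intensity f G)) (l t : ℝ) :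
    tailGiven Q l t + ENNReal.ofReal f * ∫⁻ a in Set.Ioc 0 t,
      (Set.Iio a).indicator 1 l * (vacancy Q a * tail Q G (t - a)) = 1 := by
  have := hQ.isProbabilityMeasure
  have hempty : MeasurableSet {M : Config ℝ | (M.restart (0, l)).upCount (Set.Ioc 0 t) = 0} :=
    measurable_upCount_Ioc (measurable_restart.comp (measurable_id.prodMk measurable_const))
      measurable_const measurable_const (measurableSet_singleton 0)
  have hlast := hQ.lintegral_count_past_restart (measurableSet_vacantTimes l t)
    (τ := fun a => t - a) (by fun_prop)
  rw [lintegral_congr_ae (hQ.ae_simple.mono fun M hM => hM.measure_vacantTimes l t),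
    lintegral_indicator_one hempty.compl] at hlast
  have hvacant : ∀ a, Q {M | (a, past a M) ∈ vacantTimes l t} * tail Q G (t - a) =
      (Set.Ioc 0 t).indicator (fun a => (Set.Iio a).indicator 1 l *
        (vacancy Q a * tail Q G (t - a))) a := fun a => by
    by_cases ha : a ∈ Set.Ioc 0 t
    · rw [Set.indicator_of_mem ha, ← mul_assoc, ← measure_vacant_restart Q l ha.1]
      simp only [vacantTimes, Set.mem_ofPred_eq, ha, true_and,
        vacant_restart_past_iff (z := ((0, l) : ℝ × ℝ)) ha.1]
    · rw [Set.indicator_of_notMem ha]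
      simp only [vacantTimes, Set.mem_ofPred_eq, ha, false_and, Set.ofPred_false, measure_empty,
        zero_mul]
  rw [tailGiven, ← lintegral_indicator measurableSet_Ioc, ← lintegral_congr hvacant, ← hlast,
    prob_add_prob_compl hempty]

theorem tail_equation [IsProbabilityMeasure G] (hQ : IsPoissonLaw Q (intensity f G)) (t : ℝ) :
    tail Q G t + ENNReal.ofReal f * ∫⁻ a in Set.Ioc 0 t,
      G (Set.Iio a) * (vacancy Q a * tail Q G (t - a)) = 1 := by
  have := hQ.isProbabilityMeasure
  have hindicator : Measurable fun p : ℝ × ℝ => (Set.Iio p.2).indicator (1 : ℝ → ℝ≥0∞) p.1 :=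
    measurable_one.indicator (measurableSet_lt measurable_fst measurable_snd)
  have hvacancy : Measurable fun a => vacancy Q a * tail Q G (t - a) :=
    (measurable_vacancy Q).mul ((antitone_tail Q G).measurable.comp (by fun_prop))
  have hjoint : Measurable fun p : ℝ × ℝ =>
      (Set.Iio p.2).indicator (1 : ℝ → ℝ≥0∞) p.1 * (vacancy Q p.2 * tail Q G (t - p.2)) :=
    hindicator.mul (hvacancy.comp measurable_snd)
  have hmean := lintegral_congr (μ := G) fun l => hQ.tailGiven_equation l t
  rw [lintegral_add_left (f := fun l => tailGiven Q l t)
      (measurable_tailGiven Q measurable_id measurable_const),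
    lintegral_const_mul _ hjoint.lintegral_prod_right',
    lintegral_lintegral_swap hjoint.aemeasurable, lintegral_one, measure_univ] at hmean
  rw [← hmean, tail]
  congr 3
  ext a
  dsimp only
  rw [lintegral_mul_const _ (measurable_one.indicator measurableSet_Iio),
    lintegral_indicator_one measurableSet_Iio]

end IsPoissonLaw

end RenewalEquation

section EpochRate

open Config

/-- The rate at which intervals start at vacant times, at distance `a` after the start of an
interval with a length of law `G` that is preceded by no other interval. -/
def epochRate (Q : Measure (Config ℝ)) (f : ℝ) (G : Measure ℝ) (a : ℝ) : ℝ :=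
  f * (G.real (Set.Iio a) * (vacancy Q a).toReal)

variable {Q : Measure (Config ℝ)} {f : ℝ} {G : Measure ℝ}

lemma epochRate_nonneg (Q : Measure (Config ℝ)) (hf : 0 ≤ f) (G : Measure ℝ) (a : ℝ) :
    0 ≤ epochRate Q f G a :=
  mul_nonneg hf (mul_nonneg measureReal_nonneg ENNReal.toReal_nonneg)

lemma epochRate_le [IsProbabilityMeasure Q] [IsProbabilityMeasure G] (hf : 0 ≤ f) (a : ℝ) :
    epochRate Q f G a ≤ f :=
  mul_le_of_le_one_right hf
    (mul_le_one₀ measureReal_le_one ENNReal.toReal_nonneg measureReal_le_one)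

lemma measurable_epochRate [SFinite Q] [IsFiniteMeasure G] : Measurable (epochRate Q f G) := by
  have hmono : Monotone fun a => G.real (Set.Iio a) := fun a b h =>
    measureReal_mono (Set.Iio_subset_Iio h)
  exact measurable_const.mul (hmono.measurable.mul (measurable_vacancy Q).ennreal_toReal)

lemma toReal_tail_le_one (Q : Measure (Config ℝ)) [IsProbabilityMeasure Q] (G : Measure ℝ)
    [IsProbabilityMeasure G] (t : ℝ) : (tail Q G t).toReal ≤ 1 :=
  ENNReal.toReal_mono ENNReal.one_ne_top (tail_le_one Q G t)

lemma tail_ne_top (Q : Measure (Config ℝ)) [IsProbabilityMeasure Q] (G : Measure ℝ)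
    [IsProbabilityMeasure G] (t : ℝ) : tail Q G t ≠ ∞ :=
  ne_top_of_le_ne_top ENNReal.one_ne_top (tail_le_one Q G t)

lemma antitone_toReal_tail (Q : Measure (Config ℝ)) [IsProbabilityMeasure Q] (G : Measure ℝ)
    [IsProbabilityMeasure G] : Antitone fun t => (tail Q G t).toReal :=
  fun s _ h => ENNReal.toReal_mono (tail_ne_top Q G s) (antitone_tail Q G h)

lemma measurableSet_pos_inter_busySet (a : ℝ) : MeasurableSet ({z | 0 < z.1} ∩ busySet a) :=
  (measurableSet_after 0).inter (measurableSet_busySet a)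

variable [IsProbabilityMeasure G]

lemma intensity_pos_inter_busySet_ne_top (f : ℝ) (G : Measure ℝ) [IsProbabilityMeasure G] (a : ℝ) :
    intensity f G ({z | 0 < z.1} ∩ busySet a) ≠ ∞ := by
  have hstrip : intensity f G (Prod.fst ⁻¹' Set.Ioo 0 a) ≠ ∞ := by
    rw [intensity_preimage_fst, Real.volume_Ioo]
    exact ENNReal.mul_ne_top ENNReal.ofReal_ne_top ENNReal.ofReal_ne_top
  exact ne_top_of_le_ne_top hstrip (measure_mono fun z hz => ⟨hz.1, hz.2.1⟩)

namespace IsPoissonLaw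

lemma vacancy_eq_exp (hQ : IsPoissonLaw Q (intensity f G)) (a : ℝ) :
    (vacancy Q a).toReal =
      Real.exp (-(intensity f G).real ({z | 0 < z.1} ∩ busySet a)) := by
  rw [vacancy, hQ.measure_void (measurableSet_pos_inter_busySet a)
    (intensity_pos_inter_busySet_ne_top f G a), ENNReal.toReal_ofReal (Real.exp_pos _).le]
  rfl

-- Beyond the longest interval, the busy probability no longer depends on `a`.
lemma vacancy_eq_of_lt (hQ : IsPoissonLaw Q (intensity f G)) (hf : 0 ≤ f) {d a : ℝ}
    (hd : ∀ᵐ l ∂G, l ∈ Set.Icc 0 d) (ha : d < a) :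
    (vacancy Q a).toReal = Real.exp (-(f * ∫ l, l ∂G)) := by
  have hslice : ∀ᵐ l ∂G, volume ((fun x : ℝ => (x, l)) ⁻¹' ({z | 0 < z.1} ∩ busySet a)) =
      ENNReal.ofReal l := by
    filter_upwards [hd] with l hl
    have hIco : (fun x : ℝ => (x, l)) ⁻¹' ({z | 0 < z.1} ∩ busySet a) = Set.Ico (a - l) a := by
      ext x
      refine ⟨fun h => ⟨sub_le_iff_le_add.2 h.2.2, h.2.1⟩, fun h => ⟨?_, h.2, ?_⟩⟩
      · exact (sub_pos.2 (hl.2.trans_lt ha)).trans_le h.1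
      · exact sub_le_iff_le_add.1 h.1
    rw [hIco, Real.volume_Ico, sub_sub_cancel]
  rw [hQ.vacancy_eq_exp, Measure.real, intensity, Measure.smul_apply,
    Measure.prod_apply_symm (measurableSet_pos_inter_busySet a), smul_eq_mul,
    lintegral_congr_ae hslice, ENNReal.toReal_mul, ENNReal.toReal_ofReal hf,
    integral_eq_lintegral_of_nonneg_ae (hd.mono fun l hl => hl.1)
      measurable_id.aestronglyMeasurable]

lemma vacancy_le_exp (hQ : IsPoissonLaw Q (intensity f G)) (hf : 0 ≤ f) {a : ℝ} (ha : 0 ≤ a) :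
    (vacancy Q a).toReal ≤ Real.exp (-(f * (a / 2 * G.real (Set.Ici (a / 2))))) := by
  rw [hQ.vacancy_eq_exp, Real.exp_le_exp, neg_le_neg_iff]
  have hsub : Set.Ioo (a / 2) a ×ˢ Set.Ici (a / 2) ⊆ {z | 0 < z.1} ∩ busySet a := by
    rintro z ⟨⟨hstart, hza⟩, hlength : a / 2 ≤ z.2⟩
    exact ⟨(div_nonneg ha zero_le_two).trans_lt hstart, hza, by linarith⟩
  calc f * (a / 2 * G.real (Set.Ici (a / 2)))
      = (intensity f G).real (Set.Ioo (a / 2) a ×ˢ Set.Ici (a / 2)) := by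
        rw [Measure.real, Measure.real, intensity, Measure.smul_apply, Measure.prod_prod,
          Real.volume_Ioo, sub_half, smul_eq_mul, ENNReal.toReal_mul, ENNReal.toReal_mul,
          ENNReal.toReal_ofReal hf, ENNReal.toReal_ofReal (div_nonneg ha zero_le_two)]
    _ ≤ _ := measureReal_mono hsub (intensity_pos_inter_busySet_ne_top f G a)

lemma epochRate_eq_of_lt (hQ : IsPoissonLaw Q (intensity f G)) (hf : 0 ≤ f) {d a : ℝ}
    (hd : ∀ᵐ l ∂G, l ∈ Set.Icc 0 d) (ha : d < a) :
    epochRate Q f G a = f * Real.exp (-(f * ∫ l, l ∂G)) := by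
  have hfull : ∀ᵐ l ∂G, l ∈ Set.Iio a := hd.mono fun l hl => hl.2.trans_lt ha
  rw [epochRate, hQ.vacancy_eq_of_lt hf hd ha, Measure.real,
    (mem_ae_iff_prob_eq_one measurableSet_Iio).1 hfull, ENNReal.toReal_one, one_mul]

theorem epochRate_le_of_le (hQ : IsPoissonLaw Q (intensity f G)) (hf : 0 < f) {d a : ℝ}
    (hG : ∀ b ∈ Set.Ioc 0 d, G.real (Set.Iio b) ≤ (b / d) ^ 2) (ha : a ∈ Set.Ioc 0 d) :
    epochRate Q f G a ≤ 15 / (f * d ^ 2) := by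
  have hapos : 0 < a := ha.1
  have hd : 0 < d := ha.1.trans_le ha.2
  have hlong : 3 / 4 ≤ G.real (Set.Ici (a / 2)) := by
    have hshort : G.real (Set.Iio (a / 2)) ≤ (a / 2 / d) ^ 2 :=
      hG _ ⟨half_pos ha.1, (half_le_self ha.1.le).trans ha.2⟩
    have hratio : a / 2 / d ≤ 1 / 2 := by
      rw [div_le_iff₀ hd]
      linarith [ha.2]
    have hsquare : (a / 2 / d) ^ 2 ≤ (1 / 2) ^ 2 := by gcongr
    rw [← Set.compl_Iio, probReal_compl_eq_one_sub measurableSet_Iio]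
    linarith
  have hvacancy : (vacancy Q a).toReal ≤ Real.exp (-(3 / 8 * f * a)) := by
    refine (hQ.vacancy_le_exp hf.le ha.1.le).trans (Real.exp_le_exp.2 (neg_le_neg ?_))
    calc 3 / 8 * f * a = f * (a / 2 * (3 / 4)) := by ring
      _ ≤ f * (a / 2 * G.real (Set.Ici (a / 2))) := by gcongr
  have hexp : (3 / 8 * f * a) ^ 2 * Real.exp (-(3 / 8 * f * a)) ≤ 2 := by
    have hpow := Real.pow_div_factorial_le_exp (3 / 8 * f * a) (by positivity) 2
    rw [Nat.factorial_two, Nat.cast_two] at hpow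
    rw [Real.exp_neg, ← div_eq_mul_inv, div_le_iff₀ (Real.exp_pos _)]
    linarith
  calc epochRate Q f G a ≤ f * ((a / d) ^ 2 * Real.exp (-(3 / 8 * f * a))) := by
        rw [epochRate]
        gcongr
        exact hG a ha
    _ = (64 / 9) * ((3 / 8 * f * a) ^ 2 * Real.exp (-(3 / 8 * f * a))) / (f * d ^ 2) := by
        field_simp
        ring
    _ ≤ 15 / (f * d ^ 2) := by
        gcongr
        linarith

theorem toReal_tail_equation (hQ : IsPoissonLaw Q (intensity f G)) (hf : 0 ≤ f) {t : ℝ}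
    (ht : 0 ≤ t) : (tail Q G t).toReal +
      ∫ a in (0 : ℝ)..t, epochRate Q f G a * (tail Q G (t - a)).toReal = 1 := by
  have := hQ.isProbabilityMeasure
  have hrenewal := hQ.tail_equation t
  have hmono : Monotone fun a => G (Set.Iio a) := fun a b h => measure_mono (Set.Iio_subset_Iio h)
  have hmeas : Measurable fun a => G (Set.Iio a) * (vacancy Q a * tail Q G (t - a)) :=
    hmono.measurable.mul
      ((measurable_vacancy Q).mul ((antitone_tail Q G).measurable.comp (by fun_prop)))
  have hfinite : ∀ a, G (Set.Iio a) * (vacancy Q a * tail Q G (t - a)) < ∞ := fun a =>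
    ENNReal.mul_lt_top (measure_lt_top _ _)
      (ENNReal.mul_lt_top (measure_lt_top _ _) (tail_ne_top Q G _).lt_top)
  have hreal := congrArg ENNReal.toReal hrenewal
  rw [ENNReal.toReal_add (tail_ne_top Q G t)
      (ne_top_of_le_ne_top ENNReal.one_ne_top (hrenewal ▸ le_add_self)), ENNReal.toReal_one,
    ENNReal.toReal_mul, ENNReal.toReal_ofReal hf,
    ← integral_toReal hmeas.aemeasurable (Eventually.of_forall hfinite)] at hreal
  rw [← hreal, intervalIntegral.integral_of_le ht, ← integral_const_mul]
  simp only [epochRate, Measure.real, ENNReal.toReal_mul, mul_assoc]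

end IsPoissonLaw

end EpochRate

section ExponentialDecay

lemma abs_intervalIntegral_le_of_eq_zero {h : ℝ → ℝ} {C d t : ℝ} (hC : 0 ≤ C) (hd : 0 ≤ d)
    (hnear : ∀ a ∈ Set.Ioc 0 d, |h a| ≤ C) (hfar : ∀ a, d < a → h a = 0) (ht : 0 ≤ t) :
    |∫ a in (0 : ℝ)..t, h a| ≤ C * d := by
  have htruncate : ∫ a in Set.Ioc 0 t, h a = ∫ a in Set.Ioc 0 (min t d), h a :=
    setIntegral_eq_of_subset_of_forall_sdiff_eq_zero measurableSet_Ioc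
      (Set.Ioc_subset_Ioc_right (min_le_left t d))
      fun a ha => hfar a (not_le.1 fun had => ha.2 ⟨ha.1.1, le_min ha.1.2 had⟩)
  rw [intervalIntegral.integral_of_le ht, htruncate]
  calc ‖∫ a in Set.Ioc 0 (min t d), h a‖ ≤ C * volume.real (Set.Ioc 0 (min t d)) :=
        norm_setIntegral_le_of_norm_le_const measure_Ioc_lt_top fun a ha =>
          hnear a ⟨ha.1, ha.2.trans (min_le_right t d)⟩
    _ = C * min t d := by rw [Real.volume_real_Ioc_of_le (le_min ht hd), sub_zero]
    _ ≤ C * d := by gcongr; exact min_le_right t d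

lemma abs_add_integral_sub_one_le {F ρ : ℝ → ℝ} {g C d t : ℝ} (hF : Measurable F)
    (hF1 : ∀ a, |F a| ≤ 1) (hρ : Measurable ρ) (hd : 0 < d)
    (hnear : ∀ a ∈ Set.Ioc 0 d, |ρ a - g| ≤ C) (hfar : ∀ a, d < a → ρ a = g) (ht : 0 ≤ t)
    (hrenewal : F t + ∫ a in (0 : ℝ)..t, ρ a * F (t - a) = 1) :
    |F t + g * (∫ a in (0 : ℝ)..t, F a) - 1| ≤ C * d := by
  have hC : 0 ≤ C := (abs_nonneg _).trans (hnear d ⟨hd, le_rfl⟩)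
  have hFt : Measurable fun a => F (t - a) := hF.comp (by fun_prop)
  have hnear' : ∀ a ∈ Set.Ioc 0 d, |(ρ a - g) * F (t - a)| ≤ C := fun a ha => by
    rw [abs_mul]
    exact (mul_le_of_le_one_right (abs_nonneg _) (hF1 _)).trans (hnear a ha)
  have hfar' : ∀ a, d < a → (ρ a - g) * F (t - a) = 0 := fun a ha => by
    rw [hfar a ha, sub_self, zero_mul]
  have hdiff_int : IntegrableOn (fun a => (ρ a - g) * F (t - a)) (Set.Ioc 0 t) := by
    refine Measure.integrableOn_of_bounded (M := C) measure_Ioc_lt_top.ne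
      ((hρ.sub_const g).mul hFt).aestronglyMeasurable ?_
    filter_upwards [ae_restrict_mem measurableSet_Ioc] with a ha
    rcases le_or_gt a d with had | had
    · exact hnear' a ⟨ha.1, had⟩
    · rwa [hfar' a had, norm_zero]
  have hconst_int : IntegrableOn (fun a => g * F (t - a)) (Set.Ioc 0 t) :=
    Measure.integrableOn_of_bounded (M := |g|) measure_Ioc_lt_top.ne
      (hFt.const_mul g).aestronglyMeasurable
      (Eventually.of_forall fun a => by
        rw [norm_mul]
        exact mul_le_of_le_one_right (norm_nonneg _) (hF1 _))
  have hsplit : ∫ a in (0 : ℝ)..t, ρ a * F (t - a) =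
      (∫ a in (0 : ℝ)..t, (ρ a - g) * F (t - a)) + g * ∫ a in (0 : ℝ)..t, F a := by
    have hreflect : ∫ a in (0 : ℝ)..t, F a = ∫ a in (0 : ℝ)..t, F (t - a) := by
      rw [intervalIntegral.integral_comp_sub_left, sub_self, sub_zero]
    rw [hreflect, ← intervalIntegral.integral_const_mul, ← intervalIntegral.integral_add
      ((intervalIntegrable_iff_integrableOn_Ioc_of_le ht).2 hdiff_int)
      ((intervalIntegrable_iff_integrableOn_Ioc_of_le ht).2 hconst_int)]
    simp only [← add_mul, sub_add_cancel]
  have hdiff : F t + g * (∫ a in (0 : ℝ)..t, F a) - 1 =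
      -∫ a in (0 : ℝ)..t, (ρ a - g) * F (t - a) := by linarith
  rw [hdiff, abs_neg]
  exact abs_intervalIntegral_le_of_eq_zero hC hd.le hnear' hfar' ht

lemma mul_integral_exp_neg_mul (g s : ℝ) :
    g * (∫ a in (0 : ℝ)..s, Real.exp (-(g * a))) = 1 - Real.exp (-(g * s)) := by
  rw [← intervalIntegral.integral_const_mul, intervalIntegral.integral_eq_sub_of_hasDerivAt
    (fun a _ => hasDerivAt_neg_exp_mul_exp)
    ((by fun_prop : Continuous fun a : ℝ => g * Real.exp (-(g * a))).intervalIntegrable _ _),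
    mul_zero, neg_zero, Real.exp_zero]
  ring

-- Grönwall's inequality for the primitive of `F s - exp (-(g * s))`.
theorem abs_sub_exp_le {F : ℝ → ℝ} {g e : ℝ} (hg : 0 < g) (hF : Antitone F)
    (hFright : ∀ t, ContinuousWithinAt F (Set.Ici t) t)
    (h : ∀ t, 0 ≤ t → |F t + g * (∫ a in (0 : ℝ)..t, F a) - 1| ≤ e) {t : ℝ} (ht : 0 ≤ t) :
    |F t - Real.exp (-(g * t))| ≤ e * Real.exp (g * t) := by
  let D : ℝ → ℝ := fun s => F s - Real.exp (-(g * s))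
  have hexp : Continuous fun s : ℝ => Real.exp (-(g * s)) := by fun_prop
  have hFint : ∀ a b, IntervalIntegrable F volume a b := fun a b => hF.intervalIntegrable
  have hDint : ∀ a b, IntervalIntegrable D volume a b := fun a b =>
    (hFint a b).sub (hexp.intervalIntegrable a b)
  have hDright : ∀ s, ContinuousWithinAt D (Set.Ici s) s := fun s =>
    (hFright s).sub hexp.continuousWithinAt
  have hD : ∀ s, 0 ≤ s → |D s| ≤ g * |∫ a in (0 : ℝ)..s, D a| + e := by
    intro s hs
    have hintegral : ∫ a in (0 : ℝ)..s, D a =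
        (∫ a in (0 : ℝ)..s, F a) - ∫ a in (0 : ℝ)..s, Real.exp (-(g * a)) :=
      intervalIntegral.integral_sub (hFint 0 s) (hexp.intervalIntegrable 0 s)
    have hDs : D s = (F s + g * (∫ a in (0 : ℝ)..s, F a) - 1) - g * ∫ a in (0 : ℝ)..s, D a := by
      rw [hintegral, mul_sub, mul_integral_exp_neg_mul]
      ring
    calc |D s| ≤ |F s + g * (∫ a in (0 : ℝ)..s, F a) - 1| + |g * ∫ a in (0 : ℝ)..s, D a| := by
          rw [hDs]
          exact abs_sub _ _
      _ ≤ g * |∫ a in (0 : ℝ)..s, D a| + e := by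
          rw [abs_mul, abs_of_pos hg, add_comm]
          gcongr
          exact h s hs
  have hgronwall := norm_le_gronwallBound_of_norm_deriv_right_le
    (f := fun s => ∫ a in (0 : ℝ)..s, D a) (f' := D) (δ := 0) (K := g) (ε := e) (a := 0) (b := t)
    (intervalIntegral.continuous_primitive hDint 0).continuousOn
    (fun s _ => intervalIntegral.integral_hasDerivWithinAt_right (t := Set.Ioi s)
      (hDint 0 s) (hF.measurable.sub hexp.measurable).stronglyMeasurable.stronglyMeasurableAtFilter
      ((hDright s).mono Set.Ioi_subset_Ici_self))
    (by simp) (fun s hs => hD s hs.1) t ⟨ht, le_rfl⟩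
  simp only [gronwallBound_of_K_ne_0 hg.ne', sub_zero, zero_mul, zero_add,
    Real.norm_eq_abs] at hgronwall
  calc |D t| ≤ g * |∫ a in (0 : ℝ)..t, D a| + e := hD t ht
    _ ≤ g * (e / g * (Real.exp (g * t) - 1)) + e := by gcongr
    _ = e * Real.exp (g * t) := by
      field_simp
      ring

lemma tendsto_comp_div_of_abs_sub_exp_le {ι : Type*} {l : Filter ι} {F : ι → ℝ → ℝ}
    {g c e : ι → ℝ} (hc : ∀ᶠ i in l, 0 < c i)
    (h : ∀ᶠ i in l, ∀ t, 0 ≤ t → |F i t - Real.exp (-(g i * t))| ≤ e i * Real.exp (g i * t))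
    (hgc : Tendsto (fun i => g i / c i) l (𝓝 1)) (he : Tendsto e l (𝓝 0)) {x : ℝ} (hx : 0 ≤ x) :
    Tendsto (fun i => F i (x / c i)) l (𝓝 (Real.exp (-x))) := by
  have hexponent : Tendsto (fun i => g i * (x / c i)) l (𝓝 x) := by
    simpa only [one_mul, div_mul_eq_mul_div, mul_div_assoc] using hgc.mul_const x
  have hexp : Tendsto (fun i => Real.exp (-(g i * (x / c i)))) l (𝓝 (Real.exp (-x))) :=
    (Real.continuous_exp.tendsto _).comp hexponent.neg
  have herror : Tendsto (fun i => e i * Real.exp (g i * (x / c i))) l (𝓝 0) := by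
    simpa only [zero_mul, Function.comp_def] using
      he.mul ((Real.continuous_exp.tendsto x).comp hexponent)
  have hdiff : Tendsto (fun i => F i (x / c i) - Real.exp (-(g i * (x / c i)))) l (𝓝 0) := by
    refine squeeze_zero_norm' ?_ herror
    filter_upwards [hc, h] with i hci hi using hi _ (div_nonneg hx hci.le)
  simpa only [sub_add_cancel, zero_add] using hdiff.add hexp

end ExponentialDecay

section ConvergenceInDistribution

lemma measureReal_Ioc_eq_sub (μ : Measure ℝ) [IsFiniteMeasure μ] {a b : ℝ} (hab : a ≤ b) :
    μ.real (Set.Ioc a b) = μ.real (Set.Ioi a) - μ.real (Set.Ioi b) := by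
  rw [← measureReal_sdiff (Set.Ioi_subset_Ioi hab) measurableSet_Ioi, Set.Ioi_sdiff_Ioi]

theorem tendstoInDistribution_of_tendsto_measureReal_Ioi {Ω Ω' ι : Type*} [MeasurableSpace Ω]
    [MeasurableSpace Ω'] {P : Measure Ω} [IsProbabilityMeasure P] {P' : Measure Ω'}
    [IsProbabilityMeasure P'] {l : Filter ι} [l.IsCountablyGenerated] {X : ι → Ω → ℝ} {Z : Ω' → ℝ}
    (hX : ∀ i, AEMeasurable (X i) P) (hZ : AEMeasurable Z P')
    (h : ∀ x, Tendsto (fun i => (P.map (X i)).real (Set.Ioi x)) l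
      (𝓝 ((P'.map Z).real (Set.Ioi x)))) :
    TendstoInDistribution X l Z (fun _ => P) P' := by
  refine ⟨hX, hZ, (isPiSystem_Ioc (id : ℝ → ℝ) id).tendsto_probabilityMeasure_of_tendsto_of_mem
    ?_ ?_ ?_⟩
  · rintro _ ⟨a, b, -, rfl⟩
    exact measurableSet_Ioc
  · intro u hu x hx
    obtain ⟨a, b, hab, hsub⟩ := mem_nhds_iff_exists_Ioo_subset.1 (hu.mem_nhds hx)
    obtain ⟨b', hxb, hbb⟩ := exists_between hab.2
    exact ⟨Set.Ioc a b', ⟨a, b', hab.1.trans hxb, rfl⟩, Ioc_mem_nhds hab.1 hxb,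
      fun y hy => hsub ⟨hy.1, hy.2.trans_lt hbb⟩⟩
  · rintro _ ⟨a, b, hab, rfl⟩
    have := fun i => Measure.isProbabilityMeasure_map (hX i)
    have := Measure.isProbabilityMeasure_map hZ
    rw [← NNReal.tendsto_coe]
    change Tendsto (fun i => (P.map (X i)).real (Set.Ioc a b)) l
      (𝓝 ((P'.map Z).real (Set.Ioc a b)))
    simp only [measureReal_Ioc_eq_sub _ (show a ≤ b from hab.le)]
    exact (h a).sub (h b)

lemma expMeasure_one_real_Ioi (x : ℝ) :
    (expMeasure 1).real (Set.Ioi x) = if 0 ≤ x then Real.exp (-x) else 1 := by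
  have := isProbabilityMeasure_expMeasure one_pos
  rw [← Set.compl_Iic, probReal_compl_eq_one_sub measurableSet_Iic, ← cdf_eq_real,
    cdf_expMeasure_eq one_pos]
  split_ifs <;> simp

theorem tendstoInDistribution_expMeasure_one {Ω ι : Type*} [MeasurableSpace Ω] {P : Measure Ω}
    [IsProbabilityMeasure P] {l : Filter ι} [l.IsCountablyGenerated] {X : ι → Ω → ℝ}
    (hX : ∀ i, AEMeasurable (X i) P) (hpos : ∀ᶠ i in l, ∀ᵐ ω ∂P, 0 ≤ X i ω)
    (h : ∀ x, 0 ≤ x → Tendsto (fun i => P.real {ω | x < X i ω}) l (𝓝 (Real.exp (-x)))) :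
    TendstoInDistribution X l id (fun _ => P) (expMeasure 1) := by
  have := isProbabilityMeasure_expMeasure one_pos
  refine tendstoInDistribution_of_tendsto_measureReal_Ioi hX aemeasurable_id fun x => ?_
  have hmap : ∀ i, (P.map (X i)).real (Set.Ioi x) = P.real {ω | x < X i ω} := fun i =>
    map_measureReal_apply_of_aemeasurable (hX i) measurableSet_Ioi
  rw [Measure.map_id, expMeasure_one_real_Ioi]
  simp only [hmap]
  split_ifs with hx
  · exact h x hx
  · refine tendsto_const_nhds.congr' ?_
    filter_upwards [hpos] with i hi
    have huniv : {ω | x < X i ω} =ᵐ[P] Set.univ :=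
      eventuallyEq_univ.2 (hi.mono fun ω hω => (not_le.1 hx).trans_le hω)
    rw [measureReal_congr huniv, probReal_univ]

end ConvergenceInDistribution

namespace IsPoissonLaw

open Config

variable {Q : Measure (Config ℝ)} {f : ℝ} {G : Measure ℝ} [IsProbabilityMeasure G]

lemma toReal_tail_eq_one_sub_cdf (hQ : IsPoissonLaw Q (intensity f G))
    (hinf : ∀ᵐ M ∂Q, M.upTimes.Infinite) (n : ℕ) (t : ℝ) :
    (tail Q G t).toReal = 1 - cdf (Q.map (upGap n)) t := by
  have := hQ.isProbabilityMeasure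
  have := Measure.isProbabilityMeasure_map (μ := Q) (measurable_upGap n).aemeasurable
  rw [cdf_eq_real, ← probReal_compl_eq_one_sub measurableSet_Iic, Set.compl_Iic,
    map_measureReal_apply (measurable_upGap n) measurableSet_Ioi, ← hQ.measure_lt_upGap hinf n t]
  rfl

theorem abs_toReal_tail_sub_exp_le (hQ : IsPoissonLaw Q (intensity f G)) (hf : 0 < f) {d B : ℝ}
    (hd0 : 0 < d) (hd : ∀ᵐ l ∂G, l ∈ Set.Icc 0 d)
    (hB : ∀ a ∈ Set.Ioc 0 d, epochRate Q f G a ≤ B) {t : ℝ} (ht : 0 ≤ t) :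
    |(tail Q G t).toReal - Real.exp (-(f * Real.exp (-(f * ∫ l, l ∂G)) * t))| ≤
      (f * Real.exp (-(f * ∫ l, l ∂G)) + B) * d *
        Real.exp (f * Real.exp (-(f * ∫ l, l ∂G)) * t) := by
  have := hQ.isProbabilityMeasure
  have hinf := hQ.ae_infinite_upTimes hf (hd.mono fun l hl => hl.2)
  refine abs_sub_exp_le (F := fun t => (tail Q G t).toReal) (by positivity)
    (antitone_toReal_tail Q G) (fun t => ?_) (fun t ht => ?_) ht
  · simp only [hQ.toReal_tail_eq_one_sub_cdf hinf 0]
    exact continuousWithinAt_const.sub ((cdf (Q.map (upGap 0))).right_continuous t)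
  · refine abs_add_integral_sub_one_le (antitone_toReal_tail Q G).measurable (fun a => ?_)
      measurable_epochRate hd0 (fun a ha => ?_) (fun a => hQ.epochRate_eq_of_lt hf.le hd) ht
      (hQ.toReal_tail_equation hf.le ht)
    · rw [abs_of_nonneg ENNReal.toReal_nonneg]
      exact toReal_tail_le_one Q G a
    · have hrate := epochRate_nonneg Q hf.le G a
      have hlimit : 0 < f * Real.exp (-(f * ∫ l, l ∂G)) := by positivity
      rw [abs_le]
      constructor <;> linarith [hB a ha]

end IsPoissonLaw

section Coverage

variable {p w β γ : ℝ}

lemma coverageRadius_pos (hp : 0 < p) (hw : 0 < w) (hγ : 0 < γ) : 0 < coverageRadius p w β γ :=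
  Real.rpow_pos_of_pos (by positivity) _

lemma le_snr_iff (hp : 0 < p) (hw : 0 < w) (hβ : 0 < β) (hγ : 0 < γ) (S : Set Plane) (v : ℝ)
    (u : Plane) (t : ℝ) : ENNReal.ofReal γ ≤ snr p w β S v u t ↔
      nodeDistance S v u t ≤ ENNReal.ofReal (coverageRadius p w β γ) := by
  have hw0 : ENNReal.ofReal w ≠ 0 := by simpa using hw
  have hp0 : ENNReal.ofReal p ≠ 0 := by simpa using hp
  have hwγ : ENNReal.ofReal (w * γ) ≠ 0 := by simpa using mul_pos hw hγ
  have hradius : ENNReal.ofReal ((p / (w * γ)) ^ (1 / β)) =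
      (ENNReal.ofReal p / ENNReal.ofReal (w * γ)) ^ (1 / β) := by
    rw [← ENNReal.ofReal_rpow_of_pos (by positivity), ENNReal.ofReal_div_of_pos (by positivity)]
  rw [snr, coverageRadius, hradius, one_div, ENNReal.le_rpow_inv_iff hβ,
    ENNReal.le_div_iff_mul_le (.inl hw0) (.inl ENNReal.ofReal_ne_top),
    ENNReal.le_div_iff_mul_le (.inl hwγ) (.inl ENNReal.ofReal_ne_top), ← ENNReal.ofReal_mul hγ.le,
    mul_comm γ w, ENNReal.rpow_neg, ← div_eq_mul_inv]
  generalize nodeDistance S v u t ^ β = x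
  rcases eq_or_ne x 0 with rfl | hx0
  · simp [ENNReal.div_zero hp0]
  rcases eq_or_ne x ∞ with rfl | hxt
  · simp [ENNReal.top_mul hwγ, mul_pos hw hγ]
  rw [ENNReal.le_div_iff_mul_le (.inl hx0) (.inl hxt), mul_comm]

lemma isClosed_of_finite_inter_closedBall {α : Type*} [MetricSpace α] {S : Set α} (o : α)
    (hS : ∀ R : ℝ, (S ∩ Metric.closedBall o R).Finite) : IsClosed S := by
  refine isClosed_of_closure_subset fun x hx => ?_
  have hball : x ∈ Metric.ball o (dist x o + 1) := Metric.mem_ball.2 (lt_add_one _)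
  have hx' : x ∈ closure (S ∩ Metric.closedBall o (dist x o + 1)) :=
    closure_mono (Set.inter_subset_inter_right S Metric.ball_subset_closedBall)
      (Metric.isOpen_ball.closure_inter ⟨hx, hball⟩)
  exact ((hS _).isClosed.closure_eq ▸ hx').1

lemma infEDist_le_ofReal_iff {α : Type*} [PseudoMetricSpace α] [ProperSpace α] {S : Set α}
    (hS : IsClosed S) (x : α) {r : ℝ} (hr : 0 ≤ r) :
    Metric.infEDist x S ≤ ENNReal.ofReal r ↔ ∃ z ∈ S, dist x z ≤ r := by
  rw [← Metric.mem_cthickening_iff, hS.cthickening_eq_biUnion_closedBall hr]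
  simp only [Set.mem_iUnion₂, Metric.mem_closedBall, exists_prop]

end Coverage

/-- The time during which a node at distance `|y|` from the trajectory stays within distance `r` of
a user with speed `v`; it is `0` if `r ≤ |y|`. -/
def chordDuration (r v y : ℝ) : ℝ := 2 * √(r ^ 2 - y ^ 2) / v

/-- The time at which the node with coordinates `q` comes within distance `r` of a user who moves
along the first axis with speed `v`, together with the time during which it stays there. -/
def passage (r v : ℝ) (q : ℝ × ℝ) : ℝ × ℝ :=
  (q.1 / v - chordDuration r v q.2 / 2, chordDuration r v q.2)

/-- The coordinates of a point of the plane in an orthonormal basis, as a pair. -/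
def coordinates (b : OrthonormalBasis (Fin 2) ℝ Plane) (z : Plane) : ℝ × ℝ :=
  (b.repr z 0, b.repr z 1)

/-- The points within distance `r` of the line through the first vector of the basis `b`. -/
def nearLine (b : OrthonormalBasis (Fin 2) ℝ Plane) (r : ℝ) : Set Plane :=
  {z | (coordinates b z).2 ∈ Set.Icc (-r) r}

section Passage

variable {r v : ℝ}

lemma chordDuration_mem_Icc (hr : 0 ≤ r) (hv : 0 ≤ v) (y : ℝ) :
    chordDuration r v y ∈ Set.Icc 0 (2 * r / v) := by
  have hsqrt : √(r ^ 2 - y ^ 2) ≤ r := Real.sqrt_le_iff.2 ⟨hr, by linarith [sq_nonneg y]⟩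
  refine ⟨by unfold chordDuration; positivity, ?_⟩
  unfold chordDuration
  gcongr

lemma sq_add_sq_le_iff_passage (hr : 0 ≤ r) (hv : 0 < v) (x y t : ℝ) :
    (x - v * t) ^ 2 + y ^ 2 ≤ r ^ 2 ↔ y ∈ Set.Icc (-r) r ∧
      t ∈ Set.Icc (passage r v (x, y)).1 ((passage r v (x, y)).1 + (passage r v (x, y)).2) := by
  have htime : t ∈ Set.Icc (passage r v (x, y)).1
      ((passage r v (x, y)).1 + (passage r v (x, y)).2) ↔ |x - v * t| ≤ √(r ^ 2 - y ^ 2) := by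
    have hstart : (passage r v (x, y)).1 = (x - √(r ^ 2 - y ^ 2)) / v := by
      simp only [passage, chordDuration]
      ring
    have hend : (passage r v (x, y)).1 + (passage r v (x, y)).2 = (x + √(r ^ 2 - y ^ 2)) / v := by
      simp only [passage, chordDuration]
      ring
    rw [hend, hstart, Set.mem_Icc, div_le_iff₀ hv, le_div_iff₀ hv, abs_le]
    constructor <;> rintro ⟨hleft, hright⟩ <;> constructor <;> linarith
  rw [htime, Set.mem_Icc, ← abs_le, ← abs_of_nonneg hr, ← sq_le_sq, abs_of_nonneg hr]
  constructor
  · intro h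
    exact ⟨by linarith [sq_nonneg (x - v * t)], Real.abs_le_sqrt (by linarith)⟩
  · rintro ⟨hy, ht⟩
    have hsq := (Real.le_sqrt (abs_nonneg _) (by linarith)).1 ht
    rw [sq_abs] at hsq
    linarith

variable {b : OrthonormalBasis (Fin 2) ℝ Plane} {S : Set Plane}

lemma dist_userPosition_le_iff (hr : 0 ≤ r) (hv : 0 < v) (z : Plane) (t : ℝ) :
    dist (userPosition v (b 0) t) z ≤ r ↔ z ∈ nearLine b r ∧
      t ∈ Set.Icc (passage r v (coordinates b z)).1
        ((passage r v (coordinates b z)).1 + (passage r v (coordinates b z)).2) := by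
  have hsq : ‖z - userPosition v (b 0) t‖ ^ 2 =
      ((coordinates b z).1 - v * t) ^ 2 + (coordinates b z).2 ^ 2 := by
    rw [← b.repr.norm_map, EuclideanSpace.norm_sq_eq, userPosition]
    simp [coordinates]
  rw [dist_comm, dist_eq_norm, ← sq_le_sq₀ (norm_nonneg _) hr, hsq]
  exact sq_add_sq_le_iff_passage hr hv _ _ t

lemma finite_passage (hr : 0 ≤ r) (hv : 0 < v)
    (hS : ∀ R : ℝ, (S ∩ Metric.closedBall 0 R).Finite) (R : ℝ) :
    {i : ↥(S ∩ nearLine b r) | |(passage r v (coordinates b i)).1| ≤ R}.Finite := by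
  refine Set.Finite.of_finite_image (f := Subtype.val) ?_ Subtype.val_injective.injOn
  refine (hS (v * R + r)).subset ?_
  rintro _ ⟨⟨z, hz, hline⟩, hstart : |(passage r v (coordinates b z)).1| ≤ R, rfl⟩
  refine ⟨hz, mem_closedBall_zero_iff.2 ?_⟩
  set t := (passage r v (coordinates b z)).1
  have hdist : dist (userPosition v (b 0) t) z ≤ r :=
    (dist_userPosition_le_iff hr hv z t).2
      ⟨hline, le_rfl, le_add_of_nonneg_right (chordDuration_mem_Icc hr hv.le _).1⟩
  have hnorm : ‖userPosition v (b 0) t‖ = v * |t| := by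
    rw [userPosition, norm_smul, b.norm_eq_one, mul_one, Real.norm_eq_abs, abs_mul,
      abs_of_pos hv]
  calc ‖z‖ ≤ ‖userPosition v (b 0) t‖ + dist (userPosition v (b 0) t) z := by
        rw [dist_eq_norm]
        exact norm_le_norm_add_norm_sub _ _
    _ ≤ v * R + r := by
        rw [hnorm]
        gcongr

/-- The passages of the nodes in `S`, as a configuration of starting times marked with
durations. -/
def passages (b : OrthonormalBasis (Fin 2) ℝ Plane) (hr : 0 ≤ r) (hv : 0 < v)
    (hS : ∀ R : ℝ, (S ∩ Metric.closedBall 0 R).Finite) : Config ℝ :=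
  ⟨Measure.sum fun i : ↥(S ∩ nearLine b r) => Measure.dirac (passage r v (coordinates b i)),
    _, _, rfl, finite_passage hr hv hS⟩

lemma passages_apply (hr : 0 ≤ r) (hv : 0 < v) (hS : ∀ R : ℝ, (S ∩ Metric.closedBall 0 R).Finite)
    {A : Set (ℝ × ℝ)} (hA : MeasurableSet A) :
    (passages b hr hv hS).val A =
      ((S ∩ {z ∈ nearLine b r | passage r v (coordinates b z) ∈ A}).encard : ℝ≥0∞) := by
  rw [passages, sum_dirac_apply _ hA, ← Subtype.val_injective.encard_image]
  congr 2
  ext z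
  constructor
  · rintro ⟨⟨z, hz, hline⟩, hzA, rfl⟩
    exact ⟨hz, hline, hzA⟩
  · rintro ⟨hz, hline, hzA⟩
    exact ⟨⟨z, hz, hline⟩, hzA, rfl⟩

lemma atoms_passages (hr : 0 ≤ r) (hv : 0 < v)
    (hS : ∀ R : ℝ, (S ∩ Metric.closedBall 0 R).Finite) :
    (passages b hr hv hS).atoms =
      (fun z => passage r v (coordinates b z)) '' (S ∩ nearLine b r) := by
  ext q
  rw [Config.atoms, Set.mem_ofPred_eq, passages_apply hr hv hS (measurableSet_singleton q), ne_eq,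
    ENat.toENNReal_eq_zero, Set.encard_eq_zero, ← ne_eq, ← Set.nonempty_iff_ne_empty]
  exact exists_congr fun z => (and_assoc (a := z ∈ S)).symm

end Passage

namespace Config

/-- Some interval of the configuration contains the time `t`. -/
def Covered (M : Config ℝ) (t : ℝ) : Prop := ∃ z ∈ M.atoms, t ∈ Set.Icc z.1 (z.1 + z.2)

lemma vacant_of_eventually_not_covered {M : Config ℝ} {t : ℝ}
    (h : ∀ᶠ s in 𝓝[<] t, ¬ M.Covered s) : M.Vacant t := by
  refine vacant_iff.2 fun z hz hzt => ?_
  by_contra! hend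
  obtain ⟨s, hs, hzs, hst⟩ := (h.and (Ioo_mem_nhdsLT hzt)).exists
  exact hs ⟨z, hz, hzs.le, hst.le.trans hend⟩

lemma Vacant.eventually_not_covered {M : Config ℝ} {d : ℝ} (hd : ∀ z ∈ M.atoms, z.2 ≤ d) {t : ℝ}
    (h : M.Vacant t) : ∀ᶠ s in 𝓝[<] t, ¬ M.Covered s := by
  have hended : ∀ᶠ s in 𝓝[<] t, ∀ z ∈ M.atoms ∩ {z | |z.1| ≤ |t| + 1 + |d|},
      z.1 < t → z.1 + z.2 < s := by
    refine (Filter.eventually_all_finite (M.finite_atoms _)).2 fun z hz => ?_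
    by_cases hzt : z.1 < t
    · filter_upwards [Ioo_mem_nhdsLT (vacant_iff.1 h z hz.1 hzt)] with s hs _ using hs.1
    · exact Eventually.of_forall fun s hzt' => absurd hzt' hzt
  filter_upwards [hended, Ioo_mem_nhdsLT (sub_one_lt t)] with s hs hst
  rintro ⟨z, hz, hzs, hsz⟩
  have hztime : |z.1| ≤ |t| + 1 + |d| := abs_le.2
    ⟨by linarith [hst.1, neg_abs_le t, le_abs_self d, hd z hz],
      by linarith [hst.2, le_abs_self t, abs_nonneg d]⟩
  exact (hs z ⟨hz, hztime⟩ (hzs.trans_lt hst.2)).not_ge hsz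

lemma setOf_covered_eq_upTimes {M : Config ℝ} {d : ℝ} (hd : ∀ z ∈ M.atoms, z.2 ∈ Set.Icc 0 d) :
    {t | 0 < t ∧ (∀ᶠ s in 𝓝[<] t, ¬ M.Covered s) ∧ M.Covered t} = M.upTimes := by
  ext t
  refine and_congr_right fun _ => ⟨?_, ?_⟩
  · rintro ⟨hbefore, z, hz, hzt, htz⟩
    have hvacant := vacant_of_eventually_not_covered hbefore
    exact ⟨⟨z, hz, hzt.eq_of_not_lt fun hlt => (vacant_iff.1 hvacant z hz hlt).not_ge htz⟩, hvacant⟩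
  · rintro ⟨⟨z, hz, rfl⟩, hvacant⟩
    exact ⟨hvacant.eventually_not_covered fun y hy => (hd y hy).2,
      z, hz, le_rfl, le_add_of_nonneg_right (hd z hz).1⟩

end Config

section Crossings

variable {p w β γ v : ℝ} {b : OrthonormalBasis (Fin 2) ℝ Plane} {S : Set Plane}

lemma covered_passages_iff {r : ℝ} (hr : 0 ≤ r) (hv : 0 < v)
    (hS : ∀ R : ℝ, (S ∩ Metric.closedBall 0 R).Finite) {t : ℝ} :
    (passages b hr hv hS).Covered t ↔ nodeDistance S v (b 0) t ≤ ENNReal.ofReal r := by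
  rw [nodeDistance, infEDist_le_ofReal_iff (isClosed_of_finite_inter_closedBall 0 hS) _ hr,
    Config.Covered, atoms_passages, Set.exists_mem_image]
  simp only [dist_userPosition_le_iff hr hv, Set.mem_inter_iff, and_assoc]

lemma levelCrossing_eq_one_iff {u : Plane} {t : ℝ} :
    levelCrossing p w β γ S v u t = 1 ↔ ENNReal.ofReal γ ≤ snr p w β S v u t := by
  simp [levelCrossing]

lemma levelCrossing_eq_zero_iff {u : Plane} {t : ℝ} :
    levelCrossing p w β γ S v u t = 0 ↔ ¬ ENNReal.ofReal γ ≤ snr p w β S v u t := by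
  simp [levelCrossing]

theorem upCrossings_eq_upTimes (hp : 0 < p) (hw : 0 < w) (hβ : 0 < β) (hγ : 0 < γ) (hv : 0 < v)
    (hS : ∀ R : ℝ, (S ∩ Metric.closedBall 0 R).Finite) :
    upCrossings p w β γ S v (b 0) =
      (passages b (coverageRadius_pos (β := β) hp hw hγ).le hv hS).upTimes := by
  have hr := (coverageRadius_pos (β := β) hp hw hγ).le
  rw [← Config.setOf_covered_eq_upTimes (d := 2 * coverageRadius p w β γ / v)]
  · simp only [upCrossings, levelCrossing_eq_zero_iff, levelCrossing_eq_one_iff,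
      le_snr_iff hp hw hβ hγ, covered_passages_iff]
  · rw [atoms_passages]
    rintro _ ⟨z, -, rfl⟩
    exact chordDuration_mem_Icc hr hv.le _

end Crossings

section ChordLaw

variable {r v : ℝ}

lemma measurable_chordDuration (r v : ℝ) : Measurable (chordDuration r v) := by
  unfold chordDuration
  fun_prop

/-- The law of the time that a node near the line spends within distance `r` of the user: the
distance of such a node to the line is uniformly distributed. -/
def chordLaw (r v : ℝ) : Measure ℝ := (volume[|Set.Icc (-r) r]).map (chordDuration r v)

lemma isProbabilityMeasure_chordLaw (hr : 0 < r) (v : ℝ) :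
    IsProbabilityMeasure (chordLaw r v) := by
  have := cond_isProbabilityMeasure_of_finite (μ := (volume : Measure ℝ)) (s := Set.Icc (-r) r)
    (by simp [hr]) measure_Icc_lt_top.ne
  exact Measure.isProbabilityMeasure_map (measurable_chordDuration r v).aemeasurable

lemma ae_chordLaw_mem_Icc (hr : 0 ≤ r) (hv : 0 ≤ v) :
    ∀ᵐ l ∂chordLaw r v, l ∈ Set.Icc 0 (2 * r / v) :=
  (ae_map_iff (measurable_chordDuration r v).aemeasurable measurableSet_Icc).2
    (Eventually.of_forall fun y => chordDuration_mem_Icc hr hv y)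

lemma le_chordDuration {θ y : ℝ} (hv : 0 ≤ v) (hθ0 : 0 ≤ θ) (hθ1 : θ ≤ 1)
    (hy : |y| ≤ r * (1 - θ ^ 2)) : θ * (2 * r / v) ≤ chordDuration r v y := by
  have hsq : y ^ 2 ≤ (r * (1 - θ ^ 2)) ^ 2 := sq_le_sq' (neg_le_of_abs_le hy) (le_of_abs_le hy)
  have hθsq : (1 - θ ^ 2) ^ 2 ≤ 1 - θ ^ 2 := pow_le_of_le_one
    (sub_nonneg.2 (pow_le_one₀ hθ0 hθ1)) (sub_le_self _ (sq_nonneg θ)) two_ne_zero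
  have hsqrt : r * θ ≤ √(r ^ 2 - y ^ 2) := by
    refine Real.le_sqrt_of_sq_le ?_
    nlinarith [mul_le_mul_of_nonneg_left hθsq (sq_nonneg r)]
  calc θ * (2 * r / v) = 2 * (r * θ) / v := by ring
    _ ≤ chordDuration r v y := by
      unfold chordDuration
      gcongr

-- The duration is at least `a` on the centred interval of proportion `1 - (a / (2 * r / v)) ^ 2`.
lemma chordLaw_real_Iio_le (hr : 0 < r) (hv : 0 < v) {a : ℝ} (ha : a ∈ Set.Ioc 0 (2 * r / v)) :
    (chordLaw r v).real (Set.Iio a) ≤ (a / (2 * r / v)) ^ 2 := by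
  have := isProbabilityMeasure_chordLaw hr v
  obtain ⟨θ, hθ⟩ : ∃ θ, θ = a / (2 * r / v) := ⟨_, rfl⟩
  have hθ0 : 0 ≤ θ := hθ ▸ div_nonneg ha.1.le (by positivity)
  have hθ1 : θ ≤ 1 := hθ ▸ div_le_one_of_le₀ ha.2 (by positivity)
  have hθa : θ * (2 * r / v) = a := by rw [hθ, div_mul_cancel₀ _ (by positivity)]
  have hs : 0 ≤ r * (1 - θ ^ 2) := mul_nonneg hr.le (sub_nonneg.2 (pow_le_one₀ hθ0 hθ1))
  have hsr : r * (1 - θ ^ 2) ≤ r := mul_le_of_le_one_right hr.le (sub_le_self _ (sq_nonneg θ))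
  have hIci : 1 - θ ^ 2 ≤ (chordLaw r v).real (Set.Ici a) := by
    rw [chordLaw, map_measureReal_apply (measurable_chordDuration r v) measurableSet_Ici]
    calc 1 - θ ^ 2 = (volume[|Set.Icc (-r) r]).real
          (Set.Icc (-(r * (1 - θ ^ 2))) (r * (1 - θ ^ 2))) := by
          rw [measureReal_def, cond_apply measurableSet_Icc, Set.inter_eq_right.2
            (Set.Icc_subset_Icc (neg_le_neg hsr) hsr), ENNReal.toReal_mul, ENNReal.toReal_inv,
            ← measureReal_def, ← measureReal_def, Real.volume_real_Icc_of_le (by linarith),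
            Real.volume_real_Icc_of_le (by linarith)]
          field_simp
      _ ≤ _ := measureReal_mono fun y hy => by
          rw [← hθa]
          exact le_chordDuration hv.le hθ0 hθ1 (abs_le.2 hy)
  rw [← Set.compl_Ici, probReal_compl_eq_one_sub measurableSet_Ici, ← hθ]
  linarith

lemma integral_sqrt_sq_sub_sq (hr : 0 ≤ r) :
    ∫ y in (-r)..r, √(r ^ 2 - y ^ 2) = Real.pi * r ^ 2 / 2 := by
  have hscale : ∀ y : ℝ, √(r ^ 2 - (r * y) ^ 2) = r * √(1 - y ^ 2) := fun y => by
    rw [show r ^ 2 - (r * y) ^ 2 = r ^ 2 * (1 - y ^ 2) by ring, Real.sqrt_mul (sq_nonneg r),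
      Real.sqrt_sq hr]
  have hsubst := intervalIntegral.mul_integral_comp_mul_left (a := -1) (b := 1)
    (f := fun y => √(r ^ 2 - y ^ 2)) (c := r)
  simp only [hscale, mul_neg, mul_one, intervalIntegral.integral_const_mul,
    integral_sqrt_one_sub_sq] at hsubst
  rw [← hsubst]
  ring

lemma integral_chordLaw (hr : 0 < r) (v : ℝ) :
    ∫ l, l ∂chordLaw r v = Real.pi * r / (2 * v) := by
  rw [chordLaw, integral_map (f := fun l => l) (measurable_chordDuration r v).aemeasurable
    (by fun_prop), ProbabilityTheory.cond, integral_smul_measure,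
    integral_Icc_eq_integral_Ioc, ← intervalIntegral.integral_of_le (by linarith)]
  simp only [chordDuration, intervalIntegral.integral_div, intervalIntegral.integral_const_mul,
    integral_sqrt_sq_sub_sq hr.le]
  rw [ENNReal.toReal_inv, Real.volume_Icc, ENNReal.toReal_ofReal (by linarith), smul_eq_mul]
  field_simp
  ring

lemma measurable_passage (r v : ℝ) : Measurable (passage r v) :=
  ((measurable_fst.div_const v).sub
    (((measurable_chordDuration r v).comp measurable_snd).div_const 2)).prodMk
    ((measurable_chordDuration r v).comp measurable_snd)

lemma volume_setOf_passage_mem (r : ℝ) (hv : 0 < v) (A : Set (ℝ × ℝ)) (y : ℝ) :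
    volume {x | passage r v (x, y) ∈ A} =
      ENNReal.ofReal v * volume {a | (a, chordDuration r v y) ∈ A} := by
  have haffine : {x | passage r v (x, y) ∈ A} = (fun x => x * v⁻¹) ⁻¹'
      ((fun x => x - chordDuration r v y / 2) ⁻¹' {a | (a, chordDuration r v y) ∈ A}) := rfl
  simp only [haffine, sub_eq_add_neg]
  rw [Real.volume_preimage_mul_right (inv_ne_zero hv.ne'), measure_preimage_add_right, inv_inv,
    abs_of_pos hv]

lemma volume_prod_passage_mem (hr : 0 < r) (hv : 0 < v) {A : Set (ℝ × ℝ)} (hA : MeasurableSet A) :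
    ((volume : Measure ℝ).prod volume) {q | q.2 ∈ Set.Icc (-r) r ∧ passage r v q ∈ A} =
      ENNReal.ofReal (2 * v * r) * ((volume : Measure ℝ).prod (chordLaw r v)) A := by
  have := isProbabilityMeasure_chordLaw hr v
  have hmeas : MeasurableSet {q : ℝ × ℝ | q.2 ∈ Set.Icc (-r) r ∧ passage r v q ∈ A} :=
    (measurable_snd measurableSet_Icc).inter (measurable_passage r v hA)
  have hslice : ∀ y, volume {x : ℝ | y ∈ Set.Icc (-r) r ∧ passage r v (x, y) ∈ A} =
      (Set.Icc (-r) r).indicator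
        (fun y => ENNReal.ofReal v * volume {a | (a, chordDuration r v y) ∈ A}) y := fun y => by
    by_cases hy : y ∈ Set.Icc (-r) r
    · simp only [hy, true_and, Set.indicator_of_mem, volume_setOf_passage_mem r hv]
    · simp [hy]
  have hsection : Measurable fun l : ℝ => volume {a : ℝ | (a, l) ∈ A} :=
    measurable_measure_prodMk_right hA
  have hchord : Measurable fun y => volume {a : ℝ | (a, chordDuration r v y) ∈ A} :=
    hsection.comp (measurable_chordDuration r v)
  have hwidth : volume (Set.Icc (-r) r) = ENNReal.ofReal (2 * r) := by
    rw [Real.volume_Icc, sub_neg_eq_add, two_mul]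
  calc ((volume : Measure ℝ).prod volume) {q | q.2 ∈ Set.Icc (-r) r ∧ passage r v q ∈ A}
      = ∫⁻ y in Set.Icc (-r) r,
          ENNReal.ofReal v * volume {a | (a, chordDuration r v y) ∈ A} := by
        rw [Measure.prod_apply_symm hmeas, ← lintegral_indicator measurableSet_Icc]
        exact lintegral_congr hslice
    _ = ENNReal.ofReal v * (ENNReal.ofReal (2 * r) *
          ∫⁻ l, volume {a | (a, l) ∈ A} ∂chordLaw r v) := by
        rw [lintegral_const_mul _ hchord, chordLaw,
          lintegral_map hsection (measurable_chordDuration r v), ProbabilityTheory.cond,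
          lintegral_smul_measure, hwidth, smul_eq_mul, ← mul_assoc (ENNReal.ofReal (2 * r)),
          ENNReal.mul_inv_cancel (by simpa using hr) ENNReal.ofReal_ne_top, one_mul]
    _ = ENNReal.ofReal (2 * v * r) * ((volume : Measure ℝ).prod (chordLaw r v)) A := by
        rw [Measure.prod_apply_symm hA, ← mul_assoc, ← ENNReal.ofReal_mul hv.le,
          mul_left_comm, mul_assoc]
        rfl

end ChordLaw

section RandomPassages

lemma iIndepFun_map_iff {Ω Ω' ι : Type*} {β : ι → Type*} [MeasurableSpace Ω] [MeasurableSpace Ω']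
    [∀ i, MeasurableSpace (β i)] {P : Measure Ω} {N : Ω → Ω'} (hN : Measurable N)
    {X : ∀ i, Ω' → β i} (hX : ∀ i, Measurable (X i)) :
    iIndepFun X (P.map N) ↔ iIndepFun (fun i ω => X i (N ω)) P := by
  simp only [iIndepFun_iff_measure_inter_preimage_eq_mul]
  refine forall_congr' fun S => forall_congr' fun B => forall_congr' fun hB => ?_
  rw [Measure.map_apply hN (Finset.measurableSet_biInter S fun i hi => hX i (hB i hi)),
    Set.preimage_iInter₂,
    Finset.prod_congr rfl fun i hi => Measure.map_apply hN (hX i (hB i hi))]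
  rfl

variable {r v : ℝ} {b : OrthonormalBasis (Fin 2) ℝ Plane}

lemma measurePreserving_coordinates (b : OrthonormalBasis (Fin 2) ℝ Plane) :
    MeasurePreserving (coordinates b) volume ((volume : Measure ℝ).prod volume) :=
  (volume_preserving_finTwoArrow ℝ).comp
    ((PiLp.volume_preserving_ofLp (Fin 2)).comp b.measurePreserving_repr)

lemma measurableSet_passage_mem (b : OrthonormalBasis (Fin 2) ℝ Plane) (r v : ℝ) {A : Set (ℝ × ℝ)}
    (hA : MeasurableSet A) :
    MeasurableSet {z ∈ nearLine b r | passage r v (coordinates b z) ∈ A} := by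
  have hcoord := (measurePreserving_coordinates b).measurable
  exact (hcoord.snd measurableSet_Icc).inter (hcoord (measurable_passage r v hA))

lemma mul_volume_passage_mem (hr : 0 < r) (hv : 0 < v) {lam : ℝ} (hlam : 0 ≤ lam)
    {A : Set (ℝ × ℝ)} (hA : MeasurableSet A) :
    ENNReal.ofReal lam * volume {z ∈ nearLine b r | passage r v (coordinates b z) ∈ A} =
      intensity (2 * lam * v * r) (chordLaw r v) A := by
  have hmeas : MeasurableSet {q : ℝ × ℝ | q.2 ∈ Set.Icc (-r) r ∧ passage r v q ∈ A} :=
    (measurable_snd measurableSet_Icc).inter (measurable_passage r v hA)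
  have hplane : volume {z ∈ nearLine b r | passage r v (coordinates b z) ∈ A} =
      ((volume : Measure ℝ).prod volume) {q | q.2 ∈ Set.Icc (-r) r ∧ passage r v q ∈ A} :=
    (measurePreserving_coordinates b).measure_preimage hmeas.nullMeasurableSet
  rw [hplane, volume_prod_passage_mem hr hv hA, ← mul_assoc, ← ENNReal.ofReal_mul hlam, intensity,
    Measure.smul_apply, smul_eq_mul]
  ring_nf

variable {Ω : Type*} [MeasurableSpace Ω] {P : Measure Ω} {lam : ℝ} {Φ : Ω → Set Plane}

/-- The passages of the nodes of a Poisson point process, as a random configuration. -/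
def randomPassages (b : OrthonormalBasis (Fin 2) ℝ Plane) (hr : 0 ≤ r) (hv : 0 < v)
    (hΦ : IsPoissonPointProcess Φ lam P) (ω : Ω) : Config ℝ :=
  passages b hr hv (hΦ.locallyFinite ω)

lemma randomPassages_apply (hr : 0 ≤ r) (hv : 0 < v) (hΦ : IsPoissonPointProcess Φ lam P)
    {A : Set (ℝ × ℝ)} (hA : MeasurableSet A) :
    (fun ω => (randomPassages b hr hv hΦ ω).val A) = ENat.toENNReal ∘ fun ω =>
      (Φ ω ∩ {z ∈ nearLine b r | passage r v (coordinates b z) ∈ A}).encard :=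
  funext fun _ => passages_apply hr hv _ hA

lemma measurable_randomPassages (hr : 0 ≤ r) (hv : 0 < v) (hΦ : IsPoissonPointProcess Φ lam P) :
    Measurable (randomPassages b hr hv hΦ) := by
  refine Config.measurable_of_coe fun A hA => ?_
  rw [randomPassages_apply hr hv hΦ hA]
  exact Measurable.of_discrete.comp (hΦ.measurable_count _ (measurableSet_passage_mem b r v hA))

lemma map_randomPassages_apply (hlam : 0 < lam) (hr : 0 < r) (hv : 0 < v)
    (hΦ : IsPoissonPointProcess Φ lam P) {A : Set (ℝ × ℝ)} (hA : MeasurableSet A)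
    (hfin : intensity (2 * lam * v * r) (chordLaw r v) A ≠ ∞) :
    P.map (fun ω => (randomPassages b hr.le hv hΦ ω).val A) =
      poissonCount (intensity (2 * lam * v * r) (chordLaw r v) A) := by
  have hvol := mul_volume_passage_mem (b := b) hr hv hlam.le hA
  have hvol_fin : volume {z ∈ nearLine b r | passage r v (coordinates b z) ∈ A} ≠ ∞ := fun h => by
    rw [h, ENNReal.mul_top (by simpa using hlam)] at hvol
    exact hfin hvol.symm
  have hmeas := measurableSet_passage_mem b r v hA
  rw [randomPassages_apply hr.le hv hΦ hA,
    ← Measure.map_map Measurable.of_discrete (hΦ.measurable_count _ hmeas),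
    (hΦ.law_count _ hmeas hvol_fin).map_eq,
    Measure.map_map Measurable.of_discrete Measurable.of_discrete, poissonCount, ← hvol,
    ENNReal.toNNReal_mul]
  rfl

lemma iIndepFun_randomPassages_apply (hr : 0 ≤ r) (hv : 0 < v)
    (hΦ : IsPoissonPointProcess Φ lam P) {A : ℕ → Set (ℝ × ℝ)} (hA : ∀ i, MeasurableSet (A i))
    (hdisj : Pairwise fun i j => Disjoint (A i) (A j)) :
    iIndepFun (fun i ω => (randomPassages b hr hv hΦ ω).val (A i)) P := by
  rw [funext fun i => randomPassages_apply (b := b) hr hv hΦ (hA i)]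
  exact (hΦ.indep_count _ (fun i => measurableSet_passage_mem b r v (hA i)) fun i j hij =>
    ((hdisj hij).preimage _).mono Set.inter_subset_right Set.inter_subset_right).comp
      (fun _ => ENat.toENNReal) fun _ => Measurable.of_discrete

theorem isPoissonLaw_randomPassages [IsProbabilityMeasure P] (hlam : 0 < lam) (hr : 0 < r)
    (hv : 0 < v) (hΦ : IsPoissonPointProcess Φ lam P) :
    IsPoissonLaw (P.map (randomPassages b hr.le hv hΦ))
      (intensity (2 * lam * v * r) (chordLaw r v)) where
  measure_strip_ne_top j := by
    have := isProbabilityMeasure_chordLaw hr v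
    rw [Config.strip, intensity_preimage_fst, Real.volume_Ico]
    exact ENNReal.mul_ne_top ENNReal.ofReal_ne_top ENNReal.ofReal_ne_top
  map_count A hA hfin := by
    rw [Measure.map_map (Config.measurable_coe hA) (measurable_randomPassages hr.le hv hΦ)]
    exact map_randomPassages_apply hlam hr hv hΦ hA hfin
  iIndepFun_count A hA hdisj := by
    refine (iIndepFun_map_iff (measurable_randomPassages hr.le hv hΦ) fun i =>
      Config.measurable_coe (hA i)).2 ?_
    exact iIndepFun_randomPassages_apply hr.le hv hΦ hA hdisj

end RandomPassages

section UpTimes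

open Config

variable {Ω : Type*} [MeasurableSpace Ω] {P : Measure Ω} {N : Ω → Config ℝ} {f d : ℝ}
  {G : Measure ℝ} [IsProbabilityMeasure G]

namespace IsPoissonLaw

lemma map_upGap_eq {Q : Measure (Config ℝ)} (hQ : IsPoissonLaw Q (intensity f G))
    (hinf : ∀ᵐ M ∂Q, M.upTimes.Infinite) (n : ℕ) : Q.map (upGap n) = Q.map (upGap 0) := by
  have := hQ.isProbabilityMeasure
  have := fun n => Measure.isProbabilityMeasure_map (μ := Q) (measurable_upGap n).aemeasurable
  refine Measure.eq_of_cdf _ _ (StieltjesFunction.ext fun t => ?_)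
  exact sub_right_injective
    ((hQ.toReal_tail_eq_one_sub_cdf hinf n t).symm.trans (hQ.toReal_tail_eq_one_sub_cdf hinf 0 t))

lemma ae_simple_infinite_upTimes (hQ : IsPoissonLaw (P.map N) (intensity f G)) (hN : Measurable N)
    (hf : 0 < f) (hd : ∀ᵐ l ∂G, l ≤ d) : ∀ᵐ ω ∂P, (N ω).Simple ∧ (N ω).upTimes.Infinite :=
  ae_of_ae_map hN.aemeasurable (hQ.ae_simple.and (hQ.ae_infinite_upTimes hf hd))

lemma ae_upEpoch_eq_successive (hQ : IsPoissonLaw (P.map N) (intensity f G)) (hN : Measurable N)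
    (hf : 0 < f) (hd : ∀ᵐ l ∂G, l ≤ d) :
    ∀ᵐ ω ∂P, ∀ n, upEpoch n (N ω) = successive (N ω).upTimes n :=
  (hQ.ae_simple_infinite_upTimes hN hf hd).mono fun _ hω n => hω.1.upEpoch_eq_successive hω.2 n

lemma ae_upGap_eq_sub (hQ : IsPoissonLaw (P.map N) (intensity f G)) (hN : Measurable N)
    (hf : 0 < f) (hd : ∀ᵐ l ∂G, l ≤ d) (n : ℕ) : (fun ω => upGap n (N ω)) =ᵐ[P]
      fun ω => successive (N ω).upTimes (n + 1) - successive (N ω).upTimes n := by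
  filter_upwards [hQ.ae_upEpoch_eq_successive hN hf hd] with ω hω
  rw [upGap, hω, hω]

theorem ae_strictMono_range_successive (hQ : IsPoissonLaw (P.map N) (intensity f G))
    (hN : Measurable N) (hf : 0 < f) (hd : ∀ᵐ l ∂G, l ≤ d) :
    ∀ᵐ ω ∂P, StrictMono (successive (N ω).upTimes) ∧
      Set.range (successive (N ω).upTimes) = (N ω).upTimes := by
  filter_upwards [hQ.ae_simple_infinite_upTimes hN hf hd] with ω hω
  exact ⟨strictMono_successive (N ω).finite_upTimes hω.2,
    range_successive (N ω).finite_upTimes hω.2⟩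

lemma measureReal_lt_successive_sub (hQ : IsPoissonLaw (P.map N) (intensity f G))
    (hN : Measurable N) (hf : 0 < f) (hd : ∀ᵐ l ∂G, l ≤ d) (n : ℕ) (t : ℝ) :
    P.real {ω | t < successive (N ω).upTimes (n + 1) - successive (N ω).upTimes n} =
      (tail (P.map N) G t).toReal := by
  rw [← hQ.measure_lt_upGap (hQ.ae_infinite_upTimes hf hd) n t,
    Measure.map_apply hN (measurableSet_lt measurable_const (measurable_upGap n))]
  refine congrArg ENNReal.toReal (measure_congr ?_)
  filter_upwards [hQ.ae_upGap_eq_sub hN hf hd n] with ω hω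
  exact congrArg (t < ·) hω.symm

lemma identDistrib_successive_sub (hQ : IsPoissonLaw (P.map N) (intensity f G))
    (hN : Measurable N) (hf : 0 < f) (hd : ∀ᵐ l ∂G, l ≤ d) (n : ℕ) :
    IdentDistrib (fun ω => successive (N ω).upTimes (n + 1) - successive (N ω).upTimes n)
      (fun ω => successive (N ω).upTimes 1 - successive (N ω).upTimes 0) P P := by
  have hgap : ∀ n, Measurable fun ω => upGap n (N ω) := fun n => (measurable_upGap n).comp hN
  have hident : IdentDistrib (fun ω => upGap n (N ω)) (fun ω => upGap 0 (N ω)) P P := by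
    refine ⟨(hgap n).aemeasurable, (hgap 0).aemeasurable, ?_⟩
    simpa only [Measure.map_map (measurable_upGap _) hN, Function.comp_def] using
      hQ.map_upGap_eq (hQ.ae_infinite_upTimes hf hd) n
  have hae := hQ.ae_upGap_eq_sub hN hf hd
  exact ((IdentDistrib.of_ae_eq (hgap n).aemeasurable (hae n)).symm.trans hident).trans
    (IdentDistrib.of_ae_eq (hgap 0).aemeasurable (hae 0))

lemma iIndepFun_successive_sub (hQ : IsPoissonLaw (P.map N) (intensity f G))
    (hN : Measurable N) (hf : 0 < f) (hd : ∀ᵐ l ∂G, l ≤ d) :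
    iIndepFun (fun (n : ℕ) ω => if n = 0 then successive (N ω).upTimes 0 else
      successive (N ω).upTimes n - successive (N ω).upTimes (n - 1)) P := by
  have hmeas : ∀ n : ℕ, Measurable fun M : Config ℝ =>
      if n = 0 then upEpoch 0 M else upEpoch n M - upEpoch (n - 1) M := fun n => by
    split_ifs
    · exact measurable_upEpoch 0
    · exact (measurable_upEpoch n).sub (measurable_upEpoch _)
  have hindep := (iIndepFun_map_iff hN hmeas).1
    (hQ.iIndepFun_epoch_gaps (hQ.ae_infinite_upTimes hf hd))
  refine hindep.congr fun n => ?_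
  filter_upwards [hQ.ae_upEpoch_eq_successive hN hf hd] with ω hω
  simp only [hω]

theorem isRenewalProcess_successive (hQ : IsPoissonLaw (P.map N) (intensity f G))
    (hN : Measurable N) (hf : 0 < f) (hd : ∀ᵐ l ∂G, l ≤ d) :
    IsRenewalProcess (fun n ω => successive (N ω).upTimes n) P where
  aemeasurable n := ((measurable_upEpoch n).comp hN).aemeasurable.congr
    ((hQ.ae_upEpoch_eq_successive hN hf hd).mono fun _ hω => hω n)
  nonneg := by
    filter_upwards [hQ.ae_simple_infinite_upTimes hN hf hd] with ω hω
    exact (successive_mem (N ω).finite_upTimes hω.2 0).1.le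
  increasing := (hQ.ae_strictMono_range_successive hN hf hd).mono fun _ hω n =>
    hω.1 n.lt_succ_self
  indep := hQ.iIndepFun_successive_sub hN hf hd
  identDistrib := hQ.identDistrib_successive_sub hN hf hd

end IsPoissonLaw

end UpTimes

section CrossingLimits

lemma exists_orthonormalBasis_apply_eq {𝕜 E ι : Type*} [RCLike 𝕜] [NormedAddCommGroup E]
    [InnerProductSpace 𝕜 E] [FiniteDimensional 𝕜 E] [Fintype ι]
    (hcard : Module.finrank 𝕜 E = Fintype.card ι) (i : ι) {u : E} (hu : ‖u‖ = 1) :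
    ∃ b : OrthonormalBasis ι 𝕜 E, b i = u := by
  have hunit : Orthonormal 𝕜 (({i} : Set ι).domRestrict fun _ => u) :=
    ⟨fun _ => hu, fun j k hjk => absurd (Subsingleton.elim j k) hjk⟩
  obtain ⟨b, hb⟩ := hunit.exists_orthonormalBasis_extension_of_card_eq hcard
  exact ⟨b, hb i rfl⟩

variable {Ω : Type*} [MeasurableSpace Ω] {P : Measure Ω} [IsProbabilityMeasure P]
  {lam v p w β γ : ℝ} {u : Plane} {Φ : Ω → Set Plane}

theorem exists_config_upCrossings_eq_upTimes (hlam : 0 < lam) (hv : 0 < v) (hp : 0 < p)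
    (hw : 0 < w) (hβ : 0 < β) (hu : ‖u‖ = 1) (hγ : 0 < γ) (hΦ : IsPoissonPointProcess Φ lam P) :
    ∃ N : Ω → Config ℝ, Measurable N ∧
      IsPoissonLaw (P.map N) (intensity (2 * lam * v * coverageRadius p w β γ)
        (chordLaw (coverageRadius p w β γ) v)) ∧
      ∀ ω, upCrossings p w β γ (Φ ω) v u = (N ω).upTimes := by
  have hr := coverageRadius_pos (β := β) hp hw hγ
  obtain ⟨b, rfl⟩ := exists_orthonormalBasis_apply_eq (𝕜 := ℝ) (ι := Fin 2) (by simp) 0 hu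
  exact ⟨randomPassages b hr.le hv hΦ, measurable_randomPassages hr.le hv hΦ,
    isPoissonLaw_randomPassages hlam hr hv hΦ,
    fun ω => upCrossings_eq_upTimes hp hw hβ hγ hv (hΦ.locallyFinite ω)⟩

lemma ae_chordLaw_le {r : ℝ} (hr : 0 ≤ r) (hv : 0 ≤ v) : ∀ᵐ l ∂chordLaw r v, l ≤ 2 * r / v :=
  (ae_chordLaw_mem_Icc hr hv).mono fun _ hl => hl.2

theorem ae_strictMono_range_upCrossingTime (hlam : 0 < lam) (hv : 0 < v) (hp : 0 < p) (hw : 0 < w)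
    (hβ : 0 < β) (hu : ‖u‖ = 1) (hγ : 0 < γ) (hΦ : IsPoissonPointProcess Φ lam P) :
    ∀ᵐ ω ∂P, StrictMono (upCrossingTime p w β γ (Φ ω) v u) ∧
      Set.range (upCrossingTime p w β γ (Φ ω) v u) = upCrossings p w β γ (Φ ω) v u := by
  have hr := coverageRadius_pos (β := β) hp hw hγ
  have := isProbabilityMeasure_chordLaw hr v
  obtain ⟨N, hN, hQ, hU⟩ := exists_config_upCrossings_eq_upTimes hlam hv hp hw hβ hu hγ hΦ
  have hT : ∀ ω, upCrossingTime p w β γ (Φ ω) v u = successive (N ω).upTimes := fun ω =>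
    congrArg successive (hU ω)
  simpa only [hT, hU] using
    hQ.ae_strictMono_range_successive hN (by positivity) (ae_chordLaw_le hr.le hv.le)

theorem isRenewalProcess_upCrossingTime (hlam : 0 < lam) (hv : 0 < v) (hp : 0 < p) (hw : 0 < w)
    (hβ : 0 < β) (hu : ‖u‖ = 1) (hγ : 0 < γ) (hΦ : IsPoissonPointProcess Φ lam P) :
    IsRenewalProcess (fun n ω => upCrossingTime p w β γ (Φ ω) v u n) P := by
  have hr := coverageRadius_pos (β := β) hp hw hγ
  have := isProbabilityMeasure_chordLaw hr v
  obtain ⟨N, hN, hQ, hU⟩ := exists_config_upCrossings_eq_upTimes hlam hv hp hw hβ hu hγ hΦ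
  simpa only [hU, upCrossingTime] using
    hQ.isRenewalProcess_successive hN (by positivity) (ae_chordLaw_le hr.le hv.le)

/-- The long-run rate of the up-crossings for a radius of coverage `r`: nodes come within reach at
rate `2 * lam * v * r`, and `exp (-(lam * π * r ^ 2))` is the probability that no node is within
reach. -/
def crossingRate (lam v r : ℝ) : ℝ := 2 * lam * v * r * Real.exp (-(lam * Real.pi * r ^ 2))

/-- The constant in the exponential approximation of the inter-arrival times for a radius of
coverage `r`; it vanishes as `r → 0` by the first term of the minimum, and as `r → ∞` by the
second one. -/
def gapError (lam r : ℝ) : ℝ :=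
  4 * lam * r ^ 2 * Real.exp (-(lam * Real.pi * r ^ 2)) +
    min (4 * lam * r ^ 2) (15 / (4 * lam * r ^ 2))

theorem abs_measureReal_lt_interArrival_sub_exp_le (hlam : 0 < lam) (hv : 0 < v) (hp : 0 < p)
    (hw : 0 < w) (hβ : 0 < β) (hu : ‖u‖ = 1) (hγ : 0 < γ) (hΦ : IsPoissonPointProcess Φ lam P)
    (n : ℕ) {t : ℝ} (ht : 0 ≤ t) :
    |P.real {ω | t < interArrival p w β γ (Φ ω) v u n} -
        Real.exp (-(crossingRate lam v (coverageRadius p w β γ) * t))| ≤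
      gapError lam (coverageRadius p w β γ) *
        Real.exp (crossingRate lam v (coverageRadius p w β γ) * t) := by
  obtain ⟨N, hN, hQ, hU⟩ := exists_config_upCrossings_eq_upTimes hlam hv hp hw hβ hu hγ hΦ
  have hr := coverageRadius_pos (β := β) hp hw hγ
  simp only [interArrival, upCrossingTime, hU]
  generalize coverageRadius p w β γ = r at hQ hr ⊢
  have := isProbabilityMeasure_chordLaw hr v
  have := hQ.isProbabilityMeasure
  have hf : 0 < 2 * lam * v * r := by positivity
  have hrate : crossingRate lam v r =
      2 * lam * v * r * Real.exp (-(2 * lam * v * r * ∫ l, l ∂chordLaw r v)) := by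
    rw [integral_chordLaw hr v, crossingRate]
    field_simp
  have herror : gapError lam r = (crossingRate lam v r +
      min (2 * lam * v * r) (15 / (2 * lam * v * r * (2 * r / v) ^ 2))) * (2 * r / v) := by
    rw [gapError, crossingRate, add_mul, min_mul_of_nonneg _ _ (by positivity)]
    congr 1
    · field_simp
      ring
    · congr 1 <;> field_simp <;> ring
  rw [hQ.measureReal_lt_successive_sub hN hf (ae_chordLaw_le hr.le hv.le), herror, hrate]
  exact hQ.abs_toReal_tail_sub_exp_le hf (by positivity) (ae_chordLaw_mem_Icc hr.le hv.le)
    (fun a ha => le_min (epochRate_le hf.le a) (hQ.epochRate_le_of_le hf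
      (fun _ => chordLaw_real_Iio_le hr hv) ha)) ht

lemma gapError_nonneg (hlam : 0 ≤ lam) (r : ℝ) : 0 ≤ gapError lam r := by
  unfold gapError
  positivity

lemma tendsto_exp_neg_mul_sq (c : ℝ) :
    Tendsto (fun r : ℝ => Real.exp (-(c * r ^ 2))) (𝓝 0) (𝓝 1) :=
  Continuous.tendsto' (by fun_prop) _ _ (by simp)

lemma tendsto_gapError_nhds_zero (hlam : 0 ≤ lam) : Tendsto (gapError lam) (𝓝 0) (𝓝 0) := by
  have hbound : Tendsto (fun r => 4 * lam * r ^ 2 * Real.exp (-(lam * Real.pi * r ^ 2)) +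
      4 * lam * r ^ 2) (𝓝 0) (𝓝 0) := Continuous.tendsto' (by fun_prop) _ _ (by simp)
  exact squeeze_zero (gapError_nonneg hlam)
    (fun r => add_le_add_right (min_le_left _ _) _) hbound

lemma tendsto_gapError_atTop (hlam : 0 < lam) : Tendsto (gapError lam) atTop (𝓝 0) := by
  have hsq : ∀ {c : ℝ}, 0 < c → Tendsto (fun r : ℝ => c * r ^ 2) atTop atTop := fun hc =>
    (tendsto_pow_atTop two_ne_zero).const_mul_atTop hc
  have hexp : Tendsto (fun r => 4 * lam * r ^ 2 * Real.exp (-(lam * Real.pi * r ^ 2)))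
      atTop (𝓝 0) := by
    have hlim := ((Real.tendsto_pow_mul_exp_neg_atTop_nhds_zero 1).comp
      (hsq (c := lam * Real.pi) (by positivity))).const_mul (4 / Real.pi)
    rw [mul_zero] at hlim
    refine hlim.congr fun r => ?_
    simp only [Function.comp_apply]
    field_simp
  have hbound := hexp.add ((hsq (c := 4 * lam) (by positivity)).const_div_atTop 15)
  rw [add_zero] at hbound
  exact squeeze_zero (gapError_nonneg hlam.le)
    (fun r => add_le_add_right (min_le_right _ _) _) hbound

lemma interArrival_of_nonpos (hγ : γ ≤ 0) (S : Set Plane) (u : Plane) (n : ℕ) :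
    interArrival p w β γ S v u n = 0 := by
  have hempty : upCrossings p w β γ S v u = ∅ := by
    rw [Set.eq_empty_iff_forall_notMem]
    rintro t ⟨-, hbelow, -⟩
    obtain ⟨s, hs⟩ := hbelow.exists
    simp [levelCrossing, ENNReal.ofReal_of_nonpos hγ] at hs
  have hsuccessive : ∀ n, successive (∅ : Set ℝ) n = 0 := fun n => by
    cases n <;> simp [successive]
  rw [interArrival, upCrossingTime, upCrossingTime, hempty, hsuccessive, hsuccessive, sub_zero]

lemma aemeasurable_interArrival (hlam : 0 < lam) (hv : 0 < v) (hp : 0 < p) (hw : 0 < w)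
    (hβ : 0 < β) (hu : ‖u‖ = 1) (hΦ : IsPoissonPointProcess Φ lam P) (γ : ℝ) (n : ℕ) :
    AEMeasurable (fun ω => interArrival p w β γ (Φ ω) v u n) P := by
  rcases le_or_gt γ 0 with hγ | hγ
  · simp only [interArrival_of_nonpos hγ]
    exact aemeasurable_const
  · have hT := (isRenewalProcess_upCrossingTime hlam hv hp hw hβ hu hγ hΦ).aemeasurable
    exact (hT (n + 1)).sub (hT n)

theorem tendstoInDistribution_mul_interArrival (hlam : 0 < lam) (hv : 0 < v) (hp : 0 < p)
    (hw : 0 < w) (hβ : 0 < β) (hu : ‖u‖ = 1) (hΦ : IsPoissonPointProcess Φ lam P) (n : ℕ)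
    {l : Filter ℝ} [l.IsCountablyGenerated] {c : ℝ → ℝ} (hl : ∀ᶠ γ in l, 0 < γ)
    (hc : ∀ᶠ γ in l, 0 < c γ)
    (hrate : Tendsto (fun γ => crossingRate lam v (coverageRadius p w β γ) / c γ) l (𝓝 1))
    (herror : Tendsto (fun γ => gapError lam (coverageRadius p w β γ)) l (𝓝 0)) :
    TendstoInDistribution (fun γ ω => c γ * interArrival p w β γ (Φ ω) v u n) l id
      (fun _ => P) (expMeasure 1) := by
  refine tendstoInDistribution_expMeasure_one
    (fun γ => (aemeasurable_interArrival hlam hv hp hw hβ hu hΦ γ n).const_mul _) ?_ fun x hx => ?_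
  · filter_upwards [hl, hc] with γ hγ hcγ
    filter_upwards [(isRenewalProcess_upCrossingTime hlam hv hp hw hβ hu hγ hΦ).increasing]
      with ω hω using mul_nonneg hcγ.le (sub_nonneg.2 (hω n).le)
  · have htail : Tendsto (fun γ => P.real {ω | x / c γ < interArrival p w β γ (Φ ω) v u n}) l
        (𝓝 (Real.exp (-x))) :=
      tendsto_comp_div_of_abs_sub_exp_le
        (F := fun γ t => P.real {ω | t < interArrival p w β γ (Φ ω) v u n}) hc
        (hl.mono fun γ hγ t ht =>
          abs_measureReal_lt_interArrival_sub_exp_le hlam hv hp hw hβ hu hγ hΦ n ht)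
        hrate herror hx
    refine htail.congr' ?_
    filter_upwards [hc] with γ hcγ
    simp only [div_lt_iff₀' hcγ]

lemma tendsto_coverageRadius_atTop (p : ℝ) (hw : 0 < w) (hβ : 0 < β) :
    Tendsto (coverageRadius p w β) atTop (𝓝 0) := by
  have hbase : Tendsto (fun γ => p / (w * γ)) atTop (𝓝 0) :=
    (tendsto_id.const_mul_atTop hw).const_div_atTop p
  have hpow := hbase.rpow_const (p := 1 / β) (.inr (one_div_pos.2 hβ).le)
  rwa [Real.zero_rpow (one_div_pos.2 hβ).ne'] at hpow

lemma tendsto_coverageRadius_nhdsGT_zero (hp : 0 < p) (hw : 0 < w) (hβ : 0 < β) :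
    Tendsto (coverageRadius p w β) (𝓝[>] 0) atTop := by
  have hbase : Tendsto (fun γ : ℝ => p / w * γ⁻¹) (𝓝[>] 0) atTop :=
    tendsto_inv_nhdsGT_zero.const_mul_atTop (div_pos hp hw)
  refine ((tendsto_rpow_atTop (one_div_pos.2 hβ)).comp hbase).congr fun γ => ?_
  rw [Function.comp_apply, coverageRadius, ← div_eq_mul_inv, div_div]

theorem tendstoInDistribution_mul_interArrival_atTop (hlam : 0 < lam) (hv : 0 < v) (hp : 0 < p)
    (hw : 0 < w) (hβ : 0 < β) (hu : ‖u‖ = 1) (hΦ : IsPoissonPointProcess Φ lam P) (n : ℕ) :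
    TendstoInDistribution (fun (γ : ℝ) ω => (2 * lam * v * coverageRadius p w β γ) *
      interArrival p w β γ (Φ ω) v u n) atTop id (fun _ => P) (expMeasure 1) := by
  have hr := tendsto_coverageRadius_atTop p hw hβ
  have hpos : ∀ᶠ γ in atTop, 0 < 2 * lam * v * coverageRadius p w β γ := by
    filter_upwards [eventually_gt_atTop 0] with γ hγ
    have := coverageRadius_pos (β := β) hp hw hγ
    positivity
  refine tendstoInDistribution_mul_interArrival hlam hv hp hw hβ hu hΦ n
    (eventually_gt_atTop 0) hpos ?_ ((tendsto_gapError_nhds_zero hlam.le).comp hr)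
  refine ((tendsto_exp_neg_mul_sq (lam * Real.pi)).comp hr).congr' ?_
  filter_upwards [hpos] with γ hγ
  exact (mul_div_cancel_left₀ _ hγ.ne').symm

theorem tendstoInDistribution_mul_interArrival_nhdsGT_zero (hlam : 0 < lam) (hv : 0 < v)
    (hp : 0 < p) (hw : 0 < w) (hβ : 0 < β) (hu : ‖u‖ = 1) (hΦ : IsPoissonPointProcess Φ lam P)
    (n : ℕ) :
    TendstoInDistribution (fun (γ : ℝ) ω => (2 * lam * v * coverageRadius p w β γ *
        Real.exp (-(lam * Real.pi * coverageRadius p w β γ ^ 2))) *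
      interArrival p w β γ (Φ ω) v u n) (𝓝[>] (0 : ℝ)) id (fun _ => P) (expMeasure 1) := by
  have hpos : ∀ᶠ γ in 𝓝[>] 0, 0 < crossingRate lam v (coverageRadius p w β γ) := by
    filter_upwards [self_mem_nhdsWithin] with γ hγ
    have := coverageRadius_pos (β := β) hp hw hγ
    unfold crossingRate
    positivity
  exact tendstoInDistribution_mul_interArrival hlam hv hp hw hβ hu hΦ n self_mem_nhdsWithin hpos
    (tendsto_const_nhds.congr' (hpos.mono fun γ hγ => (div_self hγ.ne').symm))
    ((tendsto_gapError_atTop hlam).comp (tendsto_coverageRadius_nhdsGT_zero hp hw hβ))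

end CrossingLimits

end PoissonCellular

end

theorem mainTheorem3_general {Ω : Type*} [MeasurableSpace Ω] (P : Measure Ω)
    [IsProbabilityMeasure P]
    (lam v p w β : ℝ) (hlam : 0 < lam) (hv : 0 < v) (hp : 0 < p) (hw : 0 < w) (hβ : 0 < β)
    (u : PoissonCellular.Plane) (hu : ‖u‖ = 1)
    (Φ : Ω → Set PoissonCellular.Plane)
    (hΦ : PoissonCellular.IsPoissonPointProcess Φ lam P) :
    (∀ γ : ℝ, 0 < γ →
      (∀ᵐ ω ∂P, StrictMono (PoissonCellular.upCrossingTime p w β γ (Φ ω) v u) ∧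
        Set.range (PoissonCellular.upCrossingTime p w β γ (Φ ω) v u) =
          PoissonCellular.upCrossings p w β γ (Φ ω) v u) ∧
      PoissonCellular.IsRenewalProcess
        (fun n ω => PoissonCellular.upCrossingTime p w β γ (Φ ω) v u n) P) ∧
    (∀ n : ℕ,
      TendstoInDistribution
        (fun (γ : ℝ) ω => (2 * lam * v * PoissonCellular.coverageRadius p w β γ) *
          PoissonCellular.interArrival p w β γ (Φ ω) v u n)
        atTop id (fun _ => P) (expMeasure 1) ∧
      TendstoInDistribution
        (fun (γ : ℝ) ω => (2 * lam * v * PoissonCellular.coverageRadius p w β γ *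
            Real.exp (-(lam * Real.pi * PoissonCellular.coverageRadius p w β γ ^ 2))) *
          PoissonCellular.interArrival p w β γ (Φ ω) v u n)
        (𝓝[>] (0 : ℝ)) id (fun _ => P) (expMeasure 1)) :=
  ⟨fun _ hγ =>
      ⟨PoissonCellular.ae_strictMono_range_upCrossingTime hlam hv hp hw hβ hu hγ hΦ,
        PoissonCellular.isRenewalProcess_upCrossingTime hlam hv hp hw hβ hu hγ hΦ⟩,
    fun n =>
      ⟨PoissonCellular.tendstoInDistribution_mul_interArrival_atTop hlam hv hp hw hβ hu hΦ n,
        PoissonCellular.tendstoInDistribution_mul_interArrival_nhdsGT_zero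
          hlam hv hp hw hβ hu hΦ n⟩⟩

theorem mainTheorem3 {Ω : Type*} [MeasurableSpace Ω] (P : Measure Ω) [IsProbabilityMeasure P]
    (lam v p w β : ℝ) (hlam : 0 < lam) (hv : 0 < v) (hp : 0 < p) (hw : 0 < w) (hβ : 2 < β)
    (u : PoissonCellular.Plane) (hu : ‖u‖ = 1)
    (Φ : Ω → Set PoissonCellular.Plane)
    (hΦ : PoissonCellular.IsPoissonPointProcess Φ lam P) :
    (∀ γ : ℝ, 0 < γ →
      (∀ᵐ ω ∂P, StrictMono (PoissonCellular.upCrossingTime p w β γ (Φ ω) v u) ∧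
        Set.range (PoissonCellular.upCrossingTime p w β γ (Φ ω) v u) =
          PoissonCellular.upCrossings p w β γ (Φ ω) v u) ∧
      PoissonCellular.IsRenewalProcess
        (fun n ω => PoissonCellular.upCrossingTime p w β γ (Φ ω) v u n) P) ∧
    (∀ n : ℕ,
      TendstoInDistribution
        (fun (γ : ℝ) ω => (2 * lam * v * PoissonCellular.coverageRadius p w β γ) *
          PoissonCellular.interArrival p w β γ (Φ ω) v u n)
        atTop id (fun _ => P) (expMeasure 1) ∧
      TendstoInDistribution
        (fun (γ : ℝ) ω => (2 * lam * v * PoissonCellular.coverageRadius p w β γ *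
            Real.exp (-(lam * Real.pi * PoissonCellular.coverageRadius p w β γ ^ 2))) *
          PoissonCellular.interArrival p w β γ (Φ ω) v u n)
        (𝓝[>] (0 : ℝ)) id (fun _ => P) (expMeasure 1)) :=
  mainTheorem3_general P lam v p w β hlam hv hp hw (by linarith) u hu Φ hΦ
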